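/- Let $M$ be a smooth closed (compact, without boundary) oriented manifold of dimension $n$, let $\mu$ be a smooth positive volume form on $M$, and let $s>n/2$. Let $\mathcal{M}_\mu^s$ be the set of continuous Riemannian metrics on $M$ of Sobolev class $H^s$ whose volume form is $\mu$, and let $\mathcal{D}_\mu^{s+1}$ be the set of $C^1$-diffeomorphisms $\phi$ of $M$ of Sobolev class $H^{s+1}$ with $\phi^*\mu=\mu$ (volumorphisms). Let $X$ be the set of $\mu$-measurable, a.e. positive definite, symmetric $(0,2)$-tensor fields $g$ on $M$, identified when they agree a.e., whose volume form agrees with $\mu$ a.e. and which satisfy $$\int_M \operatorname{tr}\big((\log(g^{-1}h))^2\big)\,d\mu<\infty\quad\text{for all } h\in\mathcal{M}_\mu^s ,$$ with the distance $$\delta(g,h)=\Big(\int_M \operatorname{tr}\big((\log(g^{-1}h))^2\big)\,d\mu\Big)^{1/2}.$$ A geodesic of $(X,\delta)$ is a curve $[0,1]\to X$ whose length equals the distance of its endpoints, a subset of $X$ is convex if any two of its points are joined by a geodesic whose image lies in it, and the convex hull $co(S)$ of $S\subset X$ is the smallest convex subset of $X$ containing $S$. Let $\phi\in\mathcal{D}_\mu^{s+1}$.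 Then pullback by $\phi$ induces a well-defined map $T:X\to X$, $Tg=\phi^*g$. If, for some $p\in X$, the orbit $\{p,Tp,T^2p,\ldots\}$ is bounded in $(X,\delta)$, then there exists a fixed point $g\in X$ of $T$ in the $\delta$-closure of $co\{p,Tp,T^2p,\ldots\}$. Thus $\phi^*g=g$ a.e. on $M$, that is, $\phi$ is an isometry with respect to the measurable Riemannian metric $g$. -/

import Mathlib

open MeasureTheory Set
open scoped Manifold ContDiff ENNReal NNReal SchwartzMap

noncomputable section

namespace FixedVolumeMetrics

/-! ### Geodesics, convex hulls and closures for a distance function -/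

section MetricGeometry

variable {α : Type*} [EDist α]

/-- `γ : [0,1] → α` is a geodesic from `p` to `q`: a curve of length `d(p,q)` joining `p` to `q`,
parametrized proportionally to arc length. Values of `γ` outside `[0,1]` play no role. -/
def IsGeodesic (γ : ℝ → α) (p q : α) : Prop :=
  γ 0 = p ∧ γ 1 = q ∧
    ∀ t ∈ Icc (0 : ℝ) 1, ∀ t' ∈ Icc (0 : ℝ) 1,
      edist (γ t) (γ t') = ENNReal.ofReal |t - t'| * edist p q

/-- A set is convex if any two of its points are joined by a geodesic whose image lies in it. -/
def GeodConvex (C : Set α) : Prop :=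
  ∀ p ∈ C, ∀ q ∈ C, ∃ γ : ℝ → α, IsGeodesic γ p q ∧ ∀ t ∈ Icc (0 : ℝ) 1, γ t ∈ C

/-- The convex hull `co(S)`: the smallest convex set containing `S`. -/
def geodHull (S : Set α) : Set α :=
  ⋂₀ {C | S ⊆ C ∧ GeodConvex C}

/-- The closure of a set with respect to the distance. -/
def distClosure (A : Set α) : Set α :=
  {q | ∀ ε : ℝ≥0∞, 0 < ε → ∃ a ∈ A, edist q a < ε}

/-- Boundedness of a set with respect to the distance. -/
def DistBounded (A : Set α) : Prop :=
  ∃ C : ℝ≥0, ∀ x ∈ A, ∀ y ∈ A, edist x y ≤ C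

end MetricGeometry

/-! ### Matrix logarithm -/

/-- The logarithm of a real matrix that is diagonalizable over `ℝ` with positive eigenvalues
(such as `G⁻¹ * H` with `G`, `H` symmetric positive definite), as a primary matrix function:
`P(B)` with `P` the polynomial interpolating `log` at the eigenvalues of `B`. Thus
`B = Q * diagonal d * Q⁻¹` has logarithm `Q * diagonal (log d) * Q⁻¹`. -/
def matLog {n : ℕ} (B : Matrix (Fin n) (Fin n) ℝ) : Matrix (Fin n) (Fin n) ℝ :=
  Polynomial.aeval B (Lagrange.interpolate B.charpoly.roots.toFinset id Real.log)

/-! ### Sobolev functions on `ℝⁿ` -/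

/-- `f ∈ H^r(ℝⁿ) = W^{r,2}(ℝⁿ)`, for a real order `r ≥ 0`: `f` is square integrable and the
tempered distribution it defines lies in the Bessel potential space of order `r`. -/
def MemHs {n : ℕ} (r : ℝ) (f : EuclideanSpace ℝ (Fin n) → ℝ) : Prop :=
  ∃ u : Lp ℂ 2 (volume : Measure (EuclideanSpace ℝ (Fin n))),
    (u : EuclideanSpace ℝ (Fin n) → ℂ) =ᵐ[volume] (fun y => (f y : ℂ)) ∧
    TemperedDistribution.MemSobolev r 2 (u : 𝓢'(EuclideanSpace ℝ (Fin n), ℂ))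

/-- `f ∈ H^r_loc(U)` for an open set `U ⊆ ℝⁿ`: every localization `χ f` with
`χ ∈ C_c^∞(U)` is in `H^r(ℝⁿ)`. -/
def MemHsLoc {n : ℕ} (r : ℝ) (U : Set (EuclideanSpace ℝ (Fin n)))
    (f : EuclideanSpace ℝ (Fin n) → ℝ) : Prop :=
  ∀ χ : EuclideanSpace ℝ (Fin n) → ℝ, ContDiff ℝ ∞ χ → HasCompactSupport χ → tsupport χ ⊆ U →
    MemHs r (fun y => χ y * f y)

/-! ### Tensor fields on a manifold -/

section Manifold

variable {n : ℕ} {M : Type*} [TopologicalSpace M] [ChartedSpace (EuclideanSpace ℝ (Fin n)) M]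

/-- A chart of the smooth structure of `M`. -/
def IsChart (e : OpenPartialHomeomorph M (EuclideanSpace ℝ (Fin n))) : Prop :=
  e ∈ IsManifold.maximalAtlas (𝓡 n) ∞ M

/-- The coordinate frame `∂₁, …, ∂ₙ` of the chart `e`, at the point with coordinates `y`. -/
def chartFrame (e : OpenPartialHomeomorph M (EuclideanSpace ℝ (Fin n)))
    (y : EuclideanSpace ℝ (Fin n)) (i : Fin n) : TangentSpace (𝓡 n) (e.symm y) :=
  mfderiv (𝓡 n) (𝓡 n) e.symm y (EuclideanSpace.single i (1 : ℝ) : EuclideanSpace ℝ (Fin n))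

/-- A basis of the tangent space at `x` (the coordinate frame of the preferred chart at `x`). -/
def stdFrame (x : M) (i : Fin n) : TangentSpace (𝓡 n) x :=
  (EuclideanSpace.single i (1 : ℝ) : EuclideanSpace ℝ (Fin n))

variable (n M) in
/-- A (rough) `(0,2)`-tensor field: a bilinear form on each tangent space, with no regularity. -/
abbrev TwoTensor : Type _ :=
  (x : M) → TangentSpace (𝓡 n) x →ₗ[ℝ] TangentSpace (𝓡 n) x →ₗ[ℝ] ℝ

/-- The Gram matrix `(g_x(v_i, v_j))`. -/
def gram {x : M} (b : TangentSpace (𝓡 n) x →ₗ[ℝ] TangentSpace (𝓡 n) x →ₗ[ℝ] ℝ)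
    (v : Fin n → TangentSpace (𝓡 n) x) : Matrix (Fin n) (Fin n) ℝ :=
  Matrix.of fun i j => b (v i) (v j)

/-- The matrix of components of `g` in the chart `e`, at the point with coordinates `y`. -/
def chartCoeff (g : TwoTensor n M) (e : OpenPartialHomeomorph M (EuclideanSpace ℝ (Fin n)))
    (y : EuclideanSpace ℝ (Fin n)) : Matrix (Fin n) (Fin n) ℝ :=
  gram (g (e.symm y)) (chartFrame e y)

/-- Symmetric and positive definite. -/
def IsSymmPosDef {x : M} (b : TangentSpace (𝓡 n) x →ₗ[ℝ] TangentSpace (𝓡 n) x →ₗ[ℝ] ℝ) : Prop :=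
  (∀ v w, b v w = b w v) ∧ ∀ v, v ≠ 0 → 0 < b v v

/-- The pullback `(φ^* g)_x(v, w) = g_{φ(x)}(dφ_x v, dφ_x w)`. -/
def pullback (φ : M → M) (g : TwoTensor n M) : TwoTensor n M := fun x =>
  (g (φ x)).compl₁₂ (mfderiv (𝓡 n) (𝓡 n) φ x).toLinearMap (mfderiv (𝓡 n) (𝓡 n) φ x).toLinearMap

/-- The integrand `tr((log(g⁻¹h))²)` at `x`. It does not depend on the frame in which the matrices
of `g_x` and `h_x` are taken. -/
def trLogSq (g h : TwoTensor n M) (x : M) : ℝ :=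
  (matLog ((gram (g x) (stdFrame x))⁻¹ * gram (h x) (stdFrame x)) ^ 2).trace

end Manifold

/-! ### Volume forms -/

/-- A volume form on `M`: a smooth nowhere vanishing `n`-form. The manifold is given the
orientation for which the form is positive. -/
structure VolumeForm (n : ℕ) (M : Type*) [TopologicalSpace M]
    [ChartedSpace (EuclideanSpace ℝ (Fin n)) M] where
  /-- the alternating form on each tangent space -/
  form : (x : M) → TangentSpace (𝓡 n) x [⋀^Fin n]→ₗ[ℝ] ℝ
  ne_zero : ∀ x, form x ≠ 0
  smooth : ∀ e : OpenPartialHomeomorph M (EuclideanSpace ℝ (Fin n)), IsChart e →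
    ContDiffOn ℝ ∞ (fun y => form (e.symm y) (chartFrame e y)) e.target

section Volume

variable {n : ℕ} {M : Type*} [TopologicalSpace M] [ChartedSpace (EuclideanSpace ℝ (Fin n)) M]

/-- The measure `|μ(∂₁, …, ∂ₙ)| dy¹ ⋯ dyⁿ` on the domain of the chart `e`. -/
def VolumeForm.chartMeasure [MeasurableSpace M] (μ : VolumeForm n M)
    (e : OpenPartialHomeomorph M (EuclideanSpace ℝ (Fin n))) : Measure M :=
  (((volume : Measure (EuclideanSpace ℝ (Fin n))).restrict e.target).withDensity
    fun y => ENNReal.ofReal |μ.form (e.symm y) (chartFrame e y)|).map e.symm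

/-- The measure defined by a volume form: the smallest measure that dominates the measures
`|μ(∂₁, …, ∂ₙ)| dy¹ ⋯ dyⁿ` of all charts. As these agree on overlaps, it is the measure whose
restriction to the domain of each chart is that measure. -/
def VolumeForm.measure [MeasurableSpace M] (μ : VolumeForm n M) : Measure M :=
  ⨆ (e : OpenPartialHomeomorph M (EuclideanSpace ℝ (Fin n))) (_ : IsChart e), μ.chartMeasure e

/-- The volume form of the metric `b` on `T_xM` is `μ_x`: for the orientation defined by `μ`,
the volume form of `b` is `± √(det b(v_i, v_j))`, with the sign `+` exactly when `v` is positively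
oriented, i.e. `μ_x(v) > 0`. -/
def VolumeForm.AgreesAt (μ : VolumeForm n M) {x : M}
    (b : TangentSpace (𝓡 n) x →ₗ[ℝ] TangentSpace (𝓡 n) x →ₗ[ℝ] ℝ) : Prop :=
  ∀ v : Fin n → TangentSpace (𝓡 n) x, |μ.form x v| = Real.sqrt (gram b v).det

/-- `𝓜_μ^s`: the Riemannian metrics on `M` (continuous, symmetric and positive definite tensor
fields) that are of Sobolev class `H^s` and have volume form `μ`. -/
def sobolevMetrics (μ : VolumeForm n M) (s : ℝ) : Set (TwoTensor n M) :=
  {h | (∀ x, IsSymmPosDef (h x)) ∧ (∀ x, μ.AgreesAt (h x)) ∧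
    ∀ e : OpenPartialHomeomorph M (EuclideanSpace ℝ (Fin n)), IsChart e → ∀ i j,
      ContinuousOn (fun y => chartCoeff h e y i j) e.target ∧
      MemHsLoc s e.target (fun y => chartCoeff h e y i j)}

/-- `𝓓_μ^r`: the `C¹` diffeomorphisms of `M` that are of Sobolev class `H^r` and preserve the
volume form, `φ^* μ = μ`. -/
structure IsSobolevVolumorphism (μ : VolumeForm n M) (r : ℝ)
    (φ : M ≃ₘ^1⟮𝓡 n, 𝓡 n⟯ M) : Prop where
  sobolev : ∀ e e' : OpenPartialHomeomorph M (EuclideanSpace ℝ (Fin n)), IsChart e → IsChart e' →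
    ∀ i, MemHsLoc r (e.target ∩ e.symm ⁻¹' (φ ⁻¹' e'.source)) (fun y => e' (φ (e.symm y)) i)
  preserves : ∀ (x : M) (v : Fin n → TangentSpace (𝓡 n) x),
    μ.form (φ x) (fun i => mfderiv (𝓡 n) (𝓡 n) φ x (v i)) = μ.form x v

/-! ### The space `(X, δ)` -/

variable [MeasurableSpace M]

/-- `δ(g, h) = (∫_M tr((log(g⁻¹h))²) dμ)^{1/2}`, as an element of `[0, ∞]`. -/
def fieldDist (μ : VolumeForm n M) (g h : TwoTensor n M) : ℝ≥0∞ :=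
  (∫⁻ x, ENNReal.ofReal (trLogSq g h x) ∂μ.measure) ^ (1 / 2 : ℝ)

/-- The tensor fields representing the points of `X`: `μ`-measurable, a.e. symmetric and positive
definite, with volume form agreeing with `μ` a.e., and with `∫_M tr((log(g⁻¹h))²) dμ < ∞` for all
`h ∈ 𝓜_μ^s`. -/
def roughMetrics (μ : VolumeForm n M) (s : ℝ) : Set (TwoTensor n M) :=
  {g | (∀ e : OpenPartialHomeomorph M (EuclideanSpace ℝ (Fin n)), IsChart e → ∀ i j,
        AEMeasurable (fun y => chartCoeff g e y i j) (volume.restrict e.target)) ∧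
      (∀ᵐ x ∂μ.measure, IsSymmPosDef (g x)) ∧
      (∀ᵐ x ∂μ.measure, μ.AgreesAt (g x)) ∧
      ∀ h ∈ sobolevMetrics μ s, ∫⁻ x, ENNReal.ofReal (trLogSq g h x) ∂μ.measure < ⊤}

/-- Equality `μ`-almost everywhere. -/
def roughSetoid (μ : VolumeForm n M) (s : ℝ) : Setoid (roughMetrics μ s) where
  r g h := ∀ᵐ x ∂μ.measure, g.1 x = h.1 x
  iseqv :=
    { refl := fun _ => ae_of_all _ fun _ => rfl
      symm := fun h => h.mono fun _ hx => hx.symm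
      trans := fun h h' => by filter_upwards [h, h'] with x hx hx' using hx.trans hx' }

/-- The space `X`: tensor fields as above, identified when they agree `μ`-a.e. -/
def RoughSpace (μ : VolumeForm n M) (s : ℝ) : Type _ :=
  Quotient (roughSetoid μ s)

/-- The point of `X` represented by the tensor field `g`. -/
def RoughSpace.mk {μ : VolumeForm n M} {s : ℝ} (g : TwoTensor n M) (hg : g ∈ roughMetrics μ s) :
    RoughSpace μ s :=
  Quotient.mk (roughSetoid μ s) ⟨g, hg⟩

/-- The distance `δ` on `X`. -/
instance (μ : VolumeForm n M) (s : ℝ) : EDist (RoughSpace μ s) where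
  edist := Quotient.lift₂ (s₁ := roughSetoid μ s) (s₂ := roughSetoid μ s)
    (fun g h => fieldDist μ g.1 h.1) (by
      intro g h g' h' hg hh
      have hg : ∀ᵐ x ∂μ.measure, g.1 x = g'.1 x := hg
      have hh : ∀ᵐ x ∂μ.measure, h.1 x = h'.1 x := hh
      unfold fieldDist
      congr 1
      apply lintegral_congr_ae
      filter_upwards [hg, hh] with x hx hx'
      simp only [trLogSq, hx, hx'])

/-- `T : X → X` is the action of `φ` by pullback: `T [g] = [φ^* g]` for every representative `g`. -/
def IsPullbackAction (μ : VolumeForm n M) (s : ℝ) (φ : M → M)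
    (T : RoughSpace μ s → RoughSpace μ s) : Prop :=
  ∀ (g : TwoTensor n M) (hg : g ∈ roughMetrics μ s),
    ∃ hg' : pullback φ g ∈ roughMetrics μ s,
      T (RoughSpace.mk g hg) = RoughSpace.mk (pullback φ g) hg'

end Volume

end FixedVolumeMetrics

end

/-!
A volumorphism `φ` acts on `X` by isometries, and `X` is a complete space of nonpositive curvature
(CAT(0)), up to the fact that some distances might be infinite. In such a space an isometry with a
bounded orbit has a fixed point in the closure of the convex hull of the orbit.

**Nonpositive curvature.** In each tangent space, the distance is the distance
`d(A, B)² = tr((log(A⁻¹B))²)` of positive definite matrices (`logDistSq`). It is invariant under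
congruences, and two matrices can be diagonalized simultaneously by a congruence; so `A` and `B`
lie in a flat subspace, which contains the geodesic between them, and the determinant is constant
along it if `det A = det B`. The comparison of `d` with the Frobenius norm,
`‖log B - log A‖ ≤ d(A, B)` (`frobSq_matLog_sub_le`), with equality if `A` or `B` is the identity,
is the source of everything else. In a frame in which the common point is the identity it yields
the triangle inequality (`sqrt_logDistSq_triangle`) and the Bruhat–Tits inequality
(`IsGeodesicPoint.convex`), and from the latter uniqueness and continuity of geodesics. The comparison is
first proved up to terms of higher order, by comparing both sides with `tr(A⁻¹B) + tr(B⁻¹A) - 2n`, and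
then in general by subdividing a geodesic.

**The space `X`.** Geodesics of `X` are formed pointwise, and the Bruhat–Tits inequality for `δ`
follows by integration (`hasConvexGeodesics_roughSpace`). A sequence that is Cauchy at a geometric
rate converges almost everywhere, and by Fatou's lemma in `δ` (`exists_limit_of_controlled`). As
the tensor fields are measurable in charts, while almost everywhere refers to the measure of the
volume form, this requires that the measure have the expected expression in each chart. By the
change of variables formula this holds for the smooth charts in its definition and, more
generally, for `C¹` charts (`IsC1Chart.measure_eq_chartMeasure`). If `e` is a chart then `e ∘ φ` is
a `C¹` chart, in which `φ^* g` has the components of `g` in `e`. Hence `φ` preserves the measure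
(`PreservesForm.measurePreserving`), pullbacks are measurable, and `δ(φ^* g, φ^* h) = δ(g, h)`.

**Invariance of `X`.** For `g ∈ X` and a Sobolev metric `h`, `δ(φ^* g, h) = δ(g, (φ⁻¹)^* h)`. The
latter is finite, since `(φ⁻¹)^* h` is a continuous metric, although perhaps not of class `H^s`,
and hence at finite distance from `h` because `M` is compact (`fieldDist_pullback_lt_top`).

**The fixed point** (`HasConvexGeodesics.exists_fixedPoint`). The squared asymptotic radius
`limsup d(Tᵏp, x)²` of the orbit is a uniformly convex function of `x` by the Bruhat–Tits
inequality, so that minimizing sequences in the convex hull of the orbit converge to one and the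
same point of the closure. As `T` preserves the function and the convex hull, it fixes this point.
-/

namespace FixedVolumeMetrics

/-! ### Diagonalization of positive definite matrices -/

section MatrixGeometry

open Matrix Filter Topology

variable {n : ℕ}

theorem exists_orthogonal_diagonalization {A : Matrix (Fin n) (Fin n) ℝ} (hA : Aᵀ = A) :
    ∃ (U : Matrix (Fin n) (Fin n) ℝ) (a : Fin n → ℝ),
      Uᵀ * U = 1 ∧ U * Uᵀ = 1 ∧ A = Uᵀ * diagonal a * U := by
  have hH : A.IsHermitian := by rw [IsHermitian, conjTranspose_eq_transpose_of_trivial, hA]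
  have h1 : star (hH.eigenvectorUnitary : Matrix (Fin n) (Fin n) ℝ) * hH.eigenvectorUnitary = 1 :=
    Unitary.coe_star_mul_self _
  have h2 : (hH.eigenvectorUnitary : Matrix (Fin n) (Fin n) ℝ) * star
    (hH.eigenvectorUnitary : Matrix (Fin n) (Fin n) ℝ) = 1 := Unitary.coe_mul_star_self _
  have h3 := hH.spectral_theorem
  rw [Unitary.conjStarAlgAut_apply] at h3
  rw [star_eq_conjTranspose, conjTranspose_eq_transpose_of_trivial] at h1 h2 h3
  refine ⟨(hH.eigenvectorUnitary : Matrix (Fin n) (Fin n) ℝ)ᵀ, hH.eigenvalues, ?_, ?_, ?_⟩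
  · rw [transpose_transpose, h2]
  · rw [transpose_transpose, h1]
  · rw [transpose_transpose]
    exact h3

theorem posDef_transpose_mul_diagonal_mul {Q : Matrix (Fin n) (Fin n) ℝ} (hQ : IsUnit Q)
    (s : Fin n → ℝ) : (Qᵀ * diagonal (fun i => Real.exp (s i)) * Q).PosDef := by
  have := (Matrix.IsUnit.posDef_star_left_conjugate_iff (x := diagonal (fun i => Real.exp (s i)))
    hQ).2 (PosDef.diagonal fun i => Real.exp_pos _)
  rwa [star_eq_conjTranspose, conjTranspose_eq_transpose_of_trivial] at this

theorem exists_orthogonal_exp {A : Matrix (Fin n) (Fin n) ℝ} (hA : A.PosDef) :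
    ∃ (U : Matrix (Fin n) (Fin n) ℝ) (a : Fin n → ℝ),
      Uᵀ * U = 1 ∧ U * Uᵀ = 1 ∧ A = Uᵀ * diagonal (fun i => Real.exp (a i)) * U := by
  have hAt : Aᵀ = A := by
    rw [← conjTranspose_eq_transpose_of_trivial]; exact hA.isHermitian
  obtain ⟨U, a, h1, h2, h3⟩ := exists_orthogonal_diagonalization hAt
  have hpos : (diagonal a).PosDef := by
    have hU : IsUnit Uᵀ := IsUnit.of_mul_eq_one _ h1
    have := (Matrix.IsUnit.posDef_star_left_conjugate_iff (x := A) hU).2 hA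
    rw [star_eq_conjTranspose, conjTranspose_eq_transpose_of_trivial, transpose_transpose,
      h3] at this
    have e : U * (Uᵀ * diagonal a * U) * Uᵀ = (U * Uᵀ) * diagonal a * (U * Uᵀ) := by
      simp only [Matrix.mul_assoc]
    rwa [e, h2, Matrix.one_mul, Matrix.mul_one] at this
  rw [posDef_diagonal_iff] at hpos
  refine ⟨U, fun i => Real.log (a i), h1, h2, ?_⟩
  simp only [Real.exp_log (hpos _)]
  exact h3

/-- Two positive definite matrices can be diagonalized simultaneously by a congruence. -/
theorem exists_simultaneous_diagonalization {A B : Matrix (Fin n) (Fin n) ℝ}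
    (hA : A.PosDef) (hB : B.PosDef) :
    ∃ (Q : Matrix (Fin n) (Fin n) ℝ) (s : Fin n → ℝ), IsUnit Q ∧ A = Qᵀ * Q ∧
      B = Qᵀ * diagonal (fun i => Real.exp (s i)) * Q := by
  obtain ⟨U, a, h1, h2, h3⟩ := exists_orthogonal_exp hA
  set R := diagonal (fun i => Real.exp (a i / 2)) * U with hR
  set R' := Uᵀ * diagonal (fun i => Real.exp (-(a i / 2))) with hR'
  have hRR' : R * R' = 1 := by
    calc R * R' = diagonal (fun i => Real.exp (a i / 2)) * (U * Uᵀ) *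
          diagonal (fun i => Real.exp (-(a i / 2))) := by simp only [hR, hR', Matrix.mul_assoc]
      _ = 1 := by
        rw [h2, Matrix.mul_one, diagonal_mul_diagonal]
        simp [← Real.exp_add]
  have hR'R : R' * R = 1 := mul_eq_one_comm.1 hRR'
  have hAR : A = Rᵀ * R := by
    rw [h3, hR, transpose_mul, diagonal_transpose]
    calc _ = Uᵀ * (diagonal (fun i => Real.exp (a i / 2)) *
          diagonal (fun i => Real.exp (a i / 2))) * U := by
            rw [diagonal_mul_diagonal]; simp only [← Real.exp_add, add_halves]
      _ = _ := by simp only [Matrix.mul_assoc]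
  have hB' : (R'ᵀ * B * R').PosDef := by
    have := (Matrix.IsUnit.posDef_star_left_conjugate_iff (x := B)
      (IsUnit.of_mul_eq_one _ hR'R)).2 hB
    rwa [star_eq_conjTranspose, conjTranspose_eq_transpose_of_trivial] at this
  obtain ⟨V, s, k1, k2, k3⟩ := exists_orthogonal_exp hB'
  refine ⟨V * R, s, (IsUnit.of_mul_eq_one _ k2).mul (IsUnit.of_mul_eq_one _ hRR'), ?_, ?_⟩
  · rw [transpose_mul, hAR]
    calc Rᵀ * R = Rᵀ * (Vᵀ * V) * R := by rw [k1, Matrix.mul_one]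
      _ = _ := by simp only [Matrix.mul_assoc]
  · rw [transpose_mul]
    calc B = (R' * R)ᵀ * B * (R' * R) := by
          rw [hR'R, transpose_one, Matrix.one_mul, Matrix.mul_one]
      _ = Rᵀ * (R'ᵀ * B * R') * R := by rw [transpose_mul]; simp only [Matrix.mul_assoc]
      _ = _ := by rw [k3]; simp only [Matrix.mul_assoc]

/-! ### The matrix logarithm and the trace distance -/

theorem aeval_conjugate {P' P : Matrix (Fin n) (Fin n) ℝ} (h : P * P' = 1)
    (D : Matrix (Fin n) (Fin n) ℝ) (p : Polynomial ℝ) :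
    Polynomial.aeval (P' * D * P) p = P' * Polynomial.aeval D p * P := by
  have h' : P' * P = 1 := mul_eq_one_comm.1 h
  have hpow : ∀ k : ℕ, (P' * D * P) ^ k = P' * D ^ k * P := by
    intro k
    induction k with
    | zero => simp [h']
    | succ k ih =>
      rw [pow_succ, ih, pow_succ]
      calc P' * D ^ k * P * (P' * D * P) = P' * D ^ k * (P * P') * D * P := by
            simp only [Matrix.mul_assoc]
        _ = _ := by rw [h, Matrix.mul_one]; simp only [Matrix.mul_assoc]
  induction p using Polynomial.induction_on' with
  | add p q hp hq => simp only [map_add, hp, hq, Matrix.mul_add, Matrix.add_mul]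
  | monomial k c =>
    simp only [Polynomial.aeval_monomial, hpow, Algebra.algebraMap_eq_smul_one, smul_mul_assoc,
      one_mul, mul_smul_comm]

theorem aeval_diagonal (d : Fin n → ℝ) (p : Polynomial ℝ) :
    Polynomial.aeval (diagonal d) p = diagonal fun i => p.eval (d i) := by
  induction p using Polynomial.induction_on' with
  | add p q hp hq => simp only [map_add, hp, hq, diagonal_add, Polynomial.eval_add]
  | monomial k c =>
    rw [Polynomial.aeval_monomial, diagonal_pow, Algebra.algebraMap_eq_smul_one, smul_mul_assoc,
      one_mul, ← diagonal_smul]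
    congr 1
    ext i
    simp [Polynomial.eval_monomial]

/-- The logarithm of a matrix that is diagonalizable with positive eigenvalues: at these, the
interpolating polynomial that defines `matLog` takes the values of the logarithm. -/
theorem matLog_conjugate {P' P : Matrix (Fin n) (Fin n) ℝ} (h : P * P' = 1) (s : Fin n → ℝ) :
    matLog (P' * diagonal (fun i => Real.exp (s i)) * P) = P' * diagonal s * P := by
  have hchar : (P' * diagonal (fun i => Real.exp (s i)) * P).charpoly =
      ∏ i, (Polynomial.X - Polynomial.C (Real.exp (s i))) := by
    rw [Matrix.mul_assoc, charpoly_mul_comm, Matrix.mul_assoc, h, Matrix.mul_one, charpoly_diagonal]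
  rw [matLog, aeval_conjugate h, aeval_diagonal]
  congr 3
  ext i
  have hmem : Real.exp (s i) ∈
      (P' * diagonal (fun i => Real.exp (s i)) * P).charpoly.roots.toFinset := by
    rw [hchar, Multiset.mem_toFinset, Polynomial.roots_prod _ _
      (Finset.prod_ne_zero_iff.2 fun i _ => Polynomial.X_sub_C_ne_zero _)]
    simp
  have := Lagrange.eval_interpolate_at_node (s := (P' * diagonal (fun i => Real.exp (s i)) *
    P).charpoly.roots.toFinset) (v := id) Real.log (injOn_id _) hmem
  simpa using this

/-- The squared distance `tr((log(A⁻¹B))²)` of two positive definite matrices. -/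
noncomputable def logDistSq (A B : Matrix (Fin n) (Fin n) ℝ) : ℝ := (matLog (A⁻¹ * B) ^ 2).trace

theorem inv_mul_of_simultaneous {Q : Matrix (Fin n) (Fin n) ℝ} (hQ : IsUnit Q) (s : Fin n → ℝ) :
    (Qᵀ * Q)⁻¹ * (Qᵀ * diagonal s * Q) = Q⁻¹ * diagonal s * Q := by
  have hd : IsUnit Qᵀ.det := by rw [det_transpose]; exact (isUnit_iff_isUnit_det _).1 hQ
  rw [Matrix.mul_inv_rev]
  calc Q⁻¹ * Qᵀ⁻¹ * (Qᵀ * diagonal s * Q) = Q⁻¹ * (Qᵀ⁻¹ * Qᵀ) * diagonal s * Q := by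
        simp only [Matrix.mul_assoc]
    _ = _ := by rw [nonsing_inv_mul _ hd, Matrix.mul_one]

theorem logDistSq_of_simultaneous {Q : Matrix (Fin n) (Fin n) ℝ} (hQ : IsUnit Q) (s : Fin n → ℝ) :
    logDistSq (Qᵀ * Q) (Qᵀ * diagonal (fun i => Real.exp (s i)) * Q) = ∑ i, s i ^ 2 := by
  have hd := (isUnit_iff_isUnit_det _).1 hQ
  rw [logDistSq, inv_mul_of_simultaneous hQ, matLog_conjugate (mul_nonsing_inv _ hd), sq]
  calc (Q⁻¹ * diagonal s * Q * (Q⁻¹ * diagonal s * Q)).trace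
      = (Q⁻¹ * (diagonal s * (Q * Q⁻¹) * diagonal s) * Q).trace := by simp only [Matrix.mul_assoc]
    _ = _ := by
      rw [mul_nonsing_inv _ hd, Matrix.mul_one, trace_mul_comm, ← Matrix.mul_assoc,
        mul_nonsing_inv _ hd, Matrix.one_mul, diagonal_mul_diagonal, trace_diagonal]
      simp only [sq]

theorem diagonal_exp_mul {s t : Fin n → ℝ} :
    diagonal (fun i => Real.exp (s i)) * diagonal (fun i => Real.exp (t i)) =
      diagonal (fun i => Real.exp (s i + t i)) := by
  rw [diagonal_mul_diagonal]; simp only [Real.exp_add]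

theorem isUnit_diagonal_exp (s : Fin n → ℝ) : IsUnit (diagonal (fun i => Real.exp (s i))) := by
  refine IsUnit.of_mul_eq_one (diagonal (fun i => Real.exp (-s i))) ?_
  rw [diagonal_exp_mul]; simp

/-- For points with a common diagonalizing frame, the trace distance is the Euclidean distance of
the exponents. -/
theorem logDistSq_diagonal {Q : Matrix (Fin n) (Fin n) ℝ} (hQ : IsUnit Q) (s t : Fin n → ℝ) :
    logDistSq (Qᵀ * diagonal (fun i => Real.exp (s i)) * Q)
      (Qᵀ * diagonal (fun i => Real.exp (t i)) * Q) = ∑ i, (t i - s i) ^ 2 := by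
  have key : ∀ u : Fin n → ℝ, Qᵀ * diagonal (fun i => Real.exp (u i)) * Q =
      (diagonal (fun i => Real.exp (s i / 2)) * Q)ᵀ *
        diagonal (fun i => Real.exp (u i - s i)) *
          (diagonal (fun i => Real.exp (s i / 2)) * Q) := by
    intro u
    rw [transpose_mul, diagonal_transpose]
    calc _ = Qᵀ * (diagonal (fun i => Real.exp (s i / 2)) *
          diagonal (fun i => Real.exp (u i - s i)) *
          diagonal (fun i => Real.exp (s i / 2))) * Q := by
            rw [diagonal_exp_mul, diagonal_exp_mul]
            congr 4; ext i; congr 1; ring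
      _ = _ := by simp only [Matrix.mul_assoc]
  rw [← logDistSq_of_simultaneous ((isUnit_diagonal_exp fun i => s i / 2).mul hQ), key s, key t]
  congr 1
  simp

/-- Congruences are isometries, so that `tr((log(g⁻¹h))²)` may be computed in any frame. -/
theorem logDistSq_congruence {J A B : Matrix (Fin n) (Fin n) ℝ} (hJ : IsUnit J) (hA : A.PosDef)
    (hB : B.PosDef) : logDistSq (Jᵀ * A * J) (Jᵀ * B * J) = logDistSq A B := by
  obtain ⟨Q, s, hQ, rfl, rfl⟩ := exists_simultaneous_diagonalization hA hB
  rw [logDistSq_of_simultaneous hQ, ← logDistSq_of_simultaneous (hQ.mul hJ)]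
  simp only [transpose_mul, Matrix.mul_assoc]

theorem logDistSq_nonneg {A B : Matrix (Fin n) (Fin n) ℝ} (hA : A.PosDef)
    (hB : B.PosDef) : 0 ≤ logDistSq A B := by
  obtain ⟨Q, s, hQ, rfl, rfl⟩ := exists_simultaneous_diagonalization hA hB
  rw [logDistSq_of_simultaneous hQ]
  positivity

theorem transpose_mul_self_eq (Q : Matrix (Fin n) (Fin n) ℝ) :
    Qᵀ * Q = Qᵀ * Matrix.diagonal (fun _ => Real.exp 0) * Q := by simp

theorem logDistSq_comm {A B : Matrix (Fin n) (Fin n) ℝ} (hA : A.PosDef)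
    (hB : B.PosDef) : logDistSq A B = logDistSq B A := by
  obtain ⟨Q, s, hQ, rfl, rfl⟩ := exists_simultaneous_diagonalization hA hB
  rw [transpose_mul_self_eq, logDistSq_diagonal hQ, logDistSq_diagonal hQ]
  simp

theorem logDistSq_self {A : Matrix (Fin n) (Fin n) ℝ} (hA : A.PosDef) : logDistSq A A = 0 := by
  obtain ⟨Q, s, hQ, rfl, h⟩ := exists_simultaneous_diagonalization hA hA
  rw [transpose_mul_self_eq, logDistSq_diagonal hQ]
  simp

theorem eq_of_logDistSq_eq_zero {A B : Matrix (Fin n) (Fin n) ℝ} (hA : A.PosDef)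
    (hB : B.PosDef) (h : logDistSq A B = 0) : A = B := by
  obtain ⟨Q, s, hQ, rfl, rfl⟩ := exists_simultaneous_diagonalization hA hB
  rw [logDistSq_of_simultaneous hQ, Finset.sum_eq_zero_iff_of_nonneg fun _ _ => sq_nonneg _] at h
  have : s = 0 := by ext i; simpa using h i (Finset.mem_univ i)
  subst this
  simp

/-! ### The logarithm is distance non-increasing -/

/-- The squared Frobenius norm. -/
def frobSq (X : Matrix (Fin n) (Fin n) ℝ) : ℝ := ∑ i, ∑ j, X i j ^ 2

theorem frobSq_eq_trace (X : Matrix (Fin n) (Fin n) ℝ) : frobSq X = (X * Xᵀ).trace := by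
  simp [frobSq, trace, Matrix.mul_apply, sq]

/-- The trace of a product of two symmetric matrices, in terms of their eigenvalues and of the
squared entries of the matrix that relates their eigenbases. -/
theorem trace_orthogonal_pair (U V : Matrix (Fin n) (Fin n) ℝ) (f g : Fin n → ℝ) :
    ((Uᵀ * diagonal f * U) * (Vᵀ * diagonal g * V)).trace =
      ∑ i, ∑ j, f i * g j * (U * Vᵀ) i j ^ 2 := by
  have : ((Uᵀ * diagonal f * U) * (Vᵀ * diagonal g * V)).trace =
      ((diagonal f * (U * Vᵀ)) * (diagonal g * (U * Vᵀ)ᵀ)).trace := by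
    rw [transpose_mul, transpose_transpose, Matrix.mul_assoc, Matrix.mul_assoc, trace_mul_comm]
    simp only [Matrix.mul_assoc]
  rw [this]
  simp only [trace, diag_apply, Matrix.mul_apply (M := diagonal f * (U * Vᵀ)), diagonal_mul,
    transpose_apply]
  exact Finset.sum_congr rfl fun i _ => Finset.sum_congr rfl fun j _ => by ring

theorem sq_le_exp_add_exp_neg (x : ℝ) : x ^ 2 ≤ Real.exp x + Real.exp (-x) - 2 := by
  have h1 : |x / 2| ≤ |Real.sinh (x / 2)| := by
    rcases le_total 0 (x / 2) with h | h
    · rw [abs_of_nonneg h, abs_of_nonneg (Real.sinh_nonneg_iff.2 h)]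
      exact Real.self_le_sinh_iff.2 h
    · rw [abs_of_nonpos h, abs_of_nonpos (Real.sinh_nonpos_iff.2 h)]
      exact neg_le_neg (Real.sinh_le_self_iff.2 h)
  have h2 := sq_le_sq.2 h1
  have h3 : Real.sinh (x / 2) ^ 2 = (Real.exp x + Real.exp (-x) - 2) / 4 := by
    rw [Real.sinh_eq]
    have e1 : Real.exp x = Real.exp (x / 2) ^ 2 := by rw [← Real.exp_nat_mul]; congr 1; ring
    have e2 : Real.exp (-x) = Real.exp (-(x / 2)) ^ 2 := by
      rw [← Real.exp_nat_mul]; congr 1; ring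
    have e3 : Real.exp (x / 2) * Real.exp (-(x / 2)) = 1 := by rw [← Real.exp_add]; simp
    rw [e1, e2]; linear_combination (-1/2 : ℝ) * e3
  rw [h3] at h2
  linarith

theorem inv_of_orthogonal {U : Matrix (Fin n) (Fin n) ℝ} (h1 : Uᵀ * U = 1) (h2 : U * Uᵀ = 1)
    (a : Fin n → ℝ) : (Uᵀ * diagonal (fun i => Real.exp (a i)) * U)⁻¹ =
      Uᵀ * diagonal (fun i => Real.exp (-a i)) * U := by
  apply inv_eq_right_inv
  calc _ = Uᵀ * (diagonal (fun i => Real.exp (a i)) * (U * Uᵀ) *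
        diagonal (fun i => Real.exp (-a i))) * U := by simp only [Matrix.mul_assoc]
    _ = 1 := by rw [h2, Matrix.mul_one, diagonal_exp_mul]; simp [h1]

/-- In terms of the eigenvalues `exp aᵢ` of `A` and `exp bⱼ` of `B`, both sides are sums over `i, j`
weighted by the squared entries of the matrix that relates the eigenbases, and the inequality holds
term by term: `x² ≤ 2 cosh x - 2` for `x = bⱼ - aᵢ`. -/
theorem frobSq_matLog_sub_le_trace {A B : Matrix (Fin n) (Fin n) ℝ} (hA : A.PosDef)
    (hB : B.PosDef) :
    frobSq (matLog B - matLog A) ≤ (A⁻¹ * B).trace + (B⁻¹ * A).trace - 2 * n := by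
  obtain ⟨U, a, hU1, hU2, rfl⟩ := exists_orthogonal_exp hA
  obtain ⟨V, b, hV1, hV2, rfl⟩ := exists_orthogonal_exp hB
  have hone : ∀ {W : Matrix (Fin n) (Fin n) ℝ}, Wᵀ * W = 1 →
      Wᵀ * Matrix.diagonal (fun _ => (1 : ℝ)) * W = 1 := fun h => by
    rw [show Matrix.diagonal (fun _ : Fin n => (1 : ℝ)) = 1 from diagonal_one, Matrix.mul_one, h]
  have hsq : ∀ {W : Matrix (Fin n) (Fin n) ℝ} (c : Fin n → ℝ), W * Wᵀ = 1 →
      (Wᵀ * diagonal c * W) * (Wᵀ * diagonal c * W) = Wᵀ * diagonal (fun i => c i ^ 2) * W := by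
    intro W c h
    calc _ = Wᵀ * (diagonal c * (W * Wᵀ) * diagonal c) * W := by simp only [Matrix.mul_assoc]
      _ = _ := by rw [h, Matrix.mul_one, diagonal_mul_diagonal]; simp only [sq]
  have t0 := trace_orthogonal_pair U V (fun _ => 1) (fun _ => 1)
  have t1 := trace_orthogonal_pair U V (fun i => a i ^ 2) (fun _ => 1)
  have t2 := trace_orthogonal_pair U V (fun _ => 1) (fun i => b i ^ 2)
  have t3 := trace_orthogonal_pair U V a b
  have t4 := trace_orthogonal_pair U V (fun i => Real.exp (-a i)) (fun i => Real.exp (b i))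
  have t5 := trace_orthogonal_pair U V (fun i => Real.exp (a i)) (fun i => Real.exp (-b i))
  rw [hone hU1, hone hV1, Matrix.one_mul, trace_one, Fintype.card_fin] at t0
  rw [hone hV1, Matrix.mul_one, ← hsq a hU2] at t1
  rw [hone hU1, Matrix.one_mul, ← hsq b hV2] at t2
  rw [inv_of_orthogonal hU1 hU2, inv_of_orthogonal hV1 hV2, matLog_conjugate hU2,
    matLog_conjugate hV2, t4, trace_mul_comm (Vᵀ * _ * V), t5, t0, frobSq_eq_trace]
  have hsymm : ∀ (W : Matrix (Fin n) (Fin n) ℝ) (c : Fin n → ℝ),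
      (Wᵀ * diagonal c * W)ᵀ = Wᵀ * diagonal c * W := fun W c => by
    simp [transpose_mul, Matrix.mul_assoc]
  rw [transpose_sub, hsymm, hsymm, Matrix.sub_mul, Matrix.mul_sub, Matrix.mul_sub, trace_sub,
    trace_sub, trace_sub, trace_mul_comm (Vᵀ * diagonal b * V) (Uᵀ * diagonal a * U), t1, t2, t3]
  simp only [Finset.mul_sum, ← Finset.sum_add_distrib, ← Finset.sum_sub_distrib]
  refine Finset.sum_le_sum fun i _ => Finset.sum_le_sum fun j _ => ?_
  have h := mul_le_mul_of_nonneg_right (sq_le_exp_add_exp_neg (b j - a i))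
    (sq_nonneg ((U * Vᵀ) i j))
  rw [show b j - a i = -a i + b j by ring, Real.exp_add,
    show -(-a i + b j) = a i + -b j by ring, Real.exp_add] at h
  linarith

theorem trace_inv_mul_diagonal {Q : Matrix (Fin n) (Fin n) ℝ} (hQ : IsUnit Q) (s t : Fin n → ℝ) :
    ((Qᵀ * diagonal (fun i => Real.exp (s i)) * Q)⁻¹ *
      (Qᵀ * diagonal (fun i => Real.exp (t i)) * Q)).trace = ∑ i, Real.exp (t i - s i) := by
  have hd := (isUnit_iff_isUnit_det _).1 hQ
  have hd' : IsUnit Qᵀ.det := by rwa [det_transpose]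
  have hinv : (diagonal (fun i => Real.exp (s i)))⁻¹ = diagonal (fun i => Real.exp (-s i)) := by
    apply inv_eq_right_inv; rw [diagonal_exp_mul]; simp
  rw [Matrix.mul_inv_rev, Matrix.mul_inv_rev, hinv]
  calc _ = (Q⁻¹ * (diagonal (fun i => Real.exp (-s i)) * (Qᵀ⁻¹ * Qᵀ) *
        diagonal (fun i => Real.exp (t i))) * Q).trace := by simp only [Matrix.mul_assoc]
    _ = _ := by
      rw [nonsing_inv_mul _ hd', Matrix.mul_one, diagonal_exp_mul, trace_mul_comm,
        ← Matrix.mul_assoc, mul_nonsing_inv _ hd, Matrix.one_mul, trace_diagonal]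
      refine Finset.sum_congr rfl fun i _ => ?_
      congr 1; ring

theorem tendsto_sq_mul_cosh (x : ℝ) :
    Tendsto (fun N : ℕ => (N : ℝ) ^ 2 * (Real.exp (x / N) + Real.exp (-(x / N)) - 2)) atTop
      (𝓝 (x ^ 2)) := by
  have hlim : Tendsto (fun N : ℕ => x ^ 2 + x ^ 4 / 2 * (1 / (N : ℝ) ^ 2)) atTop (𝓝 (x ^ 2)) := by
    have : Tendsto (fun N : ℕ => 1 / (N : ℝ) ^ 2) atTop (𝓝 0) :=
      (tendsto_const_nhds (x := (1 : ℝ))).div_atTop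
        ((tendsto_pow_atTop two_ne_zero).comp tendsto_natCast_atTop_atTop)
    simpa using (this.const_mul (x ^ 4 / 2)).const_add (x ^ 2)
  refine tendsto_of_tendsto_of_tendsto_of_le_of_le' tendsto_const_nhds hlim ?_ ?_
  · filter_upwards [eventually_gt_atTop 0] with N hN
    have hN' : (0 : ℝ) < N := by exact_mod_cast hN
    calc x ^ 2 = (N : ℝ) ^ 2 * (x / N) ^ 2 := by field_simp
      _ ≤ _ := mul_le_mul_of_nonneg_left (sq_le_exp_add_exp_neg _) (by positivity)
  · obtain ⟨K, hK⟩ := exists_nat_gt (|x|)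
    filter_upwards [eventually_gt_atTop (max 0 K)] with N hN
    have hN' : (0 : ℝ) < N := by exact_mod_cast (le_max_left 0 K).trans_lt hN
    have hKN : (K : ℝ) < N := by exact_mod_cast (le_max_right 0 K).trans_lt hN
    have hu : |(x / N) ^ 2 / 2| ≤ 1 := by
      rw [abs_of_nonneg (by positivity)]
      have : |x / N| ≤ 1 := by
        rw [abs_div, abs_of_pos hN', div_le_one hN']; linarith
      have := (sq_le_one_iff_abs_le_one _).2 this
      linarith
    have h1 := Real.cosh_le_exp_half_sq (x / N)
    have h2 := (abs_le.1 (Real.abs_exp_sub_one_sub_id_le hu)).2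
    rw [Real.cosh_eq] at h1
    calc (N : ℝ) ^ 2 * (Real.exp (x / N) + Real.exp (-(x / N)) - 2)
        ≤ (N : ℝ) ^ 2 * (2 * ((x / N) ^ 2 / 2 + ((x / N) ^ 2 / 2) ^ 2)) :=
          mul_le_mul_of_nonneg_left (by linarith) (by positivity)
      _ = _ := by field_simp

/-- **Exponential metric increasing property**: the matrix logarithm does not increase distances.
The geodesic from `A` to `B` is cut into `N` equal pieces, to which
`frobSq_matLog_sub_le_trace` applies with a relative error tending to `0` as `N → ∞`. -/
theorem frobSq_matLog_sub_le {A B : Matrix (Fin n) (Fin n) ℝ} (hA : A.PosDef)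
    (hB : B.PosDef) : frobSq (matLog B - matLog A) ≤ logDistSq A B := by
  obtain ⟨Q, s, hQ, rfl, rfl⟩ := exists_simultaneous_diagonalization hA hB
  rw [logDistSq_of_simultaneous hQ]
  have hlim : Tendsto (fun N : ℕ => ∑ i, (N : ℝ) ^ 2 *
      (Real.exp (s i / N) + Real.exp (-(s i / N)) - 2)) atTop (𝓝 (∑ i, s i ^ 2)) :=
    tendsto_finsetSum _ fun i _ => tendsto_sq_mul_cosh (s i)
  refine ge_of_tendsto hlim ?_
  filter_upwards [eventually_gt_atTop 0] with N hN
  have hN' : (0 : ℝ) < N := by exact_mod_cast hN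
  set γ : ℕ → Matrix (Fin n) (Fin n) ℝ := fun k =>
    Qᵀ * diagonal (fun i => Real.exp (k * (s i / N))) * Q with hγ
  have h0 : Qᵀ * Q = γ 0 := by simp [hγ]
  have h1 : Qᵀ * diagonal (fun i => Real.exp (s i)) * Q = γ N := by
    simp only [hγ]; congr 4; ext i; congr 1; field_simp
  have hstep : ∀ k, frobSq (matLog (γ (k + 1)) - matLog (γ k)) ≤
      ∑ i, (Real.exp (s i / N) + Real.exp (-(s i / N)) - 2) := by
    intro k
    refine (frobSq_matLog_sub_le_trace (posDef_transpose_mul_diagonal_mul hQ _)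
      (posDef_transpose_mul_diagonal_mul hQ _)).trans_eq ?_
    rw [trace_inv_mul_diagonal hQ, trace_inv_mul_diagonal hQ, Finset.sum_sub_distrib,
      Finset.sum_add_distrib]
    have e1 : ∀ i, ((k + 1 : ℕ) : ℝ) * (s i / N) - k * (s i / N) = s i / N := fun i => by
      push_cast; ring
    have e2 : ∀ i, (k : ℝ) * (s i / N) - ((k + 1 : ℕ) : ℝ) * (s i / N) = -(s i / N) := fun i => by
      push_cast; ring
    simp only [e1, e2, Finset.sum_const, Finset.card_univ, Fintype.card_fin, nsmul_eq_mul,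
      mul_comm (2 : ℝ)]
  rw [h0, h1, ← Finset.mul_sum]
  calc frobSq (matLog (γ N) - matLog (γ 0))
      ≤ N * ∑ k ∈ Finset.range N, frobSq (matLog (γ (k + 1)) - matLog (γ k)) := by
        rw [← Finset.sum_range_sub (fun k => matLog (γ k))]
        simp only [frobSq, Matrix.sum_apply]
        rw [Finset.sum_comm (s := Finset.range N), Finset.mul_sum]
        refine Finset.sum_le_sum fun i _ => ?_
        rw [Finset.sum_comm (s := Finset.range N), Finset.mul_sum]
        refine Finset.sum_le_sum fun j _ => ?_
        simpa using sq_sum_le_card_mul_sum_sq (s := Finset.range N)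
          (f := fun k => (matLog (γ (k + 1)) - matLog (γ k)) i j)
    _ ≤ N * ∑ k ∈ Finset.range N, ∑ i, (Real.exp (s i / N) + Real.exp (-(s i / N)) - 2) :=
        mul_le_mul_of_nonneg_left (Finset.sum_le_sum fun k _ => hstep k) hN'.le
    _ = _ := by
        rw [Finset.sum_const, Finset.card_range, nsmul_eq_mul]; ring

/-! ### The Bruhat–Tits inequality for positive definite matrices -/

theorem matLog_diagonal_exp (s : Fin n → ℝ) :
    matLog (Matrix.diagonal (fun i => Real.exp (s i))) = Matrix.diagonal s := by
  have := matLog_conjugate (P' := (1 : Matrix (Fin n) (Fin n) ℝ)) (P := 1) (by simp) s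
  simpa using this

theorem logDistSq_one_left {A : Matrix (Fin n) (Fin n) ℝ} (hA : A.PosDef) :
    logDistSq 1 A = frobSq (matLog A) := by
  obtain ⟨U, a, h1, h2, rfl⟩ := exists_orthogonal_exp hA
  rw [logDistSq, inv_one, Matrix.one_mul, frobSq_eq_trace, matLog_conjugate h2, sq]
  congr 2
  simp [transpose_mul, Matrix.mul_assoc]

theorem sqrt_frobSq_add_le (X Y : Matrix (Fin n) (Fin n) ℝ) :
    √(frobSq (X + Y)) ≤ √(frobSq X) + √(frobSq Y) := by
  let f : Matrix (Fin n) (Fin n) ℝ → EuclideanSpace ℝ (Fin n × Fin n) := fun X =>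
    WithLp.toLp 2 fun p => X p.1 p.2
  have hf : ∀ X, √(frobSq X) = ‖f X‖ := fun X => by
    rw [EuclideanSpace.norm_eq, frobSq, Fintype.sum_prod_type]
    simp [f]
  have hadd : f (X + Y) = f X + f Y := by ext p; simp [f]
  rw [hf, hf, hf, hadd]
  exact norm_add_le _ _

theorem posDef_congruence {J A : Matrix (Fin n) (Fin n) ℝ} (hJ : IsUnit J) :
    (Jᵀ * A * J).PosDef ↔ A.PosDef := by
  have := Matrix.IsUnit.posDef_star_left_conjugate_iff (x := A) hJ
  rwa [star_eq_conjTranspose, conjTranspose_eq_transpose_of_trivial] at this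

theorem exists_frame {Z : Matrix (Fin n) (Fin n) ℝ} {Q : Matrix (Fin n) (Fin n) ℝ}
    (hQ : IsUnit Q) (hZ : Z.PosDef) :
    ∃ Z' : Matrix (Fin n) (Fin n) ℝ, Z'.PosDef ∧ Z = Qᵀ * Z' * Q := by
  have hd := (isUnit_iff_isUnit_det _).1 hQ
  have hd' : IsUnit Qᵀ.det := by rwa [det_transpose]
  have : Z = Qᵀ * (Qᵀ⁻¹ * Z * Q⁻¹) * Q := by
    calc Z = (Qᵀ * Qᵀ⁻¹) * Z * (Q⁻¹ * Q) := by
          rw [mul_nonsing_inv _ hd', nonsing_inv_mul _ hd, Matrix.one_mul, Matrix.mul_one]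
      _ = _ := by simp only [Matrix.mul_assoc]
  refine ⟨_, ?_, this⟩
  rw [this] at hZ
  exact (posDef_congruence hQ).1 hZ

/-- The distance `√(tr((log(A⁻¹B))²))` satisfies the triangle inequality: in the frame in which
`A` is the identity, it follows from the triangle inequality for the Frobenius norm. -/
theorem sqrt_logDistSq_triangle {A B Z : Matrix (Fin n) (Fin n) ℝ} (hA : A.PosDef)
    (hB : B.PosDef) (hZ : Z.PosDef) :
    √(logDistSq A B) ≤ √(logDistSq A Z) + √(logDistSq Z B) := by
  obtain ⟨Q, s, hQ, hAQ, -⟩ := exists_simultaneous_diagonalization hA hB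
  obtain ⟨B', hB', rfl⟩ := exists_frame hQ hB
  obtain ⟨Z', hZ', rfl⟩ := exists_frame hQ hZ
  have hA1 : A = Qᵀ * 1 * Q := by rw [hAQ, Matrix.mul_one]
  rw [hA1, logDistSq_congruence hQ PosDef.one hB', logDistSq_congruence hQ PosDef.one hZ',
    logDistSq_congruence hQ hZ' hB', logDistSq_one_left hB', logDistSq_one_left hZ']
  calc √(frobSq (matLog B')) = √(frobSq (matLog Z' + (matLog B' - matLog Z'))) := by
        rw [add_sub_cancel]
    _ ≤ _ := (sqrt_frobSq_add_le _ _).trans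
        (add_le_add_right (Real.sqrt_le_sqrt (frobSq_matLog_sub_le hZ' hB')) _)

/-- `M` divides the geodesic from `A` to `B` in the ratio `t : 1 - t`. Its distances from `A` and `B`
express this without reference to a parametrization, and determine `M` if `0 ≤ t ≤ 1`. -/
structure IsGeodesicPoint (t : ℝ) (A B M : Matrix (Fin n) (Fin n) ℝ) : Prop where
  posDef : M.PosDef
  left : logDistSq A M = t ^ 2 * logDistSq A B
  right : logDistSq M B = (1 - t) ^ 2 * logDistSq A B

/-- The point with parameter `t` on the geodesic from `A = QᵀQ` to `B = Qᵀ exp(diag s) Q`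
is `Qᵀ exp(t diag s) Q`. The convexity inequality is that of Euclidean space, transported by the
logarithm in the frame in which this point is the identity. -/
theorem logDistSq_convex_of_simultaneous {Q Z : Matrix (Fin n) (Fin n) ℝ} (hQ : IsUnit Q)
    (s : Fin n → ℝ) (hZ : Z.PosDef) {t : ℝ} (ht : t ∈ Icc (0 : ℝ) 1) :
    logDistSq Z (Qᵀ * Matrix.diagonal (fun i => Real.exp (t * s i)) * Q) +
        t * (1 - t) * ∑ i, s i ^ 2 ≤
      (1 - t) * logDistSq Z (Qᵀ * Q) +
        t * logDistSq Z (Qᵀ * Matrix.diagonal (fun i => Real.exp (s i)) * Q) := by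
  set R := Matrix.diagonal (fun i => Real.exp (t * s i / 2)) * Q with hR
  have hRu : IsUnit R := (isUnit_diagonal_exp _).mul hQ
  have key : ∀ u : ℝ, Qᵀ * Matrix.diagonal (fun i => Real.exp (u * s i)) * Q =
      Rᵀ * Matrix.diagonal (fun i => Real.exp ((u - t) * s i)) * R := by
    intro u
    rw [hR, transpose_mul, diagonal_transpose]
    calc _ = Qᵀ * (Matrix.diagonal (fun i => Real.exp (t * s i / 2)) *
          Matrix.diagonal (fun i => Real.exp ((u - t) * s i)) *
          Matrix.diagonal (fun i => Real.exp (t * s i / 2))) * Q := by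
            rw [diagonal_exp_mul, diagonal_exp_mul]
            congr 4; ext i; congr 1; ring
      _ = _ := by simp only [Matrix.mul_assoc]
  have k0 := key 0
  have k1 := key 1
  have kt := key t
  simp only [zero_mul, Real.exp_zero, one_mul, sub_self] at k0 k1 kt
  rw [show Matrix.diagonal (fun _ : Fin n => (1 : ℝ)) = 1 from Matrix.diagonal_one] at k0 kt
  rw [Matrix.mul_one] at k0
  obtain ⟨Z', hZ', rfl⟩ := exists_frame hRu hZ
  have hpd : ∀ u : Fin n → ℝ, (Matrix.diagonal (fun i => Real.exp (u i))).PosDef := fun u =>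
    PosDef.diagonal fun i => Real.exp_pos _
  rw [k0, k1, kt, logDistSq_congruence hRu hZ' PosDef.one, logDistSq_congruence hRu hZ' (hpd _),
    logDistSq_congruence hRu hZ' (hpd _), logDistSq_comm hZ' PosDef.one, logDistSq_one_left hZ']
  have h0 := frobSq_matLog_sub_le hZ' (hpd fun i => (0 - t) * s i)
  have h1 := frobSq_matLog_sub_le hZ' (hpd fun i => (1 - t) * s i)
  rw [matLog_diagonal_exp] at h0 h1
  refine le_trans (le_of_eq ?_) (add_le_add (mul_le_mul_of_nonneg_left h0 (sub_nonneg.2 ht.2))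
    (mul_le_mul_of_nonneg_left h1 ht.1))
  have hs : ∑ i, s i ^ 2 = ∑ i, ∑ j, Matrix.diagonal s i j ^ 2 := by
    refine Finset.sum_congr rfl fun i _ => ?_
    rw [Finset.sum_eq_single i (fun j _ hj => by rw [diagonal_apply_ne _ hj.symm]; simp)
      (fun h => absurd (Finset.mem_univ i) h), diagonal_apply_eq]
  have hd : ∀ (u : ℝ) (i j : Fin n), Matrix.diagonal (fun i => u * s i) i j =
      u * Matrix.diagonal s i j := fun u i j => by
    by_cases h : i = j
    · subst h; simp
    · simp [h]
  rw [hs]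
  simp only [frobSq, Matrix.sub_apply, hd, Finset.mul_sum, ← Finset.sum_add_distrib]
  refine Finset.sum_congr rfl fun i _ => Finset.sum_congr rfl fun j _ => ?_
  ring

theorem isGeodesicPoint_of_simultaneous {Q : Matrix (Fin n) (Fin n) ℝ} (hQ : IsUnit Q)
    (s : Fin n → ℝ) (t : ℝ) :
    IsGeodesicPoint t (Qᵀ * Q) (Qᵀ * Matrix.diagonal (fun i => Real.exp (s i)) * Q)
      (Qᵀ * Matrix.diagonal (fun i => Real.exp (t * s i)) * Q) := by
  refine ⟨posDef_transpose_mul_diagonal_mul hQ _, ?_, ?_⟩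
  · rw [logDistSq_of_simultaneous hQ, logDistSq_of_simultaneous hQ, Finset.mul_sum]
    simp only [mul_pow]
  · rw [logDistSq_of_simultaneous hQ, logDistSq_diagonal hQ, Finset.mul_sum]
    exact Finset.sum_congr rfl fun i _ => by ring

theorem exists_isGeodesicPoint {A B : Matrix (Fin n) (Fin n) ℝ} (hA : A.PosDef) (hB : B.PosDef)
    (t : ℝ) : ∃ M, IsGeodesicPoint t A B M := by
  obtain ⟨Q, s, hQ, rfl, rfl⟩ := exists_simultaneous_diagonalization hA hB
  exact ⟨_, isGeodesicPoint_of_simultaneous hQ s t⟩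

/-- A point with the distances of a geodesic point is that geodesic point: for `Z = M`, the convexity
inequality leaves no room for a positive distance between them. -/
theorem IsGeodesicPoint.eq_of_simultaneous {Q M : Matrix (Fin n) (Fin n) ℝ} (hQ : IsUnit Q)
    {s : Fin n → ℝ} {t : ℝ} (hM : IsGeodesicPoint t (Qᵀ * Q)
      (Qᵀ * Matrix.diagonal (fun i => Real.exp (s i)) * Q) M) (ht : t ∈ Icc (0 : ℝ) 1) :
    M = Qᵀ * Matrix.diagonal (fun i => Real.exp (t * s i)) * Q := by
  have hA : (Qᵀ * Q).PosDef := by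
    rw [transpose_mul_self_eq]; exact posDef_transpose_mul_diagonal_mul hQ _
  have h := logDistSq_convex_of_simultaneous hQ s hM.posDef ht
  rw [logDistSq_comm hM.posDef hA, hM.left, hM.right, logDistSq_of_simultaneous hQ] at h
  have hpd := posDef_transpose_mul_diagonal_mul hQ fun i => t * s i
  refine eq_of_logDistSq_eq_zero hM.posDef hpd
    (le_antisymm ?_ (logDistSq_nonneg hM.posDef hpd))
  linarith

theorem IsGeodesicPoint.unique {A B M M' : Matrix (Fin n) (Fin n) ℝ} {t : ℝ}
    (hM : IsGeodesicPoint t A B M) (hM' : IsGeodesicPoint t A B M') (hA : A.PosDef)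
    (hB : B.PosDef) (ht : t ∈ Icc (0 : ℝ) 1) : M = M' := by
  obtain ⟨Q, s, hQ, rfl, rfl⟩ := exists_simultaneous_diagonalization hA hB
  rw [hM.eq_of_simultaneous hQ ht, hM'.eq_of_simultaneous hQ ht]

/-- The weighted Bruhat–Tits (semi-parallelogram) inequality. -/
theorem IsGeodesicPoint.convex {A B M Z : Matrix (Fin n) (Fin n) ℝ} {t : ℝ}
    (hM : IsGeodesicPoint t A B M) (hA : A.PosDef)
    (hB : B.PosDef) (hZ : Z.PosDef) (ht : t ∈ Icc (0 : ℝ) 1) :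
    logDistSq Z M + t * (1 - t) * logDistSq A B ≤ (1 - t) * logDistSq Z A + t * logDistSq Z B := by
  obtain ⟨Q, s, hQ, rfl, rfl⟩ := exists_simultaneous_diagonalization hA hB
  rw [hM.eq_of_simultaneous hQ ht, logDistSq_of_simultaneous hQ]
  exact logDistSq_convex_of_simultaneous hQ s hZ ht

theorem IsGeodesicPoint.logDistSq_eq {A B M M' : Matrix (Fin n) (Fin n) ℝ} {t t' : ℝ}
    (hM : IsGeodesicPoint t A B M) (hM' : IsGeodesicPoint t' A B M') (hA : A.PosDef)
    (hB : B.PosDef) (ht : t ∈ Icc (0 : ℝ) 1) (ht' : t' ∈ Icc (0 : ℝ) 1) :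
    logDistSq M M' = (t - t') ^ 2 * logDistSq A B := by
  obtain ⟨Q, s, hQ, rfl, rfl⟩ := exists_simultaneous_diagonalization hA hB
  rw [hM.eq_of_simultaneous hQ ht, hM'.eq_of_simultaneous hQ ht', logDistSq_of_simultaneous hQ,
    logDistSq_diagonal hQ, Finset.mul_sum]
  exact Finset.sum_congr rfl fun i _ => by ring

/-- Geodesics between matrices of equal determinant keep the determinant constant, since `log det`
is affine along geodesics. -/
theorem IsGeodesicPoint.det_eq {A B M : Matrix (Fin n) (Fin n) ℝ} {t : ℝ}
    (hM : IsGeodesicPoint t A B M) (hA : A.PosDef) (hB : B.PosDef) (ht : t ∈ Icc (0 : ℝ) 1)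
    (h : A.det = B.det) : M.det = A.det := by
  obtain ⟨Q, s, hQ, rfl, rfl⟩ := exists_simultaneous_diagonalization hA hB
  rw [hM.eq_of_simultaneous hQ ht]
  have hd : Q.det ≠ 0 := ((isUnit_iff_isUnit_det _).1 hQ).ne_zero
  simp only [det_mul, det_transpose, det_diagonal, ← Real.exp_sum, ← Finset.mul_sum] at h ⊢
  have h1 : Real.exp (∑ i, s i) = 1 := by
    have h2 : Q.det * Q.det * (Real.exp (∑ i, s i) - 1) = 0 := by linear_combination -h
    rcases mul_eq_zero.1 h2 with h3 | h3
    · exact absurd h3 (mul_ne_zero hd hd)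
    · linarith
  rw [Real.exp_eq_one_iff] at h1
  rw [h1]; simp

theorem IsGeodesicPoint.congruence {A B M J : Matrix (Fin n) (Fin n) ℝ} {t : ℝ}
    (hM : IsGeodesicPoint t A B M) (hA : A.PosDef) (hB : B.PosDef) (hJ : IsUnit J) :
    IsGeodesicPoint t (Jᵀ * A * J) (Jᵀ * B * J) (Jᵀ * M * J) := by
  refine ⟨(posDef_congruence hJ).2 hM.posDef, ?_, ?_⟩
  · rw [logDistSq_congruence hJ hA hM.posDef, logDistSq_congruence hJ hA hB, hM.left]
  · rw [logDistSq_congruence hJ hM.posDef hB, logDistSq_congruence hJ hA hB, hM.right]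

/-! ### Topology of the trace distance -/

theorem exp_matLog {A : Matrix (Fin n) (Fin n) ℝ} (hA : A.PosDef) :
    NormedSpace.exp (matLog A) = A := by
  obtain ⟨U, a, h1, h2, rfl⟩ := exists_orthogonal_exp hA
  have hU : IsUnit U := IsUnit.of_mul_eq_one _ h2
  have hinv : Uᵀ = U⁻¹ := (inv_eq_left_inv h1).symm
  rw [matLog_conjugate h2, hinv, Matrix.exp_conj' _ _ hU, Matrix.exp_diagonal, Pi.exp_def]
  simp only [Real.exp_eq_exp_ℝ]

open scoped Matrix.Norms.Operator in
theorem continuous_matrix_exp :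
    Continuous (NormedSpace.exp : Matrix (Fin n) (Fin n) ℝ → Matrix (Fin n) (Fin n) ℝ) :=
  NormedSpace.exp_continuous

theorem posDef_exp {L : Matrix (Fin n) (Fin n) ℝ} (hL : Lᵀ = L) : (NormedSpace.exp L).PosDef := by
  obtain ⟨U, a, h1, h2, rfl⟩ := exists_orthogonal_diagonalization hL
  have hU : IsUnit U := IsUnit.of_mul_eq_one _ h2
  have hinv : Uᵀ = U⁻¹ := (inv_eq_left_inv h1).symm
  rw [hinv, Matrix.exp_conj' _ _ hU, Matrix.exp_diagonal, Pi.exp_def, ← hinv]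
  simpa only [Real.exp_eq_exp_ℝ] using posDef_transpose_mul_diagonal_mul hU a

theorem matLog_transpose {A : Matrix (Fin n) (Fin n) ℝ} (hA : A.PosDef) :
    (matLog A)ᵀ = matLog A := by
  obtain ⟨U, a, h1, h2, rfl⟩ := exists_orthogonal_exp hA
  rw [matLog_conjugate h2]
  simp [transpose_mul, Matrix.mul_assoc]

theorem sq_le_frobSq (X : Matrix (Fin n) (Fin n) ℝ) (i j : Fin n) : X i j ^ 2 ≤ frobSq X :=
  (Finset.single_le_sum (f := fun j => X i j ^ 2) (fun _ _ => sq_nonneg _)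
    (Finset.mem_univ j)).trans
  (Finset.single_le_sum (f := fun i => ∑ j, X i j ^ 2)
    (fun _ _ => Finset.sum_nonneg fun _ _ => sq_nonneg _) (Finset.mem_univ i))

/-- Convergence in the trace distance implies convergence of the entries: by the exponential metric
increasing property the logarithms converge, and `exp` is continuous. -/
theorem tendsto_of_logDistSq {ι : Type*} {l : Filter ι} {A : Matrix (Fin n) (Fin n) ℝ}
    {F : ι → Matrix (Fin n) (Fin n) ℝ} (hA : A.PosDef) (hF : ∀ᶠ i in l, (F i).PosDef)
    (h : Tendsto (fun i => logDistSq A (F i)) l (𝓝 0)) : Tendsto F l (𝓝 A) := by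
  have hlog : Tendsto (fun i => matLog (F i)) l (𝓝 (matLog A)) := by
    refine tendsto_pi_nhds.2 fun a => tendsto_pi_nhds.2 fun b => ?_
    rw [← tendsto_sub_nhds_zero_iff]
    have h2 : Tendsto (fun i => (matLog (F i) a b - matLog A a b) ^ 2) l (𝓝 0) := by
      refine tendsto_of_tendsto_of_tendsto_of_le_of_le' tendsto_const_nhds h
        (Eventually.of_forall fun i => sq_nonneg _) (hF.mono fun i hi => ?_)
      exact (sq_le_frobSq (matLog (F i) - matLog A) a b).trans (frobSq_matLog_sub_le hA hi)
    have h3 := h2.sqrt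
    simp only [Real.sqrt_sq_eq_abs, Real.sqrt_zero] at h3
    exact (tendsto_zero_iff_abs_tendsto_zero _).2 h3
  have h4 := (continuous_matrix_exp.tendsto (matLog A)).comp hlog
  rw [exp_matLog hA] at h4
  exact h4.congr' (hF.mono fun i hi => exp_matLog hi)

/-- With simultaneous eigenvalues `exp sᵢ`, this is `sᵢ² ≤ 2 cosh sᵢ - 2`. The right-hand side is
visibly continuous in `A` and `B`. -/
theorem logDistSq_le_trace {A B : Matrix (Fin n) (Fin n) ℝ} (hA : A.PosDef) (hB : B.PosDef) :
    logDistSq A B ≤ (A⁻¹ * B).trace + (B⁻¹ * A).trace - 2 * n := by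
  obtain ⟨Q, s, hQ, rfl, rfl⟩ := exists_simultaneous_diagonalization hA hB
  rw [transpose_mul_self_eq, trace_inv_mul_diagonal hQ, trace_inv_mul_diagonal hQ,
    logDistSq_diagonal hQ]
  have : ∑ _i : Fin n, (2 : ℝ) = 2 * n := by simp [mul_comm]
  rw [← this, ← Finset.sum_add_distrib, ← Finset.sum_sub_distrib]
  refine Finset.sum_le_sum fun i _ => ?_
  have := sq_le_exp_add_exp_neg (s i - 0)
  rwa [neg_sub] at this

theorem tendsto_logDistSq_of_tendsto {ι : Type*} {l : Filter ι} {A : Matrix (Fin n) (Fin n) ℝ}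
    {F : ι → Matrix (Fin n) (Fin n) ℝ} (hA : A.PosDef) (hF : ∀ᶠ i in l, (F i).PosDef)
    (h : Tendsto F l (𝓝 A)) : Tendsto (fun i => logDistSq A (F i)) l (𝓝 0) := by
  have hd : A.det ≠ 0 := hA.det_pos.ne'
  have hinv : Tendsto (fun i => (F i)⁻¹) l (𝓝 A⁻¹) := by
    simp only [Matrix.inv_def, Ring.inverse_eq_inv']
    exact ((continuous_id.matrix_det.tendsto A).comp h |>.inv₀ hd).smul
      ((continuous_id.matrix_adjugate.tendsto A).comp h)
  have htr : ∀ {G : ι → Matrix (Fin n) (Fin n) ℝ} {B : Matrix (Fin n) (Fin n) ℝ},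
      Tendsto G l (𝓝 B) → Tendsto (fun i => (G i).trace) l (𝓝 B.trace) := fun hG =>
    (continuous_id.matrix_trace.tendsto _).comp hG
  have hlim : Tendsto (fun i => (A⁻¹ * F i).trace + ((F i)⁻¹ * A).trace - 2 * n) l (𝓝 0) := by
    have := ((htr (h.const_mul A⁻¹)).add (htr (hinv.mul_const A))).sub_const (2 * (n : ℝ))
    rw [nonsing_inv_mul _ (isUnit_iff_ne_zero.2 hd), trace_one, Fintype.card_fin] at this
    convert this using 2
    ring
  exact tendsto_of_tendsto_of_tendsto_of_le_of_le' tendsto_const_nhds hlim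
    (hF.mono fun i hi => logDistSq_nonneg hA hi) (hF.mono fun i hi => logDistSq_le_trace hA hi)

theorem tendsto_logDistSq {ι : Type*} {l : Filter ι} {A B : Matrix (Fin n) (Fin n) ℝ}
    {F G : ι → Matrix (Fin n) (Fin n) ℝ} (hA : A.PosDef) (hB : B.PosDef)
    (hF : ∀ᶠ i in l, (F i).PosDef) (hG : ∀ᶠ i in l, (G i).PosDef)
    (h : Tendsto F l (𝓝 A)) (h' : Tendsto G l (𝓝 B)) :
    Tendsto (fun i => logDistSq (F i) (G i)) l (𝓝 (logDistSq A B)) := by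
  have h1 := (tendsto_logDistSq_of_tendsto hA hF h).sqrt
  have h2 := (tendsto_logDistSq_of_tendsto hB hG h').sqrt
  rw [Real.sqrt_zero] at h1 h2
  have h3 : Tendsto (fun i => √(logDistSq (F i) (G i))) l (𝓝 (√(logDistSq A B))) := by
    have hlow := (tendsto_const_nhds (x := √(logDistSq A B))).sub (h1.add h2)
    have hup := (tendsto_const_nhds (x := √(logDistSq A B))).add (h1.add h2)
    rw [add_zero, sub_zero] at hlow
    rw [add_zero, add_zero] at hup
    refine tendsto_of_tendsto_of_tendsto_of_le_of_le' hlow hup ?_ ?_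
    · filter_upwards [hF, hG] with i hFi hGi
      have a1 := sqrt_logDistSq_triangle hA hB hFi
      have a2 := sqrt_logDistSq_triangle hFi hB hGi
      rw [logDistSq_comm hGi hB] at a2
      linarith
    · filter_upwards [hF, hG] with i hFi hGi
      have a1 := sqrt_logDistSq_triangle hFi hGi hA
      have a2 := sqrt_logDistSq_triangle hA hGi hB
      rw [logDistSq_comm hFi hA] at a1
      linarith
  have h4 := h3.pow 2
  rw [Real.sq_sqrt (logDistSq_nonneg hA hB)] at h4
  refine h4.congr' ?_
  filter_upwards [hF, hG] with i hFi hGi using Real.sq_sqrt (logDistSq_nonneg hFi hGi)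

/-- Completeness of the trace distance: the logarithms form a Cauchy sequence of symmetric matrices,
so they have a symmetric limit, whose exponential is positive definite. -/
theorem exists_tendsto_of_cauchy {F : ℕ → Matrix (Fin n) (Fin n) ℝ} (hF : ∀ k, (F k).PosDef)
    (h : ∀ ε > 0, ∃ N, ∀ k ≥ N, ∀ l ≥ N, √(logDistSq (F k) (F l)) < ε) :
    ∃ B : Matrix (Fin n) (Fin n) ℝ, B.PosDef ∧ Tendsto F atTop (𝓝 B) := by
  have hcau : ∀ i j, CauchySeq fun k => matLog (F k) i j := by
    intro i j
    rw [Metric.cauchySeq_iff]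
    intro ε hε
    obtain ⟨N, hN⟩ := h ε hε
    refine ⟨N, fun k hk l hl => lt_of_le_of_lt ?_ (hN k hk l hl)⟩
    rw [Real.dist_eq, ← Real.sqrt_sq_eq_abs]
    apply Real.sqrt_le_sqrt
    rw [logDistSq_comm (hF k) (hF l)]
    exact (sq_le_frobSq (matLog (F k) - matLog (F l)) i j).trans
      (frobSq_matLog_sub_le (hF l) (hF k))
  choose L hL using fun i j => cauchySeq_tendsto_of_complete (hcau i j)
  have hlim : Tendsto (fun k => matLog (F k)) atTop (𝓝 (Matrix.of L)) :=
    tendsto_pi_nhds.2 fun i => tendsto_pi_nhds.2 fun j => hL i j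
  have hsymm : (Matrix.of L)ᵀ = Matrix.of L := by
    ext i j
    have h1 := hL j i
    have h2 : (fun k => matLog (F k) j i) = fun k => matLog (F k) i j := by
      ext k
      exact congrFun (congrFun (matLog_transpose (hF k)) i) j
    rw [h2] at h1
    exact tendsto_nhds_unique h1 (hL i j)
  refine ⟨NormedSpace.exp (Matrix.of L), posDef_exp hsymm, ?_⟩
  have h4 := (continuous_matrix_exp.tendsto (Matrix.of L)).comp hlim
  exact h4.congr fun k => exp_matLog (hF k)

/-- Geodesic points depend continuously on the end points. The point `H` for the perturbed end
points is almost at the distances from `A` and `B` that `M` has, so the Bruhat–Tits inequality with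
`Z = H` bounds its distance from `M`. -/
theorem tendsto_geodesicPoint {ι : Type*} {l : Filter ι} {A B M : Matrix (Fin n) (Fin n) ℝ}
    {F G H : ι → Matrix (Fin n) (Fin n) ℝ} {t : ℝ} (ht : t ∈ Icc (0 : ℝ) 1) (hA : A.PosDef)
    (hB : B.PosDef) (hM : IsGeodesicPoint t A B M)
    (hF : ∀ᶠ i in l, (F i).PosDef) (hG : ∀ᶠ i in l, (G i).PosDef)
    (hH : ∀ᶠ i in l, IsGeodesicPoint t (F i) (G i) (H i))
    (h : Tendsto F l (𝓝 A)) (h' : Tendsto G l (𝓝 B)) : Tendsto H l (𝓝 M) := by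
  have hHp := hH.mono fun i hi => hi.posDef
  refine tendsto_of_logDistSq hM.posDef hHp ?_
  have hFA := (tendsto_logDistSq_of_tendsto hA hF h).sqrt
  have hGB := (tendsto_logDistSq_of_tendsto hB hG h').sqrt
  have hFG := (tendsto_logDistSq hA hB hF hG h h').sqrt
  rw [Real.sqrt_zero] at hFA hGB
  have hup : Tendsto (fun i =>
      (1 - t) * (t * √(logDistSq (F i) (G i)) + √(logDistSq A (F i))) ^ 2 +
      t * ((1 - t) * √(logDistSq (F i) (G i)) + √(logDistSq B (G i))) ^ 2 -
      t * (1 - t) * logDistSq A B) l (𝓝 0) := by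
    have := ((((((hFG.const_mul t).add hFA).pow 2).const_mul (1 - t)).add
      ((((hFG.const_mul (1 - t)).add hGB).pow 2).const_mul t))).sub_const
        (t * (1 - t) * logDistSq A B)
    convert this using 2
    rw [add_zero, add_zero, mul_pow, mul_pow, Real.sq_sqrt (logDistSq_nonneg hA hB)]
    ring
  refine tendsto_of_tendsto_of_tendsto_of_le_of_le' tendsto_const_nhds hup
    (hHp.mono fun i hi => logDistSq_nonneg hM.posDef hi) ?_
  filter_upwards [hF, hG, hH] with i hFi hGi hHi
  have hc := hM.convex hA hB hHi.posDef ht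
  rw [logDistSq_comm hHi.posDef hM.posDef] at hc
  have hFGn := logDistSq_nonneg hFi hGi
  have e1 : √(logDistSq (H i) A) ≤ t * √(logDistSq (F i) (G i)) + √(logDistSq A (F i)) := by
    have := sqrt_logDistSq_triangle hHi.posDef hA hFi
    rwa [logDistSq_comm hHi.posDef hFi, hHi.left, Real.sqrt_mul (sq_nonneg t),
      Real.sqrt_sq ht.1, logDistSq_comm hFi hA] at this
  have e2 : √(logDistSq (H i) B) ≤ (1 - t) * √(logDistSq (F i) (G i)) + √(logDistSq B (G i)) := by
    have := sqrt_logDistSq_triangle hHi.posDef hB hGi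
    rwa [hHi.right, Real.sqrt_mul (sq_nonneg _),
      Real.sqrt_sq (sub_nonneg.2 ht.2), logDistSq_comm hGi hB] at this
  have f1 := pow_le_pow_left₀ (Real.sqrt_nonneg _) e1 2
  have f2 := pow_le_pow_left₀ (Real.sqrt_nonneg _) e2 2
  rw [Real.sq_sqrt (logDistSq_nonneg hHi.posDef hA)] at f1
  rw [Real.sq_sqrt (logDistSq_nonneg hHi.posDef hB)] at f2
  have g1 := mul_le_mul_of_nonneg_left f1 (sub_nonneg.2 ht.2)
  have g2 := mul_le_mul_of_nonneg_left f2 ht.1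
  linarith

end MatrixGeometry

/-! ### Fixed points of isometries with a bounded orbit -/

section FixedPoint

open Filter Topology

variable {α : Type*} [EMetricSpace α]

/-- The geodesic convexity of an extended metric space that the fixed point argument uses: points
at finite distance are joined by a geodesic along which squared distances satisfy the
Bruhat–Tits (CAT(0)) inequality. -/
def HasConvexGeodesics (α : Type*) [EDist α] : Prop :=
  ∀ p q : α, edist p q ≠ ⊤ → ∃ γ : ℝ → α, IsGeodesic γ p q ∧ ∀ t ∈ Icc (0 : ℝ) 1, ∀ z : α,
    edist z (γ t) ^ 2 + ENNReal.ofReal (t * (1 - t)) * edist p q ^ 2 ≤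
      ENNReal.ofReal (1 - t) * edist z p ^ 2 + ENNReal.ofReal t * edist z q ^ 2

theorem IsGeodesic.edist_left {γ : ℝ → α} {p q : α} (h : IsGeodesic γ p q) {t : ℝ}
    (ht : t ∈ Icc (0 : ℝ) 1) : edist (γ t) p = ENNReal.ofReal t * edist p q := by
  have := h.2.2 t ht 0 ⟨le_rfl, zero_le_one⟩
  rwa [h.1, sub_zero, abs_of_nonneg ht.1] at this

theorem IsGeodesic.edist_right {γ : ℝ → α} {p q : α} (h : IsGeodesic γ p q) {t : ℝ}
    (ht : t ∈ Icc (0 : ℝ) 1) : edist (γ t) q = ENNReal.ofReal (1 - t) * edist p q := by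
  have := h.2.2 t ht 1 ⟨zero_le_one, le_rfl⟩
  rwa [h.2.1, abs_sub_comm, abs_of_nonneg (sub_nonneg.2 ht.2)] at this

/-- The Bruhat–Tits inequality in real numbers, when the right-hand side is finite. -/
theorem toReal_convex {x a b c : ℝ≥0∞} {u : ℝ} (hu : u ∈ Icc (0 : ℝ) 1) (hb : b ≠ ⊤)
    (hc : c ≠ ⊤)
    (h : x ^ 2 + ENNReal.ofReal (u * (1 - u)) * a ^ 2 ≤
      ENNReal.ofReal (1 - u) * b ^ 2 + ENNReal.ofReal u * c ^ 2) :
    x.toReal ^ 2 + u * (1 - u) * a.toReal ^ 2 ≤ (1 - u) * b.toReal ^ 2 + u * c.toReal ^ 2 := by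
  have hu' : 0 ≤ 1 - u := sub_nonneg.2 hu.2
  have hR : ENNReal.ofReal (1 - u) * b ^ 2 + ENNReal.ofReal u * c ^ 2 ≠ ⊤ :=
    ENNReal.add_ne_top.2 ⟨ENNReal.mul_ne_top ENNReal.ofReal_ne_top (ENNReal.pow_ne_top hb),
      ENNReal.mul_ne_top ENNReal.ofReal_ne_top (ENNReal.pow_ne_top hc)⟩
  have hL := ENNReal.add_ne_top.1 (ne_top_of_le_ne_top hR h)
  have h2 := ENNReal.toReal_mono hR h
  rw [ENNReal.toReal_add hL.1 hL.2, ENNReal.toReal_add (ENNReal.add_ne_top.1 hR).1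
    (ENNReal.add_ne_top.1 hR).2] at h2
  simpa only [ENNReal.toReal_mul, ENNReal.toReal_pow, ENNReal.toReal_ofReal hu',
    ENNReal.toReal_ofReal hu.1, ENNReal.toReal_ofReal (mul_nonneg hu.1 hu')] using h2

/-- Geodesics are unique: the Bruhat–Tits inequality for `γ`, tested at the point `γ' t`, has equal
terms on both sides apart from `d(γ' t, γ t)²`. -/
theorem IsGeodesic.eq_of_convex {γ γ' : ℝ → α} {p q : α} (h' : IsGeodesic γ' p q)
    (hpq : edist p q ≠ ⊤) {t : ℝ} (ht : t ∈ Icc (0 : ℝ) 1)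
    (hc : ∀ z : α, edist z (γ t) ^ 2 + ENNReal.ofReal (t * (1 - t)) * edist p q ^ 2 ≤
      ENNReal.ofReal (1 - t) * edist z p ^ 2 + ENNReal.ofReal t * edist z q ^ 2) :
    γ' t = γ t := by
  have h := hc (γ' t)
  rw [h'.edist_left ht, h'.edist_right ht] at h
  have ht' : 0 ≤ 1 - t := sub_nonneg.2 ht.2
  have hR : ENNReal.ofReal (1 - t) * (ENNReal.ofReal t * edist p q) ^ 2 +
      ENNReal.ofReal t * (ENNReal.ofReal (1 - t) * edist p q) ^ 2 =
      ENNReal.ofReal (t * (1 - t)) * edist p q ^ 2 := by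
    rw [mul_pow, mul_pow, ← mul_assoc, ← mul_assoc, ← add_mul, ← ENNReal.ofReal_pow ht.1,
      ← ENNReal.ofReal_pow ht', ← ENNReal.ofReal_mul ht', ← ENNReal.ofReal_mul ht.1,
      ← ENNReal.ofReal_add (by positivity) (mul_nonneg ht.1 (by positivity))]
    congr 2; ring
  rw [hR] at h
  have hfin : ENNReal.ofReal (t * (1 - t)) * edist p q ^ 2 ≠ ⊤ :=
    ENNReal.mul_ne_top ENNReal.ofReal_ne_top (ENNReal.pow_ne_top hpq)
  have h0 : edist (γ' t) (γ t) ^ 2 ≤ 0 := by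
    rw [← ENNReal.add_le_add_iff_right hfin, zero_add]
    exact h
  exact edist_eq_zero.1 (pow_eq_zero_iff two_ne_zero |>.1 (le_antisymm h0 bot_le))

/-- The points at finite distance from `p` form a convex set, which therefore contains the convex
hull of a bounded orbit through `p`. -/
theorem HasConvexGeodesics.geodConvex_component (hα : HasConvexGeodesics α) (p : α) :
    GeodConvex {x : α | edist x p ≠ ⊤} := by
  intro x hx y hy
  have hxy : edist x y ≠ ⊤ := ne_top_of_le_ne_top (ENNReal.add_ne_top.2 ⟨hx, hy⟩)
    (edist_triangle_right x y p)
  obtain ⟨γ, hγ, -⟩ := hα x y hxy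
  refine ⟨γ, hγ, fun t ht => ?_⟩
  refine ne_top_of_le_ne_top (ENNReal.add_ne_top.2 ⟨?_, hx⟩) (edist_triangle (γ t) x p)
  rw [hγ.edist_left ht]
  exact ENNReal.mul_ne_top ENNReal.ofReal_ne_top hxy

/-- Because geodesics are unique, the intersection of convex sets that defines `geodHull` contains
the geodesics between its points. -/
theorem HasConvexGeodesics.mem_geodHull (hα : HasConvexGeodesics α) {S : Set α} {x y : α}
    (hx : x ∈ geodHull S) (hy : y ∈ geodHull S) (hxy : edist x y ≠ ⊤) {γ : ℝ → α}
    (hγ : IsGeodesic γ x y) {t : ℝ} (ht : t ∈ Icc (0 : ℝ) 1) : γ t ∈ geodHull S := by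
  obtain ⟨γ₀, -, hγ₀⟩ := hα x y hxy
  rintro C ⟨hS, hC⟩
  obtain ⟨γ', hγ', hm⟩ := hC x (hx C ⟨hS, hC⟩) y (hy C ⟨hS, hC⟩)
  rw [hγ.eq_of_convex hxy ht (hγ₀ t ht), ← hγ'.eq_of_convex hxy ht (hγ₀ t ht)]
  exact hm t ht

/-- An isometry that maps `S` into itself maps its convex hull into itself: the preimage of the hull
is a convex set containing `S`. -/
theorem HasConvexGeodesics.image_mem_geodHull (hα : HasConvexGeodesics α) {S : Set α}
    {T : α → α} (hT : ∀ x y, edist (T x) (T y) = edist x y) (hTS : ∀ x ∈ S, T x ∈ S)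
    (hfin : ∀ x ∈ geodHull S, ∀ y ∈ geodHull S, edist x y ≠ ⊤) {x : α} (hx : x ∈ geodHull S) :
    T x ∈ geodHull S := by
  refine hx (T ⁻¹' geodHull S) ⟨fun y hy C hC => hC.1 (hTS y hy), fun y hy z hz => ?_⟩
  have hyz : edist (T y) (T z) ≠ ⊤ := hfin _ hy _ hz
  obtain ⟨γ, hγ, -⟩ := hα y z (by rwa [← hT])
  refine ⟨γ, hγ, fun t ht => hα.mem_geodHull (γ := T ∘ γ) hy hz hyz ⟨?_, ?_, ?_⟩ ht⟩
  · simp [hγ.1]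
  · simp [hγ.2.1]
  · intro a ha b hb
    simp only [Function.comp_apply, hT]
    exact hγ.2.2 a ha b hb

/-- **Fixed point theorem** for isometries with a bounded orbit. The squared asymptotic radius
`limsup d(Tᵏp, x)²` is uniformly convex in `x` by the Bruhat–Tits inequality, so sequences in the
convex hull of the orbit that minimize it are Cauchy. It is invariant under `T`, hence `T` fixes
their limit. -/
theorem HasConvexGeodesics.exists_fixedPoint [CompleteSpace α] (hα : HasConvexGeodesics α)
    {T : α → α} (hT : ∀ x y, edist (T x) (T y) = edist x y) {p : α}
    (hp : DistBounded (Set.range fun k : ℕ => T^[k] p)) :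
    ∃ c ∈ distClosure (geodHull (Set.range fun k : ℕ => T^[k] p)), T c = c := by
  set S := Set.range fun k : ℕ => T^[k] p with hS
  set K := geodHull S with hK
  have hSK : S ⊆ K := fun x hx C hC => hC.1 hx
  have hpS : p ∈ S := ⟨0, rfl⟩
  have hKp : ∀ x ∈ K, edist x p ≠ ⊤ := by
    intro x hx
    refine hx _ ⟨?_, hα.geodConvex_component p⟩
    intro y hy
    obtain ⟨C, hC⟩ := hp
    exact ne_top_of_le_ne_top ENNReal.coe_ne_top (hC y hy p hpS)
  have hfin : ∀ x ∈ K, ∀ y ∈ K, edist x y ≠ ⊤ := fun x hx y hy =>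
    ne_top_of_le_ne_top (ENNReal.add_ne_top.2 ⟨hKp x hx, hKp y hy⟩) (edist_triangle_right x y p)
  have hTS : ∀ x ∈ S, T x ∈ S := by
    rintro _ ⟨k, rfl⟩
    exact ⟨k + 1, Function.iterate_succ_apply' T k p⟩
  have hTK : ∀ x ∈ K, T x ∈ K := fun x hx => hα.image_mem_geodHull hT hTS hfin hx
  -- `P x R`: the squared asymptotic radius of the orbit about `x` is at most `R`
  let P : α → ℝ → Prop := fun x R => ∀ᶠ k in atTop, (edist (T^[k] p) x).toReal ^ 2 ≤ R
  let A : Set ℝ := {R | ∃ x ∈ K, P x R}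
  have hAne : A.Nonempty := by
    obtain ⟨C, hC⟩ := hp
    refine ⟨(C : ℝ) ^ 2, p, hSK hpS, Eventually.of_forall fun k => ?_⟩
    exact pow_le_pow_left₀ ENNReal.toReal_nonneg
      (ENNReal.toReal_le_coe_of_le_coe (hC _ ⟨k, rfl⟩ p hpS)) 2
  have hAbdd : BddBelow A := by
    refine ⟨0, ?_⟩
    rintro R ⟨x, -, hx⟩
    obtain ⟨k, hk⟩ := hx.exists
    exact (sq_nonneg _).trans hk
  -- the midpoint of `x` and `y` has a squared radius smaller by `d(x, y)² / 4`
  have hmid : ∀ x ∈ K, ∀ y ∈ K, ∀ R, P x R → P y R →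
      (edist x y).toReal ^ 2 ≤ 4 * (R - sInf A) := by
    intro x hx y hy R hxR hyR
    obtain ⟨γ, hγ, hc⟩ := hα x y (hfin x hx y hy)
    have ht : (1 / 2 : ℝ) ∈ Icc (0 : ℝ) 1 := by constructor <;> norm_num
    have hm : γ (1 / 2) ∈ K := hα.mem_geodHull hx hy (hfin x hx y hy) hγ ht
    have hmem : R - (edist x y).toReal ^ 2 / 4 ∈ A := by
      refine ⟨_, hm, ?_⟩
      filter_upwards [hxR, hyR] with k h1 h2
      have hk : T^[k] p ∈ K := hSK ⟨k, rfl⟩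
      have := toReal_convex ht (hfin _ hk x hx) (hfin _ hk y hy) (hc _ ht (T^[k] p))
      linarith
    have := csInf_le hAbdd hmem
    linarith
  have hex : ∀ m : ℕ, ∃ x ∈ K, P x (sInf A + (1 / 4) * (1 / ((m : ℝ) + 1)) ^ 2) := by
    intro m
    obtain ⟨R, ⟨x, hx, hxR⟩, hR⟩ := Real.lt_sInf_add_pos hAne
      (ε := (1 / 4) * (1 / ((m : ℝ) + 1)) ^ 2) (by positivity)
    exact ⟨x, hx, hxR.mono fun k hk => hk.trans hR.le⟩
  choose x hxK hxP using hex
  have hmono : ∀ {m m' : ℕ} {y : α}, m ≤ m' →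
      P y (sInf A + (1 / 4) * (1 / ((m' : ℝ) + 1)) ^ 2) →
      P y (sInf A + (1 / 4) * (1 / ((m : ℝ) + 1)) ^ 2) := by
    intro m m' y hmm hy
    refine hy.mono fun k hk => hk.trans ?_
    have : (m : ℝ) ≤ m' := by exact_mod_cast hmm
    gcongr
  have hdist : ∀ (m : ℕ), ∀ y ∈ K, ∀ z ∈ K, P y (sInf A + (1 / 4) * (1 / ((m : ℝ) + 1)) ^ 2) →
      P z (sInf A + (1 / 4) * (1 / ((m : ℝ) + 1)) ^ 2) →
      edist y z ≤ ENNReal.ofReal (1 / ((m : ℝ) + 1)) := by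
    intro m y hy z hz hyP hzP
    have h := hmid y hy z hz _ hyP hzP
    rw [← ENNReal.ofReal_toReal (hfin y hy z hz)]
    refine ENNReal.ofReal_le_ofReal (abs_le_of_sq_le_sq' ?_ (by positivity)).2
    linarith
  have hzero : Tendsto (fun m : ℕ => ENNReal.ofReal (1 / ((m : ℝ) + 1))) atTop (𝓝 0) := by
    have := ENNReal.tendsto_ofReal (tendsto_one_div_add_atTop_nhds_zero_nat (𝕜 := ℝ))
    rwa [ENNReal.ofReal_zero] at this
  have hcau : CauchySeq x := by
    refine EMetric.cauchySeq_iff_le_tendsto_0.2 ⟨_, fun a b N ha hb => ?_, hzero⟩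
    exact hdist N _ (hxK a) _ (hxK b) (hmono ha (hxP a)) (hmono hb (hxP b))
  obtain ⟨c, hc⟩ := cauchySeq_tendsto_of_complete hcau
  have hcx : Tendsto (fun m => edist c (x m)) atTop (𝓝 0) := by
    have := tendsto_iff_edist_tendsto_0.1 hc
    simpa only [edist_comm] using this
  refine ⟨c, fun ε hε => ?_, ?_⟩
  · obtain ⟨m, hm⟩ := (hcx.eventually (gt_mem_nhds hε)).exists
    exact ⟨x m, hxK m, hm⟩
  -- `d(Tᵏ⁺¹p, Tx) = d(Tᵏp, x)`, so `T (x m)` is as close to minimizing as `x m`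
  · have hTx : ∀ m, P (T (x m)) (sInf A + (1 / 4) * (1 / ((m : ℝ) + 1)) ^ 2) := by
      intro m
      refine (eventually_atTop.2 ?_)
      obtain ⟨N, hN⟩ := eventually_atTop.1 (hxP m)
      refine ⟨N + 1, fun k hk => ?_⟩
      obtain ⟨j, rfl⟩ : ∃ j, k = j + 1 := ⟨k - 1, by omega⟩
      rw [Function.iterate_succ_apply', hT]
      exact hN j (by omega)
    have hle : ∀ m, edist (T c) c ≤
        edist c (x m) + ENNReal.ofReal (1 / ((m : ℝ) + 1)) + edist c (x m) := by
      intro m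
      calc edist (T c) c ≤ edist (T c) (T (x m)) + edist (T (x m)) (x m) + edist (x m) c :=
            edist_triangle4 _ _ _ _
        _ ≤ _ := by
          rw [hT, edist_comm (x m) c]
          gcongr
          exact hdist m _ (hTK _ (hxK m)) _ (hxK m) (hTx m) (hxP m)
    have hlim := (hcx.add hzero).add hcx
    rw [add_zero, add_zero] at hlim
    have := ge_of_tendsto' hlim hle
    exact edist_eq_zero.1 (le_antisymm this bot_le)

end FixedPoint

/-! ### Frames, Gram matrices and volume forms -/

section Frames

open Matrix

variable {n : ℕ} {M : Type*} [TopologicalSpace M] [ChartedSpace (EuclideanSpace ℝ (Fin n)) M]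

/-- The matrix of an endomorphism of `ℝⁿ` in the standard basis. -/
noncomputable def matOf (L : EuclideanSpace ℝ (Fin n) →L[ℝ] EuclideanSpace ℝ (Fin n)) :
    Matrix (Fin n) (Fin n) ℝ :=
  Matrix.of fun k i => L (EuclideanSpace.single i (1 : ℝ)) k

theorem map_single_eq_sum (L : EuclideanSpace ℝ (Fin n) →L[ℝ] EuclideanSpace ℝ (Fin n))
    (i : Fin n) : L (EuclideanSpace.single i (1 : ℝ)) =
      ∑ k, matOf L k i • (EuclideanSpace.single k (1 : ℝ) : EuclideanSpace ℝ (Fin n)) := by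
  ext j
  simp [matOf, Finset.sum_apply, Pi.single_apply]

theorem matOf_comp (L L' : EuclideanSpace ℝ (Fin n) →L[ℝ] EuclideanSpace ℝ (Fin n)) :
    matOf (L.comp L') = matOf L * matOf L' := by
  ext k i
  rw [Matrix.mul_apply]
  simp only [matOf, Matrix.of_apply, ContinuousLinearMap.comp_apply]
  rw [map_single_eq_sum L' i, map_sum]
  simp [matOf, mul_comm, Pi.single_apply]

theorem matOf_id : matOf (ContinuousLinearMap.id ℝ (EuclideanSpace ℝ (Fin n))) = 1 := by
  ext k i
  simp [matOf, Matrix.one_apply]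

theorem det_matOf (L : EuclideanSpace ℝ (Fin n) →L[ℝ] EuclideanSpace ℝ (Fin n)) :
    (matOf L).det = L.det := by
  rw [ContinuousLinearMap.det, ← LinearMap.det_toMatrix (EuclideanSpace.basisFun (Fin n) ℝ).toBasis]
  congr 1

theorem continuous_matOf : Continuous (matOf (n := n)) := by
  refine continuous_pi fun k => continuous_pi fun i => ?_
  have h : Continuous fun L : EuclideanSpace ℝ (Fin n) →L[ℝ] EuclideanSpace ℝ (Fin n) =>
      L (EuclideanSpace.single i (1 : ℝ)) := by fun_prop
  exact (PiLp.continuous_apply 2 (fun _ : Fin n => ℝ) k).comp h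

/-- An `n`-form on the image of `n` vectors under a matrix `D` is multiplied by `det D`. -/
theorem alternating_matrix_smul {V : Type*} [AddCommGroup V] [Module ℝ V] (η : V [⋀^Fin n]→ₗ[ℝ] ℝ)
    (D : Matrix (Fin n) (Fin n) ℝ) (v : Fin n → V) :
    η (fun i => ∑ k, D k i • v k) = D.det * η v := by
  have h1 : η (fun i => ∑ k, D k i • v k) =
      η.compLinearMap (Fintype.linearCombination ℝ v) (fun i k => D k i) := by
    simp [Fintype.linearCombination_apply]
  have h2 := (η.compLinearMap (Fintype.linearCombination ℝ v)).eq_smul_basis_det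
    (Pi.basisFun ℝ (Fin n))
  rw [h1, h2, AlternatingMap.smul_apply, Pi.basisFun_det_apply, smul_eq_mul, mul_comm]
  have h3 : Matrix.of (fun i k => D k i) = Dᵀ := rfl
  rw [h3, det_transpose]
  congr 1
  rw [AlternatingMap.compLinearMap_apply]
  congr 1
  ext i
  simp [Fintype.linearCombination_apply, Pi.single_apply]

variable {x : M}

theorem gram_matrix_smul (b : TangentSpace (𝓡 n) x →ₗ[ℝ] TangentSpace (𝓡 n) x →ₗ[ℝ] ℝ)
    (D : Matrix (Fin n) (Fin n) ℝ) (v : Fin n → TangentSpace (𝓡 n) x) :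
    gram b (fun i => ∑ k, D k i • v k) = Dᵀ * gram b v * D := by
  ext i j
  simp only [gram, Matrix.of_apply, map_sum, map_smul, LinearMap.sum_apply, LinearMap.smul_apply,
    Matrix.mul_apply, transpose_apply, smul_eq_mul, Finset.sum_mul, Finset.mul_sum]
  exact Finset.sum_congr rfl fun k _ => Finset.sum_congr rfl fun l _ => by ring

theorem eq_sum_stdFrame (v : TangentSpace (𝓡 n) x) :
    v = ∑ k, (show EuclideanSpace ℝ (Fin n) from v) k • stdFrame x k := by
  have := (EuclideanSpace.basisFun (Fin n) ℝ).sum_repr (show EuclideanSpace ℝ (Fin n) from v)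
  simp only [EuclideanSpace.basisFun_apply] at this
  exact this.symm

/-- The Gram matrix of `v₁, …, vₙ` is `Lᵀ G L`, where `G` is the Gram matrix of the standard frame
and the columns of `L` are the coordinates of the `vᵢ`. -/
theorem gram_map_stdFrame (b : TangentSpace (𝓡 n) x →ₗ[ℝ] TangentSpace (𝓡 n) x →ₗ[ℝ] ℝ)
    (v : Fin n → TangentSpace (𝓡 n) x) :
    gram b v = (Matrix.of fun k i => (show EuclideanSpace ℝ (Fin n) from v i) k)ᵀ *
      gram b (stdFrame x) * Matrix.of fun k i => (show EuclideanSpace ℝ (Fin n) from v i) k := by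
  rw [← gram_matrix_smul]
  congr 1
  ext1 i
  exact eq_sum_stdFrame (v i)

theorem bilin_eq_gram (b : TangentSpace (𝓡 n) x →ₗ[ℝ] TangentSpace (𝓡 n) x →ₗ[ℝ] ℝ)
    (v w : TangentSpace (𝓡 n) x) :
    b v w = (show EuclideanSpace ℝ (Fin n) from v).ofLp ⬝ᵥ
      gram b (stdFrame x) *ᵥ (show EuclideanSpace ℝ (Fin n) from w).ofLp := by
  conv_lhs => rw [eq_sum_stdFrame v, eq_sum_stdFrame w]
  simp only [map_sum, map_smul, LinearMap.sum_apply, LinearMap.smul_apply, smul_eq_mul, dotProduct,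
    mulVec, gram, Matrix.of_apply, Finset.mul_sum]
  rw [Finset.sum_comm]
  exact Finset.sum_congr rfl fun k _ => Finset.sum_congr rfl fun l _ => by ring

theorem isSymmPosDef_iff (b : TangentSpace (𝓡 n) x →ₗ[ℝ] TangentSpace (𝓡 n) x →ₗ[ℝ] ℝ) :
    IsSymmPosDef b ↔ (gram b (stdFrame x)).PosDef := by
  rw [posDef_iff_dotProduct_mulVec]
  constructor
  · rintro ⟨h1, h2⟩
    refine ⟨?_, fun {v} hv => ?_⟩
    · ext i j
      simp [gram, h1]
    · have hw : (show TangentSpace (𝓡 n) x from WithLp.toLp 2 v) ≠ 0 := fun h =>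
        hv (congrArg WithLp.ofLp (show (WithLp.toLp 2 v : EuclideanSpace ℝ (Fin n)) = 0 from h))
      have h3 := h2 _ hw
      rw [bilin_eq_gram] at h3
      exact h3
  · rintro ⟨h1, h2⟩
    refine ⟨fun v w => ?_, fun v hv => ?_⟩
    · have h1' : (gram b (stdFrame x))ᵀ = gram b (stdFrame x) := by
        rw [← conjTranspose_eq_transpose_of_trivial]; exact h1
      rw [bilin_eq_gram, bilin_eq_gram, dotProduct_mulVec, dotProduct_comm, ← mulVec_transpose, h1']
    · rw [bilin_eq_gram]
      have := h2 (x := (show EuclideanSpace ℝ (Fin n) from v).ofLp) (fun h => hv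
        (WithLp.ofLp_injective 2 h))
      simpa using this

/-- The volume form of a metric is `μ` as soon as this holds on one frame. -/
theorem agreesAt_iff (μ : VolumeForm n M)
    (b : TangentSpace (𝓡 n) x →ₗ[ℝ] TangentSpace (𝓡 n) x →ₗ[ℝ] ℝ)
    (hb : IsSymmPosDef b) :
    μ.AgreesAt b ↔ (gram b (stdFrame x)).det = μ.form x (stdFrame x) ^ 2 := by
  have hpos := ((isSymmPosDef_iff b).1 hb).det_pos
  constructor
  · intro h
    rw [← sq_abs, h (stdFrame x), Real.sq_sqrt hpos.le]
  · intro h v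
    set D : Matrix (Fin n) (Fin n) ℝ :=
      Matrix.of fun k i => (show EuclideanSpace ℝ (Fin n) from v i) k
    have h1 : gram b v = Dᵀ * gram b (stdFrame x) * D := gram_map_stdFrame b v
    have h2 : μ.form x v = D.det * μ.form x (stdFrame x) := by
      rw [← alternating_matrix_smul]
      congr 1
      ext1 i
      exact eq_sum_stdFrame (v i)
    rw [h1, h2, det_mul, det_mul, det_transpose, h, ← Real.sqrt_sq_eq_abs]
    congr 1
    ring

/-- The bilinear form with a given Gram matrix in the standard frame. -/
noncomputable def ofGram (G : Matrix (Fin n) (Fin n) ℝ) :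
    TangentSpace (𝓡 n) x →ₗ[ℝ] TangentSpace (𝓡 n) x →ₗ[ℝ] ℝ :=
  Matrix.toLinearMap₂ (EuclideanSpace.basisFun (Fin n) ℝ).toBasis
    (EuclideanSpace.basisFun (Fin n) ℝ).toBasis G

theorem gram_ofGram (G : Matrix (Fin n) (Fin n) ℝ) :
    gram (x := x) (ofGram G) (stdFrame x) = G := by
  ext i j
  have h := congrFun (congrFun (LinearMap.toMatrix₂_toLinearMap₂
    (EuclideanSpace.basisFun (Fin n) ℝ).toBasis (EuclideanSpace.basisFun (Fin n) ℝ).toBasis G) i) j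
  rw [LinearMap.toMatrix₂_apply] at h
  simp only [OrthonormalBasis.coe_toBasis, EuclideanSpace.basisFun_apply] at h
  exact h

theorem eq_of_gram_eq {b b' : TangentSpace (𝓡 n) x →ₗ[ℝ] TangentSpace (𝓡 n) x →ₗ[ℝ] ℝ}
    (h : gram b (stdFrame x) = gram b' (stdFrame x)) : b = b' := by
  ext v w
  rw [bilin_eq_gram, bilin_eq_gram, h]

end Frames

/-! ### Coordinate changes -/

section PartialHomeomorph

variable {n : ℕ} {M : Type*} [TopologicalSpace M]

theorem isOpen_overlap (e e' : OpenPartialHomeomorph M (EuclideanSpace ℝ (Fin n))) :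
    IsOpen (e'.target ∩ e'.symm ⁻¹' e.source) :=
  e'.isOpen_inter_preimage_symm e.open_source

variable [MeasurableSpace M] [BorelSpace M]

theorem aemeasurable_symm (e : OpenPartialHomeomorph M (EuclideanSpace ℝ (Fin n))) :
    AEMeasurable e.symm (volume.restrict e.target) :=
  e.continuousOn_symm.aemeasurable e.open_target.measurableSet

theorem measurableSet_target_inter (e : OpenPartialHomeomorph M (EuclideanSpace ℝ (Fin n)))
    {A : Set M} (hA : MeasurableSet A) : MeasurableSet (e.target ∩ e.symm ⁻¹' A) := by
  have h := e.open_target.measurableSet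
  have h2 : Measurable (e.target.domRestrict e.symm) :=
    (continuousOn_iff_continuous_domRestrict.1 e.continuousOn_symm).measurable
  have h3 := h.subtype_image (h2 hA)
  convert h3 using 1
  ext y
  simp only [mem_inter_iff, mem_preimage, mem_image, Subtype.exists, Set.domRestrict_apply]
  constructor
  · rintro ⟨h1, h2⟩; exact ⟨y, h1, h2, rfl⟩
  · rintro ⟨z, h1, h2, rfl⟩; exact ⟨h1, h2⟩

end PartialHomeomorph

section Charts

open Matrix Filter Topology

variable {n : ℕ} {M : Type*} [TopologicalSpace M] [ChartedSpace (EuclideanSpace ℝ (Fin n)) M]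

/-- A chart of the underlying `C¹` structure. In contrast to smooth charts, these can be composed
with `C¹` diffeomorphisms of `M`. -/
structure IsC1Chart (e : OpenPartialHomeomorph M (EuclideanSpace ℝ (Fin n))) : Prop where
  contMDiffOn : ContMDiffOn (𝓡 n) (𝓡 n) 1 e e.source
  contMDiffOn_symm : ContMDiffOn (𝓡 n) (𝓡 n) 1 e.symm e.target

theorem IsChart.isC1Chart [IsManifold (𝓡 n) ∞ M]
    {e : OpenPartialHomeomorph M (EuclideanSpace ℝ (Fin n))} (he : IsChart e) : IsC1Chart e :=
  ⟨(contMDiffOn_of_mem_maximalAtlas he).of_le (by norm_cast),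
    (contMDiffOn_symm_of_mem_maximalAtlas he).of_le (by norm_cast)⟩

theorem isChart_chartAt [IsManifold (𝓡 n) ∞ M] (x : M) :
    IsChart (chartAt (EuclideanSpace ℝ (Fin n)) x) :=
  IsManifold.chart_mem_maximalAtlas x

variable {e e' : OpenPartialHomeomorph M (EuclideanSpace ℝ (Fin n))}

theorem IsC1Chart.mdifferentiableAt (he : IsC1Chart e) {x : M} (hx : x ∈ e.source) :
    MDifferentiableAt (𝓡 n) (𝓡 n) e x :=
  (he.contMDiffOn.contMDiffAt (e.open_source.mem_nhds hx)).mdifferentiableAt one_ne_zero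

theorem IsC1Chart.mdifferentiableAt_symm (he : IsC1Chart e) {y : EuclideanSpace ℝ (Fin n)}
    (hy : y ∈ e.target) : MDifferentiableAt (𝓡 n) (𝓡 n) e.symm y :=
  (he.contMDiffOn_symm.contMDiffAt (e.open_target.mem_nhds hy)).mdifferentiableAt one_ne_zero

/-- The derivative of the inverse chart, as an endomorphism of `ℝⁿ`. -/
noncomputable def chartDeriv (e : OpenPartialHomeomorph M (EuclideanSpace ℝ (Fin n)))
    (y : EuclideanSpace ℝ (Fin n)) : EuclideanSpace ℝ (Fin n) →L[ℝ] EuclideanSpace ℝ (Fin n) :=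
  mfderiv (𝓡 n) (𝓡 n) e.symm y

theorem IsC1Chart.isUnit_matOf_chartDeriv (he : IsC1Chart e) {y : EuclideanSpace ℝ (Fin n)}
    (hy : y ∈ e.target) : IsUnit (matOf (chartDeriv e y)) := by
  have h1 : MDifferentiableAt (𝓡 n) (𝓡 n) e (e.symm y) :=
    he.mdifferentiableAt (e.map_target hy)
  have h2 := he.mdifferentiableAt_symm hy
  have h3 := mfderiv_comp y h1 h2
  have h4 : e ∘ e.symm =ᶠ[𝓝 y] id := by
    filter_upwards [e.open_target.mem_nhds hy] with z hz using e.right_inv hz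
  rw [h4.mfderiv_eq, mfderiv_id] at h3
  have h5 : (ContinuousLinearMap.id ℝ (EuclideanSpace ℝ (Fin n))) =
    (show EuclideanSpace ℝ (Fin n) →L[ℝ] EuclideanSpace ℝ (Fin n) from
      mfderiv (𝓡 n) (𝓡 n) e (e.symm y)).comp (chartDeriv e y) := h3
  have h6 := matOf_comp (show EuclideanSpace ℝ (Fin n) →L[ℝ] EuclideanSpace ℝ (Fin n) from
      mfderiv (𝓡 n) (𝓡 n) e (e.symm y)) (chartDeriv e y)
  rw [← h5, matOf_id] at h6
  exact IsUnit.of_mul_eq_one_right _ h6.symm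

theorem IsC1Chart.contDiffOn_transition (he : IsC1Chart e) (he' : IsC1Chart e') :
    ContDiffOn ℝ 1 (e ∘ e'.symm) (e'.target ∩ e'.symm ⁻¹' e.source) := by
  rw [← contMDiffOn_iff_contDiffOn]
  exact he.contMDiffOn.comp (he'.contMDiffOn_symm.mono inter_subset_left) fun y hy => hy.2

theorem IsC1Chart.chartDeriv_transition (he : IsC1Chart e) (he' : IsC1Chart e')
    {y : EuclideanSpace ℝ (Fin n)} (hy : y ∈ e'.target ∩ e'.symm ⁻¹' e.source) :
    chartDeriv e' y = (chartDeriv e (e (e'.symm y))).comp (fderiv ℝ (e ∘ e'.symm) y) := by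
  have hψ : MDifferentiableAt (𝓡 n) (𝓡 n) (e ∘ e'.symm) y :=
    (he.mdifferentiableAt hy.2).comp y (he'.mdifferentiableAt_symm hy.1)
  have h2 : MDifferentiableAt (𝓡 n) (𝓡 n) e.symm ((e ∘ e'.symm) y) :=
    he.mdifferentiableAt_symm (e.map_source hy.2)
  have h3 := mfderiv_comp y h2 hψ
  have h4 : e.symm ∘ (e ∘ e'.symm) =ᶠ[𝓝 y] e'.symm := by
    filter_upwards [(isOpen_overlap e e').mem_nhds hy] with z hz using e.left_inv hz.2
  rw [h4.mfderiv_eq] at h3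
  have h5 := mfderiv_eq_fderiv (𝕜 := ℝ) (f := e ∘ e'.symm) (x := y)
  rw [h5] at h3
  exact h3

theorem chartCoeff_eq (g : TwoTensor n M) (e : OpenPartialHomeomorph M (EuclideanSpace ℝ (Fin n)))
    (y : EuclideanSpace ℝ (Fin n)) : chartCoeff g e y = (matOf (chartDeriv e y))ᵀ *
      gram (g (e.symm y)) (stdFrame (e.symm y)) * matOf (chartDeriv e y) :=
  gram_map_stdFrame _ _

theorem form_chartFrame (μ : VolumeForm n M)
    (e : OpenPartialHomeomorph M (EuclideanSpace ℝ (Fin n))) (y : EuclideanSpace ℝ (Fin n)) :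
    μ.form (e.symm y) (chartFrame e y) = (matOf (chartDeriv e y)).det *
      μ.form (e.symm y) (stdFrame (e.symm y)) := by
  rw [← alternating_matrix_smul]
  congr 1
  ext1 i
  exact eq_sum_stdFrame (chartFrame e y i)

/-- The Jacobian matrix of the change of coordinates from `e'` to `e`. -/
noncomputable def transMat (e e' : OpenPartialHomeomorph M (EuclideanSpace ℝ (Fin n)))
    (y : EuclideanSpace ℝ (Fin n)) : Matrix (Fin n) (Fin n) ℝ :=
  matOf (fderiv ℝ (e ∘ e'.symm) y)

theorem IsC1Chart.matOf_chartDeriv_transition (he : IsC1Chart e) (he' : IsC1Chart e')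
    {y : EuclideanSpace ℝ (Fin n)} (hy : y ∈ e'.target ∩ e'.symm ⁻¹' e.source) :
    matOf (chartDeriv e' y) = matOf (chartDeriv e (e (e'.symm y))) * transMat e e' y := by
  rw [he.chartDeriv_transition he' hy, matOf_comp, transMat]

theorem IsC1Chart.continuousOn_transMat (he : IsC1Chart e) (he' : IsC1Chart e') :
    ContinuousOn (transMat e e') (e'.target ∩ e'.symm ⁻¹' e.source) :=
  continuous_matOf.comp_continuousOn
    ((he.contDiffOn_transition he').continuousOn_fderiv_of_isOpen (isOpen_overlap e e') le_rfl)

/-- Transformation law of the components of a `(0,2)`-tensor. -/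
theorem IsC1Chart.chartCoeff_transition (he : IsC1Chart e) (he' : IsC1Chart e')
    (g : TwoTensor n M) {y : EuclideanSpace ℝ (Fin n)}
    (hy : y ∈ e'.target ∩ e'.symm ⁻¹' e.source) :
    chartCoeff g e' y = (transMat e e' y)ᵀ * chartCoeff g e (e (e'.symm y)) * transMat e e' y := by
  have hx : e.symm (e (e'.symm y)) = e'.symm y := e.left_inv hy.2
  rw [chartCoeff_eq, chartCoeff_eq, he.matOf_chartDeriv_transition he' hy, hx, transpose_mul]
  simp only [Matrix.mul_assoc]

/-- Transformation law of the component of the volume form. -/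
theorem IsC1Chart.form_transition (he : IsC1Chart e) (he' : IsC1Chart e')
    (μ : VolumeForm n M) {y : EuclideanSpace ℝ (Fin n)}
    (hy : y ∈ e'.target ∩ e'.symm ⁻¹' e.source) :
    μ.form (e'.symm y) (chartFrame e' y) = (transMat e e' y).det *
      μ.form (e.symm (e (e'.symm y))) (chartFrame e (e (e'.symm y))) := by
  have hx : e.symm (e (e'.symm y)) = e'.symm y := e.left_inv hy.2
  rw [form_chartFrame, form_chartFrame, he.matOf_chartDeriv_transition he' hy, hx, det_mul]
  ring

theorem posDef_chartCoeff_iff (he : IsC1Chart e) (g : TwoTensor n M)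
    {y : EuclideanSpace ℝ (Fin n)} (hy : y ∈ e.target) :
    (chartCoeff g e y).PosDef ↔ IsSymmPosDef (g (e.symm y)) := by
  rw [chartCoeff_eq, posDef_congruence (he.isUnit_matOf_chartDeriv hy), isSymmPosDef_iff]

theorem trLogSq_eq (g h : TwoTensor n M) (x : M) : trLogSq g h x =
    logDistSq (gram (g x) (stdFrame x)) (gram (h x) (stdFrame x)) := rfl

theorem trLogSq_eq_chartCoeff (he : IsC1Chart e) (g h : TwoTensor n M)
    {y : EuclideanSpace ℝ (Fin n)} (hy : y ∈ e.target) (hg : IsSymmPosDef (g (e.symm y)))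
    (hh : IsSymmPosDef (h (e.symm y))) :
    trLogSq g h (e.symm y) = logDistSq (chartCoeff g e y) (chartCoeff h e y) := by
  rw [isSymmPosDef_iff] at hg hh
  rw [trLogSq_eq, chartCoeff_eq, chartCoeff_eq,
    logDistSq_congruence (he.isUnit_matOf_chartDeriv hy) hg hh]

theorem exists_finite_chart_cover [CompactSpace M] [IsManifold (𝓡 n) ∞ M] : ∃ t : Finset M,
    ⋃ x ∈ t, (chartAt (EuclideanSpace ℝ (Fin n)) x).source = univ := by
  obtain ⟨t, -, ht⟩ := isCompact_univ.elim_nhds_subcover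
    (fun x : M => (chartAt (EuclideanSpace ℝ (Fin n)) x).source)
    fun x _ => chart_source_mem_nhds _ x
  exact ⟨t, univ_subset_iff.1 ht⟩

/-! ### The measure of the volume form -/

variable [MeasurableSpace M] [BorelSpace M]

theorem chartMeasure_apply (μ : VolumeForm n M)
    (e : OpenPartialHomeomorph M (EuclideanSpace ℝ (Fin n))) {A : Set M} (hA : MeasurableSet A) :
    μ.chartMeasure e A = ∫⁻ y in e.target ∩ e.symm ⁻¹' A,
      ENNReal.ofReal |μ.form (e.symm y) (chartFrame e y)| := by
  have hm := aemeasurable_symm e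
  rw [VolumeForm.chartMeasure, Measure.map_apply_of_aemeasurable
    (hm.mono_ac (withDensity_absolutelyContinuous _ _)) hA]
  have hnull : NullMeasurableSet (e.symm ⁻¹' A) (volume.restrict e.target) :=
    hm.nullMeasurableSet_preimage hA
  rw [withDensity_apply' _ (e.symm ⁻¹' A), Measure.restrict_restrict₀ hnull, inter_comm]

theorem chartMeasure_inter_source (μ : VolumeForm n M)
    (e : OpenPartialHomeomorph M (EuclideanSpace ℝ (Fin n))) {A : Set M} (hA : MeasurableSet A) :
    μ.chartMeasure e (A ∩ e.source) = μ.chartMeasure e A := by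
  rw [chartMeasure_apply μ e hA, chartMeasure_apply μ e (hA.inter e.open_source.measurableSet)]
  congr 2
  ext y
  simp only [mem_inter_iff, mem_preimage]
  exact ⟨fun h => ⟨h.1, h.2.1⟩, fun h => ⟨h.1, h.2, e.map_target h.1⟩⟩

/-- The measures defined by two charts agree on the overlap of their domains, by the change of
variables formula. -/
theorem IsC1Chart.chartMeasure_eq (he : IsC1Chart e) (he' : IsC1Chart e') (μ : VolumeForm n M)
    {A : Set M} (hA : MeasurableSet A) (h : A ⊆ e.source) (h' : A ⊆ e'.source) :
    μ.chartMeasure e A = μ.chartMeasure e' A := by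
  rw [chartMeasure_apply μ e hA, chartMeasure_apply μ e' hA]
  set s := e'.target ∩ e'.symm ⁻¹' A
  have hs : MeasurableSet s := measurableSet_target_inter e' hA
  have hsub : s ⊆ e'.target ∩ e'.symm ⁻¹' e.source := fun y hy => ⟨hy.1, h hy.2⟩
  have himg : e.target ∩ e.symm ⁻¹' A = (e ∘ e'.symm) '' s := by
    ext z
    constructor
    · rintro ⟨h1, h2⟩
      refine ⟨e' (e.symm z), ⟨e'.map_source (h' h2), ?_⟩, ?_⟩
      · rw [mem_preimage, e'.left_inv (h' h2)]; exact h2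
      · rw [Function.comp_apply, e'.left_inv (h' h2), e.right_inv h1]
    · rintro ⟨y, ⟨h1, h2⟩, rfl⟩
      refine ⟨e.map_source (h h2), ?_⟩
      rw [mem_preimage, Function.comp_apply, e.left_inv (h h2)]
      exact h2
  have hinj : InjOn (e ∘ e'.symm) s := by
    intro y hy z hz hyz
    exact e'.symm.injOn hy.1 hz.1 (e.injOn (h hy.2) (h hz.2) hyz)
  have hder : ∀ y ∈ s, HasFDerivWithinAt (e ∘ e'.symm) (fderiv ℝ (e ∘ e'.symm) y) s y := by
    intro y hy
    have hd := ((he.contDiffOn_transition he').contDiffAt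
      ((isOpen_overlap e e').mem_nhds (hsub hy))).differentiableAt one_ne_zero
    exact hd.hasFDerivAt.hasFDerivWithinAt
  rw [himg, lintegral_image_eq_lintegral_abs_det_fderiv_mul volume hs hder hinj]
  refine setLIntegral_congr_fun hs fun y hy => ?_
  rw [he.form_transition he' μ (hsub hy), abs_mul, ENNReal.ofReal_mul (abs_nonneg _), transMat,
    det_matOf]
  rfl

/-- The supremum of measures that defines `μ.measure` is not a supremum of values on each set, so
this is proved by exhibiting a measure above all chart measures that agrees with `μ.chartMeasure e`
on the domain of `e`. -/
theorem measure_le_chartMeasure [IsManifold (𝓡 n) ∞ M] (he : IsChart e) (μ : VolumeForm n M)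
    {A : Set M} (hA : MeasurableSet A) (h : A ⊆ e.source) : μ.measure A ≤ μ.chartMeasure e A := by
  -- a measure that is infinite off the domain of `e` dominates all chart measures
  have hle : μ.measure ≤ μ.chartMeasure e + (⊤ : ℝ≥0∞) • Measure.count.restrict e.sourceᶜ := by
    refine iSup₂_le fun e' he' => ?_
    refine Measure.le_iff.2 fun B hB => ?_
    have hsrc := e.open_source.measurableSet
    by_cases hBe : B ⊆ e.source
    · rw [← chartMeasure_inter_source μ e' hB, Measure.add_apply]
      have hm := hB.inter e'.open_source.measurableSet
      rw [(he'.isC1Chart).chartMeasure_eq he.isC1Chart μ hm inter_subset_right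
        (inter_subset_left.trans hBe)]
      exact (measure_mono inter_subset_left).trans le_self_add
    · obtain ⟨x, hxB, hx⟩ := not_subset.1 hBe
      have hpos : (Measure.count.restrict e.sourceᶜ) B ≠ 0 := by
        rw [Measure.restrict_apply hB]
        exact Measure.count_ne_zero ⟨x, hxB, hx⟩
      rw [Measure.add_apply, Measure.smul_apply, smul_eq_mul, ENNReal.top_mul hpos, add_top]
      exact le_top
  refine (hle A).trans ?_
  rw [Measure.add_apply, Measure.smul_apply, Measure.restrict_apply hA,
    show A ∩ e.sourceᶜ = ∅ from disjoint_compl_right_iff_subset.2 h |>.inter_eq]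
  simp

theorem measure_eq_chartMeasure [IsManifold (𝓡 n) ∞ M] (he : IsChart e) (μ : VolumeForm n M)
    {A : Set M} (hA : MeasurableSet A) (h : A ⊆ e.source) : μ.measure A = μ.chartMeasure e A :=
  le_antisymm (measure_le_chartMeasure he μ hA h)
    (Measure.le_iff'.1 (le_iSup₂ (f := fun e (_ : IsChart e) => μ.chartMeasure e) e he) A)

theorem measure_ext_of_charts [CompactSpace M] [IsManifold (𝓡 n) ∞ M] {ν ν' : Measure M}
    (h : ∀ x : M, ∀ A, MeasurableSet A → A ⊆ (chartAt (EuclideanSpace ℝ (Fin n)) x).source →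
      ν A = ν' A) : ν = ν' := by
  obtain ⟨t, ht⟩ := exists_finite_chart_cover (n := n) (M := M)
  refine Measure.ext_of_biUnion_eq_univ (S := (t : Set M)) t.countable_toSet
    (s := fun x => (chartAt (EuclideanSpace ℝ (Fin n)) x).source) (by simpa using ht)
    fun x _ => ?_
  refine Measure.ext fun A hA => ?_
  rw [Measure.restrict_apply hA, Measure.restrict_apply hA]
  exact h x _ (hA.inter (chartAt _ x).open_source.measurableSet) inter_subset_right

/-- The measure of the volume form has the expected expression in `C¹` charts as well, although its
definition refers only to smooth charts. -/
theorem IsC1Chart.measure_eq_chartMeasure [CompactSpace M] [IsManifold (𝓡 n) ∞ M]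
    (he : IsC1Chart e) (μ : VolumeForm n M)
    {A : Set M} (hA : MeasurableSet A) (h : A ⊆ e.source) : μ.measure A = μ.chartMeasure e A := by
  have key : μ.measure.restrict e.source = (μ.chartMeasure e).restrict e.source := by
    refine measure_ext_of_charts (n := n) fun x B hB hBx => ?_
    have hm := hB.inter e.open_source.measurableSet
    rw [Measure.restrict_apply hB, Measure.restrict_apply hB,
      FixedVolumeMetrics.measure_eq_chartMeasure (isChart_chartAt x) μ hm
        (inter_subset_left.trans hBx)]
    exact (isChart_chartAt x).isC1Chart.chartMeasure_eq he μ hm (inter_subset_left.trans hBx)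
      inter_subset_right
  have := congrArg (fun ν => ν A) key
  simpa only [Measure.restrict_apply hA, inter_eq_left.2 h] using this

theorem restrict_source_eq_chartMeasure [CompactSpace M] [IsManifold (𝓡 n) ∞ M]
    (he : IsC1Chart e) (μ : VolumeForm n M) :
    μ.measure.restrict e.source = μ.chartMeasure e := by
  refine Measure.ext fun A hA => ?_
  rw [Measure.restrict_apply hA, he.measure_eq_chartMeasure μ
    (hA.inter e.open_source.measurableSet) inter_subset_right, chartMeasure_inter_source μ e hA]

end Charts

/-! ### Null sets and measurability in charts -/

section ChartMeasurability

open Matrix Filter Topology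

variable {n : ℕ} {M : Type*} [TopologicalSpace M] [ChartedSpace (EuclideanSpace ℝ (Fin n)) M]
  {e e' : OpenPartialHomeomorph M (EuclideanSpace ℝ (Fin n))}

theorem form_stdFrame_ne_zero (μ : VolumeForm n M) (x : M) : μ.form x (stdFrame x) ≠ 0 := by
  intro h
  apply μ.ne_zero x
  ext v
  have : v = fun i => ∑ k, (Matrix.of fun k i => (show EuclideanSpace ℝ (Fin n) from v i) k :
      Matrix (Fin n) (Fin n) ℝ) k i • stdFrame x k := by
    ext1 i
    exact eq_sum_stdFrame (v i)
  rw [this, alternating_matrix_smul, h]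
  simp

theorem IsC1Chart.form_chartFrame_ne_zero (he : IsC1Chart e) (μ : VolumeForm n M)
    {y : EuclideanSpace ℝ (Fin n)} (hy : y ∈ e.target) :
    μ.form (e.symm y) (chartFrame e y) ≠ 0 := by
  rw [form_chartFrame]
  exact mul_ne_zero ((isUnit_iff_isUnit_det _).1 (he.isUnit_matOf_chartDeriv hy)).ne_zero
    (form_stdFrame_ne_zero μ _)

theorem IsChart.continuousOn_density (he : IsChart e) (μ : VolumeForm n M) :
    ContinuousOn (fun y => ENNReal.ofReal |μ.form (e.symm y) (chartFrame e y)|) e.target :=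
  ENNReal.continuous_ofReal.comp_continuousOn (μ.smooth e he).continuousOn.abs

/-- Changes of coordinates preserve null sets. -/
theorem IsC1Chart.map_transition_absolutelyContinuous (he : IsC1Chart e) (he' : IsC1Chart e') :
    (volume.restrict (e'.target ∩ e'.symm ⁻¹' e.source)).map (e ∘ e'.symm) ≪
      volume.restrict e.target := by
  have hW := (isOpen_overlap e e').measurableSet
  have hcont := (he.contDiffOn_transition he').continuousOn
  refine Measure.AbsolutelyContinuous.mk fun N hN h0 => ?_
  rw [Measure.restrict_apply hN] at h0
  rw [Measure.map_apply_of_aemeasurable (hcont.aemeasurable hW) hN]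
  rw [Measure.restrict_apply' hW]
  refine measure_mono_null (t := (e' ∘ e.symm) '' ((e.target ∩ e.symm ⁻¹' e'.source) ∩ N)) ?_ ?_
  · rintro y ⟨h1, h2, h3⟩
    refine ⟨e (e'.symm y), ⟨⟨e.map_source h3, ?_⟩, h1⟩, ?_⟩
    · rw [mem_preimage, e.left_inv h3]; exact e'.map_target h2
    · rw [Function.comp_apply, e.left_inv h3, e'.right_inv h2]
  · refine addHaar_image_eq_zero_of_differentiableOn_of_addHaar_eq_zero _
      (((he'.contDiffOn_transition he).differentiableOn one_ne_zero).mono inter_subset_left) ?_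
    exact measure_mono_null (t := N ∩ e.target) (fun y hy => ⟨hy.2, hy.1.1⟩) h0

/-- Almost everywhere measurability of a matrix-valued function. Matrices carry no measurable
structure in Mathlib, so this is required of each entry. -/
def AEMeasurableEntries {β : Type*} [MeasurableSpace β] (F : β → Matrix (Fin n) (Fin n) ℝ)
    (ν : Measure β) : Prop :=
  ∀ i j, AEMeasurable (fun b => F b i j) ν

theorem AEMeasurableEntries.mul {β : Type*} [MeasurableSpace β] {ν : Measure β}
    {F G : β → Matrix (Fin n) (Fin n) ℝ} (hF : AEMeasurableEntries F ν)
    (hG : AEMeasurableEntries G ν) : AEMeasurableEntries (fun b => F b * G b) ν := by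
  intro i j
  simp only [Matrix.mul_apply]
  exact Finset.aemeasurable_fun_sum _ fun k _ => (hF i k).mul (hG k j)

theorem AEMeasurableEntries.congr {β : Type*} [MeasurableSpace β] {ν : Measure β}
    {F G : β → Matrix (Fin n) (Fin n) ℝ} (hF : AEMeasurableEntries F ν)
    (h : F =ᵐ[ν] G) : AEMeasurableEntries G ν := fun i j =>
  (hF i j).congr (h.mono fun b hb => by simp only [hb])

/-- If the components of a tensor field are measurable in a family of `C¹` charts covering `M`,
they are measurable in every `C¹` chart. -/
theorem aemeasurable_chartCoeff_of_cover (he' : IsC1Chart e') {ι : Type*} [Countable ι]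
    {c : ι → OpenPartialHomeomorph M (EuclideanSpace ℝ (Fin n))}
    (hc : ∀ i, IsC1Chart (c i)) (hcover : ⋃ i, (c i).source = univ) {g : TwoTensor n M}
    (hg : ∀ i, AEMeasurableEntries (chartCoeff g (c i)) (volume.restrict (c i).target)) :
    AEMeasurableEntries (chartCoeff g e') (volume.restrict e'.target) := by
  have hT : e'.target = ⋃ i, e'.target ∩ e'.symm ⁻¹' (c i).source := by
    simp only [← inter_iUnion, ← preimage_iUnion, hcover, preimage_univ, inter_univ]
  suffices h : ∀ i, AEMeasurableEntries (chartCoeff g e')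
      (volume.restrict (e'.target ∩ e'.symm ⁻¹' (c i).source)) by
    intro k l
    rw [hT, aemeasurable_iUnion_iff]
    exact fun i => h i k l
  intro i
  have hW := (isOpen_overlap (c i) e').measurableSet
  have h1 : AEMeasurableEntries (fun y => chartCoeff g (c i) (((c i) ∘ e'.symm) y))
      (volume.restrict (e'.target ∩ e'.symm ⁻¹' (c i).source)) := fun k l =>
    ((hg i k l).mono_ac ((hc i).map_transition_absolutelyContinuous he')).comp_aemeasurable
      (((hc i).contDiffOn_transition he').continuousOn.aemeasurable hW)
  have h2 : AEMeasurableEntries (transMat (c i) e')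
      (volume.restrict (e'.target ∩ e'.symm ⁻¹' (c i).source)) := fun k l =>
    ((continuous_id.matrix_elem k l).comp_continuousOn
      ((hc i).continuousOn_transMat he')).aemeasurable hW
  have h3 : AEMeasurableEntries (fun y => (transMat (c i) e' y)ᵀ)
      (volume.restrict (e'.target ∩ e'.symm ⁻¹' (c i).source)) := fun k l => h2 l k
  refine ((h3.mul h1).mul h2).congr ?_
  filter_upwards [ae_restrict_mem hW] with y hy
  exact ((hc i).chartCoeff_transition he' g hy).symm

variable [MeasurableSpace M] [BorelSpace M] [CompactSpace M] [IsManifold (𝓡 n) ∞ M]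

/-- As the volume form vanishes nowhere, null sets of its measure are null in coordinates. -/
theorem ae_symm_of_ae (he : IsChart e) (μ : VolumeForm n M) {p : M → Prop}
    (h : ∀ᵐ x ∂μ.measure, p x) : ∀ᵐ y ∂volume.restrict e.target, p (e.symm y) := by
  have h1 : ∀ᵐ x ∂μ.chartMeasure e, p x := by
    rw [← restrict_source_eq_chartMeasure he.isC1Chart μ]
    exact ae_restrict_of_ae h
  have h2 := ae_of_ae_map ((aemeasurable_symm e).mono_ac (withDensity_absolutelyContinuous _ _)) h1
  refine (withDensity_absolutelyContinuous'
    ((he.continuousOn_density μ).aemeasurable e.open_target.measurableSet) ?_).ae_le h2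
  filter_upwards [ae_restrict_mem e.open_target.measurableSet] with y hy
  simpa using he.isC1Chart.form_chartFrame_ne_zero μ hy

theorem map_chart_absolutelyContinuous (he : IsC1Chart e) (μ : VolumeForm n M) :
    (μ.measure.restrict e.source).map e ≪ volume.restrict e.target := by
  have hac := withDensity_absolutelyContinuous (volume.restrict e.target)
    fun y => ENNReal.ofReal |μ.form (e.symm y) (chartFrame e y)|
  have hem : AEMeasurable e (μ.measure.restrict e.source) :=
    e.continuousOn.aemeasurable e.open_source.measurableSet
  rw [restrict_source_eq_chartMeasure he μ] at hem ⊢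
  rw [VolumeForm.chartMeasure] at hem ⊢
  rw [AEMeasurable.map_map_of_aemeasurable hem ((aemeasurable_symm e).mono_ac hac)]
  have hid : (e ∘ e.symm) =ᵐ[(volume.restrict e.target).withDensity
      fun y => ENNReal.ofReal |μ.form (e.symm y) (chartFrame e y)|] id := by
    refine hac.ae_le ?_
    filter_upwards [ae_restrict_mem e.open_target.measurableSet] with y hy using e.right_inv hy
  rw [Measure.map_congr hid, Measure.map_id]
  exact hac

theorem aemeasurable_of_charts (μ : VolumeForm n M) {β : Type*} [MeasurableSpace β] {F : M → β}
    (h : ∀ x : M, AEMeasurable (fun y => F ((chartAt (EuclideanSpace ℝ (Fin n)) x).symm y))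
      (volume.restrict (chartAt (EuclideanSpace ℝ (Fin n)) x).target)) :
    AEMeasurable F μ.measure := by
  obtain ⟨t, ht⟩ := exists_finite_chart_cover (n := n) (M := M)
  have ht' : ⋃ x : t, (chartAt (EuclideanSpace ℝ (Fin n)) (x : M)).source = univ := by
    simpa [iUnion_subtype] using ht
  rw [← Measure.restrict_univ (μ := μ.measure), ← ht', aemeasurable_iUnion_iff]
  rintro ⟨x, -⟩
  have he := (isChart_chartAt (n := n) x).isC1Chart
  set e := chartAt (EuclideanSpace ℝ (Fin n)) x
  refine (((h x).mono_ac (map_chart_absolutelyContinuous he μ)).comp_aemeasurable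
    (e.continuousOn.aemeasurable e.open_source.measurableSet)).congr ?_
  filter_upwards [ae_restrict_mem e.open_source.measurableSet] with z hz
  rw [Function.comp_apply, e.left_inv hz]

theorem measure_univ_lt_top (μ : VolumeForm n M) : μ.measure univ < ⊤ := by
  refine isCompact_univ.measure_lt_top_of_nhdsWithin fun x _ => ?_
  rw [nhdsWithin_univ]
  have he := isChart_chartAt (n := n) x
  set e := chartAt (EuclideanSpace ℝ (Fin n)) x
  have hx : x ∈ e.source := mem_chart_source _ x
  have hcont := (he.continuousOn_density μ).continuousAt
    (e.open_target.mem_nhds (e.map_source hx))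
  set d := fun y => ENNReal.ofReal |μ.form (e.symm y) (chartFrame e y)|
  have hlt : ∀ᶠ y in 𝓝 (e x), d y < d (e x) + 1 :=
    hcont.eventually (gt_mem_nhds (ENNReal.lt_add_right ENNReal.ofReal_ne_top one_ne_zero))
  obtain ⟨r, hr, hball⟩ := Metric.eventually_nhds_iff_ball.1
    (hlt.and (e.open_target.mem_nhds (e.map_source hx)))
  refine ⟨e.source ∩ e ⁻¹' Metric.ball (e x) r,
    (e.isOpen_inter_preimage Metric.isOpen_ball).mem_nhds ⟨hx, Metric.mem_ball_self hr⟩, ?_⟩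
  have hA := (e.isOpen_inter_preimage (Metric.isOpen_ball (x := e x) (ε := r))).measurableSet
  rw [measure_eq_chartMeasure he μ hA inter_subset_left, chartMeasure_apply μ e hA]
  have hsub : e.target ∩ e.symm ⁻¹' (e.source ∩ e ⁻¹' Metric.ball (e x) r) ⊆
      Metric.ball (e x) r := by
    rintro y ⟨h1, -, h3⟩
    rwa [mem_preimage, e.right_inv h1] at h3
  calc _ ≤ ∫⁻ y in Metric.ball (e x) r, d y := lintegral_mono_set hsub
    _ ≤ ∫⁻ _ in Metric.ball (e x) r, (d (e x) + 1) :=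
        setLIntegral_mono measurable_const fun y hy => (hball y hy).1.le
    _ < ⊤ := by
      rw [setLIntegral_const]
      exact ENNReal.mul_lt_top (ENNReal.add_lt_top.2 ⟨ENNReal.ofReal_lt_top, ENNReal.one_lt_top⟩)
        measure_ball_lt_top

end ChartMeasurability

/-! ### Pullback by a diffeomorphism -/

section Pullback

open Matrix Filter Topology

variable {n : ℕ} {M : Type*} [TopologicalSpace M] [ChartedSpace (EuclideanSpace ℝ (Fin n)) M]
  {e : OpenPartialHomeomorph M (EuclideanSpace ℝ (Fin n))} (φ : M ≃ₘ^1⟮𝓡 n, 𝓡 n⟯ M)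

/-- The chart `e ∘ φ`. For a `C¹` diffeomorphism `φ` it is a `C¹` chart, but in general not a chart
of the smooth structure. -/
noncomputable def pullChart (e : OpenPartialHomeomorph M (EuclideanSpace ℝ (Fin n))) :
    OpenPartialHomeomorph M (EuclideanSpace ℝ (Fin n)) :=
  φ.toHomeomorph.transOpenPartialHomeomorph e

theorem pullChart_source (e : OpenPartialHomeomorph M (EuclideanSpace ℝ (Fin n))) :
    (pullChart φ e).source = φ ⁻¹' e.source := rfl

theorem pullChart_target (e : OpenPartialHomeomorph M (EuclideanSpace ℝ (Fin n))) :
    (pullChart φ e).target = e.target := rfl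

theorem pullChart_symm_apply (e : OpenPartialHomeomorph M (EuclideanSpace ℝ (Fin n)))
    (y : EuclideanSpace ℝ (Fin n)) : (pullChart φ e).symm y = φ.symm (e.symm y) := rfl

theorem IsC1Chart.pullChart (he : IsC1Chart e) : IsC1Chart (pullChart φ e) := by
  constructor
  · exact he.contMDiffOn.comp φ.contMDiff.contMDiffOn fun x hx => hx
  · exact φ.symm.contMDiff.comp_contMDiffOn he.contMDiffOn_symm

/-- The matrix of the derivative of `φ` at `x`, in the standard frames at `x` and `φ x`. -/
noncomputable def derivMat (x : M) : Matrix (Fin n) (Fin n) ℝ :=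
  matOf (show EuclideanSpace ℝ (Fin n) →L[ℝ] EuclideanSpace ℝ (Fin n) from
    mfderiv (𝓡 n) (𝓡 n) φ x)

theorem derivMat_symm_mul (x : M) : derivMat φ.symm (φ x) * derivMat φ x = 1 := by
  have h1 : MDifferentiableAt (𝓡 n) (𝓡 n) φ x := φ.mdifferentiable one_ne_zero x
  have h2 : MDifferentiableAt (𝓡 n) (𝓡 n) φ.symm (φ x) := φ.symm.mdifferentiable one_ne_zero _
  have h3 := mfderiv_comp x h2 h1
  have h4 : φ.symm ∘ φ = id := funext φ.symm_apply_apply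
  rw [h4, mfderiv_id] at h3
  rw [derivMat, derivMat, ← matOf_comp, ← matOf_id]
  congr 1
  exact h3.symm

theorem isUnit_derivMat (x : M) : IsUnit (derivMat φ x) :=
  IsUnit.of_mul_eq_one_right _ (derivMat_symm_mul φ x)

theorem gram_pullback (g : TwoTensor n M) (x : M) :
    gram (pullback φ g x) (stdFrame x) =
      (derivMat φ x)ᵀ * gram (g (φ x)) (stdFrame (φ x)) * derivMat φ x :=
  gram_map_stdFrame (g (φ x)) fun i => mfderiv (𝓡 n) (𝓡 n) φ x (stdFrame x i)

theorem isSymmPosDef_pullback (g : TwoTensor n M) (x : M) :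
    IsSymmPosDef (pullback φ g x) ↔ IsSymmPosDef (g (φ x)) := by
  rw [isSymmPosDef_iff, isSymmPosDef_iff, gram_pullback, posDef_congruence (isUnit_derivMat φ x)]

theorem pullback_symm_pullback (g : TwoTensor n M) : pullback φ (pullback φ.symm g) = g := by
  ext1 x
  refine eq_of_gram_eq ?_
  rw [gram_pullback, gram_pullback, φ.symm_apply_apply]
  calc _ = (derivMat φ.symm (φ x) * derivMat φ x)ᵀ * gram (g x) (stdFrame x) *
        (derivMat φ.symm (φ x) * derivMat φ x) := by
          rw [transpose_mul]; simp only [Matrix.mul_assoc]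
    _ = _ := by rw [derivMat_symm_mul]; simp

theorem trLogSq_pullback (g h : TwoTensor n M) (x : M) (hg : IsSymmPosDef (g (φ x)))
    (hh : IsSymmPosDef (h (φ x))) :
    trLogSq (pullback φ g) (pullback φ h) x = trLogSq g h (φ x) := by
  rw [isSymmPosDef_iff] at hg hh
  rw [trLogSq_eq, trLogSq_eq, gram_pullback, gram_pullback,
    logDistSq_congruence (isUnit_derivMat φ x) hg hh]

theorem matOf_chartDeriv_pullChart (he : IsC1Chart e) {y : EuclideanSpace ℝ (Fin n)}
    (hy : y ∈ e.target) : matOf (chartDeriv (pullChart φ e) y) =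
      derivMat φ.symm (e.symm y) * matOf (chartDeriv e y) := by
  have h1 := he.mdifferentiableAt_symm hy
  have h2 : MDifferentiableAt (𝓡 n) (𝓡 n) φ.symm (e.symm y) :=
    φ.symm.mdifferentiable one_ne_zero _
  have h3 := mfderiv_comp y h2 h1
  rw [derivMat, ← matOf_comp]
  congr 1

/-- In the chart `e ∘ φ`, the pullback `φ^* g` has the components that `g` has in the chart `e`. -/
theorem chartCoeff_pullback (he : IsC1Chart e) (g : TwoTensor n M)
    {y : EuclideanSpace ℝ (Fin n)} (hy : y ∈ e.target) :
    chartCoeff (pullback φ g) (pullChart φ e) y = chartCoeff g e y := by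
  rw [chartCoeff_eq, chartCoeff_eq, matOf_chartDeriv_pullChart φ he hy, pullChart_symm_apply,
    gram_pullback, φ.apply_symm_apply]
  have h := derivMat_symm_mul φ.symm (e.symm y)
  have hs : derivMat φ.symm.symm (φ.symm (e.symm y)) = derivMat φ (φ.symm (e.symm y)) := rfl
  rw [hs] at h
  calc _ = (matOf (chartDeriv e y))ᵀ * (derivMat φ (φ.symm (e.symm y)) *
        derivMat φ.symm (e.symm y))ᵀ * gram (g (e.symm y)) (stdFrame (e.symm y)) *
        (derivMat φ (φ.symm (e.symm y)) * derivMat φ.symm (e.symm y)) *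
        matOf (chartDeriv e y) := by
          simp only [transpose_mul, Matrix.mul_assoc]
    _ = _ := by rw [h]; simp

theorem aemeasurable_chartCoeff_pullback [CompactSpace M] [IsManifold (𝓡 n) ∞ M]
    {e' : OpenPartialHomeomorph M (EuclideanSpace ℝ (Fin n))}
    (he' : IsC1Chart e') {g : TwoTensor n M}
    (hg : ∀ e, IsChart e → AEMeasurableEntries (chartCoeff g e) (volume.restrict e.target)) :
    AEMeasurableEntries (chartCoeff (pullback φ g) e') (volume.restrict e'.target) := by
  obtain ⟨t, ht⟩ := exists_finite_chart_cover (n := n) (M := M)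
  have ht' : ⋃ x : t, (chartAt (EuclideanSpace ℝ (Fin n)) (x : M)).source = univ := by
    simpa [iUnion_subtype] using ht
  refine aemeasurable_chartCoeff_of_cover he'
    (c := fun x : t => pullChart φ (chartAt (EuclideanSpace ℝ (Fin n)) (x : M)))
    (fun x => (isChart_chartAt _).isC1Chart.pullChart φ) ?_ fun x => ?_
  · simp only [pullChart_source, ← preimage_iUnion, ht', preimage_univ]
  · refine (hg _ (isChart_chartAt (x : M))).congr ?_
    filter_upwards [ae_restrict_mem
      (chartAt (EuclideanSpace ℝ (Fin n)) (x : M)).open_target.measurableSet] with y hy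
    exact (chartCoeff_pullback φ (isChart_chartAt _).isC1Chart g hy).symm

/-- `φ^* μ = μ`, stated in terms of the Jacobian determinant of `φ` in the standard frames: an
`n`-form is determined by its value on one frame. -/
def PreservesForm (μ : VolumeForm n M) (φ : M ≃ₘ^1⟮𝓡 n, 𝓡 n⟯ M) : Prop :=
  ∀ x, μ.form x (stdFrame x) = (derivMat φ x).det * μ.form (φ x) (stdFrame (φ x))

theorem IsSobolevVolumorphism.preservesForm {μ : VolumeForm n M} {r : ℝ}
    {φ : M ≃ₘ^1⟮𝓡 n, 𝓡 n⟯ M} (hφ : IsSobolevVolumorphism μ r φ) : PreservesForm μ φ := by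
  intro x
  rw [← hφ.preserves x (stdFrame x), ← alternating_matrix_smul]
  congr 1
  ext1 i
  exact eq_sum_stdFrame (mfderiv (𝓡 n) (𝓡 n) φ x (stdFrame x i))

variable {φ}

theorem PreservesForm.symm {μ : VolumeForm n M} (hφ : PreservesForm μ φ) :
    PreservesForm μ φ.symm := by
  intro x
  have h := hφ (φ.symm x)
  rw [φ.apply_symm_apply] at h
  have h2 := congrArg Matrix.det (derivMat_symm_mul φ.symm x)
  have hs : derivMat φ.symm.symm (φ.symm x) = derivMat φ (φ.symm x) := rfl
  rw [hs, det_mul, det_one] at h2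
  rw [h]
  linear_combination -(μ.form x (stdFrame x)) * h2

theorem PreservesForm.agreesAt {μ : VolumeForm n M} (hφ : PreservesForm μ φ) {g : TwoTensor n M}
    {x : M} (hg : IsSymmPosDef (g (φ x))) (h : μ.AgreesAt (g (φ x))) :
    μ.AgreesAt (pullback φ g x) := by
  rw [agreesAt_iff μ _ hg] at h
  rw [agreesAt_iff μ _ ((isSymmPosDef_pullback φ g x).2 hg), gram_pullback, det_mul, det_mul,
    det_transpose, h, hφ x]
  ring

/-- The volume form has the same component in the charts `e ∘ φ` and `e`. -/
theorem PreservesForm.form_pullChart {μ : VolumeForm n M} (hφ : PreservesForm μ φ)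
    (he : IsC1Chart e) {y : EuclideanSpace ℝ (Fin n)} (hy : y ∈ e.target) :
    μ.form ((pullChart φ e).symm y) (chartFrame (pullChart φ e) y) =
      μ.form (e.symm y) (chartFrame e y) := by
  rw [form_chartFrame, form_chartFrame, matOf_chartDeriv_pullChart φ he hy, det_mul,
    hφ.symm (e.symm y), pullChart_symm_apply]
  ring

variable [MeasurableSpace M] [BorelSpace M] [CompactSpace M] [IsManifold (𝓡 n) ∞ M]

/-- A diffeomorphism that preserves the volume form preserves its measure: near a point, the measure
has the same expression in the charts `e` and `e ∘ φ`. -/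
theorem PreservesForm.measurePreserving {μ : VolumeForm n M} (hφ : PreservesForm μ φ) :
    MeasurePreserving φ μ.measure μ.measure := by
  have hm : Measurable φ := φ.continuous.measurable
  refine ⟨hm, measure_ext_of_charts (n := n) fun x A hA hAx => ?_⟩
  have he := isChart_chartAt (n := n) x
  set e := chartAt (EuclideanSpace ℝ (Fin n)) x
  rw [Measure.map_apply hm hA, measure_eq_chartMeasure he μ hA hAx,
    (he.isC1Chart.pullChart φ).measure_eq_chartMeasure μ (hm hA) (preimage_mono hAx),
    chartMeasure_apply μ _ hA, chartMeasure_apply μ _ (hm hA)]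
  have hset : (pullChart φ e).target ∩ (pullChart φ e).symm ⁻¹' (φ ⁻¹' A) =
      e.target ∩ e.symm ⁻¹' A := by
    ext y
    simp only [pullChart_target, mem_inter_iff, mem_preimage, pullChart_symm_apply,
      φ.apply_symm_apply]
  rw [hset]
  refine setLIntegral_congr_fun (measurableSet_target_inter e hA) fun y hy => ?_
  simp only [hφ.form_pullChart he.isC1Chart hy.1]

theorem PreservesForm.lintegral_comp {μ : VolumeForm n M} (hφ : PreservesForm μ φ)
    (F : M → ℝ≥0∞) : ∫⁻ x, F (φ x) ∂μ.measure = ∫⁻ x, F x ∂μ.measure :=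
  hφ.measurePreserving.lintegral_comp_emb φ.toHomeomorph.measurableEmbedding F

end Pullback

/-! ### Measurable families of positive definite matrices -/

section MeasurableMatrix

open Matrix Filter Topology

variable {n : ℕ}

/-- The positive definite matrices are the positive semidefinite ones, which form a closed set, of
nonzero determinant, which form an open set. -/
theorem measurableSet_posDef :
    MeasurableSet {A : Fin n → Fin n → ℝ | (Matrix.of A).PosDef} := by
  have hset : {A : Fin n → Fin n → ℝ | (Matrix.of A).PosDef} =
      ({A | ∀ i j, A i j = A j i} ∩ ⋂ v : Fin n → ℝ, {A | 0 ≤ v ⬝ᵥ (Matrix.of A) *ᵥ v}) ∩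
        {A | (Matrix.of A).det ≠ 0} := by
    ext A
    simp only [mem_ofPred_eq, mem_inter_iff, mem_iInter]
    constructor
    · intro h
      refine ⟨⟨fun i j => ?_, fun v => ?_⟩, h.det_pos.ne'⟩
      · have := congrFun (congrFun h.isHermitian j) i
        simpa using this
      · simpa using h.posSemidef.dotProduct_mulVec_nonneg v
    · rintro ⟨⟨h1, h2⟩, h3⟩
      have hp : (Matrix.of A).PosSemidef := by
        refine PosSemidef.of_dotProduct_mulVec_nonneg ?_ fun v => by simpa using h2 v
        ext i j
        simp [h1 i j]
      exact hp.posDef_iff_det_ne_zero.2 h3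
  rw [hset]
  refine (IsClosed.measurableSet ?_).inter (IsOpen.measurableSet ?_)
  · refine IsClosed.inter ?_ (isClosed_iInter fun v => ?_)
    · simp only [ofPred_forall]
      exact isClosed_iInter fun i => isClosed_iInter fun j =>
        isClosed_eq (by fun_prop) (by fun_prop)
    · refine isClosed_le continuous_const ?_
      have : Continuous fun A : Fin n → Fin n → ℝ => (Matrix.of A) *ᵥ v :=
        Continuous.matrix_mulVec (A := fun A : Fin n → Fin n → ℝ => Matrix.of A) continuous_id
          continuous_const
      exact Continuous.dotProduct continuous_const this
  · exact isOpen_ne_fun (Continuous.matrix_det (A := fun A : Fin n → Fin n → ℝ => Matrix.of A)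
      continuous_id) continuous_const

/-- A function of two matrices that is continuous on positive definite matrices preserves
measurability. Continuity is stated for arbitrary filters, as the continuity of `logDistSq` and of
geodesic points is. -/
theorem aemeasurable_of_tendsto_posDef {β : Type*} [MeasurableSpace β] {ν : Measure β}
    {F G : β → Matrix (Fin n) (Fin n) ℝ} (hF : AEMeasurableEntries F ν)
    (hG : AEMeasurableEntries G ν) (hFp : ∀ᵐ b ∂ν, (F b).PosDef) (hGp : ∀ᵐ b ∂ν, (G b).PosDef)
    (f : Matrix (Fin n) (Fin n) ℝ → Matrix (Fin n) (Fin n) ℝ → ℝ)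
    (hf : ∀ (l : Filter (Matrix (Fin n) (Fin n) ℝ × Matrix (Fin n) (Fin n) ℝ))
      (A B : Matrix (Fin n) (Fin n) ℝ), A.PosDef → B.PosDef → (∀ᶠ p in l, p.1.PosDef) →
      (∀ᶠ p in l, p.2.PosDef) → Tendsto Prod.fst l (𝓝 A) → Tendsto Prod.snd l (𝓝 B) →
      Tendsto (fun p => f p.1 p.2) l (𝓝 (f A B))) :
    AEMeasurable (fun b => f (F b) (G b)) ν := by
  classical
  set S : Set (Fin n → Fin n → ℝ) := {A | (Matrix.of A).PosDef}
  have hS : MeasurableSet (S ×ˢ S) := measurableSet_posDef.prod measurableSet_posDef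
  let f' : (Fin n → Fin n → ℝ) × (Fin n → Fin n → ℝ) → ℝ := fun p =>
    f (Matrix.of p.1) (Matrix.of p.2)
  have hcont : ContinuousOn f' (S ×ˢ S) := by
    rintro ⟨A, B⟩ ⟨hA, hB⟩
    refine hf (𝓝[S ×ˢ S] (A, B)) (Matrix.of A) (Matrix.of B) hA hB ?_ ?_ ?_ ?_
    · filter_upwards [self_mem_nhdsWithin] with p hp using hp.1
    · filter_upwards [self_mem_nhdsWithin] with p hp using hp.2
    · exact (continuous_fst.tendsto (A, B)).mono_left nhdsWithin_le_nhds
    · exact (continuous_snd.tendsto (A, B)).mono_left nhdsWithin_le_nhds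
  have hmeas : Measurable ((S ×ˢ S).piecewise f' fun _ => 0) :=
    hcont.measurable_piecewise continuousOn_const hS
  have hF' : AEMeasurable (fun b => (fun i j => F b i j : Fin n → Fin n → ℝ)) ν :=
    aemeasurable_pi_lambda _ fun i => aemeasurable_pi_lambda _ fun j => hF i j
  have hG' : AEMeasurable (fun b => (fun i j => G b i j : Fin n → Fin n → ℝ)) ν :=
    aemeasurable_pi_lambda _ fun i => aemeasurable_pi_lambda _ fun j => hG i j
  refine (hmeas.comp_aemeasurable (hF'.prodMk hG')).congr ?_
  filter_upwards [hFp, hGp] with b h1 h2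
  rw [Function.comp_apply, Set.piecewise_eq_of_mem]
  · rfl
  · exact ⟨h1, h2⟩

theorem aemeasurable_logDistSq {β : Type*} [MeasurableSpace β] {ν : Measure β}
    {F G : β → Matrix (Fin n) (Fin n) ℝ} (hF : AEMeasurableEntries F ν)
    (hG : AEMeasurableEntries G ν) (hFp : ∀ᵐ b ∂ν, (F b).PosDef) (hGp : ∀ᵐ b ∂ν, (G b).PosDef) :
    AEMeasurable (fun b => logDistSq (F b) (G b)) ν :=
  aemeasurable_of_tendsto_posDef hF hG hFp hGp logDistSq fun _ _ _ hA hB h1 h2 h3 h4 =>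
    tendsto_logDistSq hA hB h1 h2 h3 h4

open Classical in

/-- The point with parameter `t` on the geodesic between two positive definite matrices. It is
chosen by its distances from the end points, which determine it for `0 ≤ t ≤ 1`. -/
noncomputable def geodPoint (t : ℝ) (A B : Matrix (Fin n) (Fin n) ℝ) :
    Matrix (Fin n) (Fin n) ℝ :=
  if h : ∃ M, IsGeodesicPoint t A B M then h.choose else 0

theorem isGeodesicPoint_geodPoint {A B : Matrix (Fin n) (Fin n) ℝ} (hA : A.PosDef)
    (hB : B.PosDef) (t : ℝ) : IsGeodesicPoint t A B (geodPoint t A B) := by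
  have h := exists_isGeodesicPoint hA hB t
  rw [geodPoint, dif_pos h]
  exact h.choose_spec

/-- Geodesics are natural under changes of frame. Hence the pointwise geodesic between two tensor
fields has components that can be computed in any chart. -/
theorem geodPoint_congruence {A B J : Matrix (Fin n) (Fin n) ℝ} (hA : A.PosDef)
    (hB : B.PosDef) (hJ : IsUnit J) {t : ℝ} (ht : t ∈ Icc (0 : ℝ) 1) :
    Jᵀ * geodPoint t A B * J = geodPoint t (Jᵀ * A * J) (Jᵀ * B * J) :=
  ((isGeodesicPoint_geodPoint hA hB t).congruence hA hB hJ).unique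
    (isGeodesicPoint_geodPoint ((posDef_congruence hJ).2 hA) ((posDef_congruence hJ).2 hB) t)
    ((posDef_congruence hJ).2 hA) ((posDef_congruence hJ).2 hB) ht

theorem aemeasurable_geodPoint {β : Type*} [MeasurableSpace β] {ν : Measure β}
    {F G : β → Matrix (Fin n) (Fin n) ℝ} (hF : AEMeasurableEntries F ν)
    (hG : AEMeasurableEntries G ν) (hFp : ∀ᵐ b ∂ν, (F b).PosDef) (hGp : ∀ᵐ b ∂ν, (G b).PosDef)
    {t : ℝ} (ht : t ∈ Icc (0 : ℝ) 1) :
    AEMeasurableEntries (fun b => geodPoint t (F b) (G b)) ν := fun i j =>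
  aemeasurable_of_tendsto_posDef hF hG hFp hGp (fun A B => geodPoint t A B i j)
    fun _ _ _ hA hB h1 h2 h3 h4 =>
      ((continuous_id.matrix_elem i j).tendsto _).comp
        (tendsto_geodesicPoint ht hA hB (isGeodesicPoint_geodPoint hA hB t) h1 h2
          (h1.and h2 |>.mono fun _ hp => isGeodesicPoint_geodPoint hp.1 hp.2 t) h3 h4)

end MeasurableMatrix

/-! ### Measurable metrics and their distance -/

section MeasurableMetric

open Matrix Filter Topology

variable {n : ℕ} {M : Type*} [TopologicalSpace M] [ChartedSpace (EuclideanSpace ℝ (Fin n)) M]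

theorem trLogSq_comm {g h : TwoTensor n M} {x : M} (hg : IsSymmPosDef (g x))
    (hh : IsSymmPosDef (h x)) : trLogSq g h x = trLogSq h g x :=
  logDistSq_comm ((isSymmPosDef_iff _).1 hg) ((isSymmPosDef_iff _).1 hh)

theorem trLogSq_nonneg {g h : TwoTensor n M} {x : M} (hg : IsSymmPosDef (g x))
    (hh : IsSymmPosDef (h x)) : 0 ≤ trLogSq g h x :=
  logDistSq_nonneg ((isSymmPosDef_iff _).1 hg) ((isSymmPosDef_iff _).1 hh)

/-- The point with parameter `t` on the geodesic between two metrics, in each tangent space. -/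
noncomputable def geodField (t : ℝ) (g h : TwoTensor n M) : TwoTensor n M := fun x =>
  ofGram (geodPoint t (gram (g x) (stdFrame x)) (gram (h x) (stdFrame x)))

theorem gram_geodField (t : ℝ) (g h : TwoTensor n M) (x : M) :
    gram (geodField t g h x) (stdFrame x) =
      geodPoint t (gram (g x) (stdFrame x)) (gram (h x) (stdFrame x)) :=
  gram_ofGram _

variable [MeasurableSpace M]

/-- Measurable, a.e. positive definite tensor fields with volume form `μ` a.e.: the conditions on
the points of `X` other than finite distance to the Sobolev metrics. -/
structure IsMeasurableMetric (μ : VolumeForm n M) (g : TwoTensor n M) : Prop where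
  aemeasurable : ∀ e : OpenPartialHomeomorph M (EuclideanSpace ℝ (Fin n)), IsChart e →
    AEMeasurableEntries (chartCoeff g e) (volume.restrict e.target)
  posDef : ∀ᵐ x ∂μ.measure, IsSymmPosDef (g x)
  agrees : ∀ᵐ x ∂μ.measure, μ.AgreesAt (g x)

variable {μ : VolumeForm n M} {s : ℝ} {g h k : TwoTensor n M}

theorem fieldDist_sq (μ : VolumeForm n M) (g h : TwoTensor n M) :
    fieldDist μ g h ^ 2 = ∫⁻ x, ENNReal.ofReal (trLogSq g h x) ∂μ.measure := by
  rw [fieldDist, ← ENNReal.rpow_natCast, ← ENNReal.rpow_mul]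
  norm_num

theorem fieldDist_lt_top_iff :
    fieldDist μ g h < ⊤ ↔ ∫⁻ x, ENNReal.ofReal (trLogSq g h x) ∂μ.measure < ⊤ := by
  rw [← fieldDist_sq, ENNReal.pow_lt_top_iff]
  simp

theorem mem_roughMetrics_iff : g ∈ roughMetrics μ s ↔
    IsMeasurableMetric μ g ∧ ∀ h ∈ sobolevMetrics μ s, fieldDist μ g h < ⊤ := by
  simp only [fieldDist_lt_top_iff]
  exact ⟨fun hg => ⟨⟨hg.1, hg.2.1, hg.2.2.1⟩, hg.2.2.2⟩,
    fun hg => ⟨hg.1.1, hg.1.2, hg.1.3, hg.2⟩⟩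

theorem isMeasurableMetric_of_mem_sobolevMetrics (hh : h ∈ sobolevMetrics μ s) :
    IsMeasurableMetric μ h :=
  ⟨fun e he i j => (hh.2.2 e he i j).1.aemeasurable e.open_target.measurableSet,
    ae_of_all _ hh.1, ae_of_all _ hh.2.1⟩

namespace IsMeasurableMetric

theorem ae_posDef_gram (hg : IsMeasurableMetric μ g) :
    ∀ᵐ x ∂μ.measure, (gram (g x) (stdFrame x)).PosDef :=
  hg.posDef.mono fun _ hx => (isSymmPosDef_iff _).1 hx

theorem fieldDist_self (hg : IsMeasurableMetric μ g) : fieldDist μ g g = 0 := by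
  have h : ∫⁻ x, ENNReal.ofReal (trLogSq g g x) ∂μ.measure = ∫⁻ _, 0 ∂μ.measure := by
    refine lintegral_congr_ae ?_
    filter_upwards [hg.ae_posDef_gram] with x hx
    rw [trLogSq_eq, logDistSq_self hx, ENNReal.ofReal_zero]
  rw [fieldDist, h, lintegral_zero]
  simp

theorem fieldDist_comm (hg : IsMeasurableMetric μ g) (hh : IsMeasurableMetric μ h) :
    fieldDist μ g h = fieldDist μ h g := by
  unfold fieldDist
  congr 1
  refine lintegral_congr_ae ?_
  filter_upwards [hg.posDef, hh.posDef] with x h1 h2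
  rw [trLogSq_comm h1 h2]

variable [BorelSpace M] [CompactSpace M] [IsManifold (𝓡 n) ∞ M]

theorem ae_posDef_chartCoeff (hg : IsMeasurableMetric μ g)
    {e : OpenPartialHomeomorph M (EuclideanSpace ℝ (Fin n))} (he : IsChart e) :
    ∀ᵐ y ∂volume.restrict e.target, (chartCoeff g e y).PosDef := by
  filter_upwards [ae_symm_of_ae he μ hg.posDef, ae_restrict_mem e.open_target.measurableSet]
    with y hy hy'
  exact (posDef_chartCoeff_iff he.isC1Chart g hy').2 hy

theorem aemeasurable_trLogSq (hg : IsMeasurableMetric μ g) (hh : IsMeasurableMetric μ h) :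
    AEMeasurable (trLogSq g h) μ.measure := by
  refine aemeasurable_of_charts μ fun x => ?_
  have he := isChart_chartAt (n := n) x
  set e := chartAt (EuclideanSpace ℝ (Fin n)) x
  refine (aemeasurable_logDistSq (hg.aemeasurable e he) (hh.aemeasurable e he)
    (hg.ae_posDef_chartCoeff he) (hh.ae_posDef_chartCoeff he)).congr ?_
  filter_upwards [ae_symm_of_ae he μ hg.posDef, ae_symm_of_ae he μ hh.posDef,
    ae_restrict_mem e.open_target.measurableSet] with y h1 h2 hy
  exact (trLogSq_eq_chartCoeff he.isC1Chart g h hy h1 h2).symm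

/-- Minkowski's inequality, applied to the pointwise triangle inequality. -/
theorem fieldDist_triangle (hg : IsMeasurableMetric μ g) (hk : IsMeasurableMetric μ k)
    (hh : IsMeasurableMetric μ h) :
    fieldDist μ g h ≤ fieldDist μ g k + fieldDist μ k h := by
  have hsqrt : ∀ {g h : TwoTensor n M}, IsMeasurableMetric μ g → IsMeasurableMetric μ h →
      fieldDist μ g h =
        (∫⁻ x, ENNReal.ofReal (√(trLogSq g h x)) ^ (2 : ℝ) ∂μ.measure) ^ (1 / 2 : ℝ) := by
    intro g h hg hh
    unfold fieldDist
    congr 1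
    refine lintegral_congr_ae ?_
    filter_upwards [hg.posDef, hh.posDef] with x h1 h2
    rw [ENNReal.ofReal_rpow_of_nonneg (Real.sqrt_nonneg _) zero_le_two, Real.rpow_two,
      Real.sq_sqrt (trLogSq_nonneg h1 h2)]
  rw [hsqrt hg hh, hsqrt hg hk, hsqrt hk hh]
  refine le_trans ?_ (ENNReal.lintegral_Lp_add_le
    (hg.aemeasurable_trLogSq hk).sqrt.ennreal_ofReal
    (hk.aemeasurable_trLogSq hh).sqrt.ennreal_ofReal one_le_two)
  refine ENNReal.rpow_le_rpow (lintegral_mono_ae ?_) (by norm_num)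
  filter_upwards [hg.ae_posDef_gram, hh.ae_posDef_gram, hk.ae_posDef_gram] with x h1 h2 h3
  refine ENNReal.rpow_le_rpow ?_ zero_le_two
  rw [Pi.add_apply, ← ENNReal.ofReal_add (Real.sqrt_nonneg _) (Real.sqrt_nonneg _)]
  exact ENNReal.ofReal_le_ofReal (sqrt_logDistSq_triangle h1 h2 h3)

theorem ae_eq_of_fieldDist_eq_zero (hg : IsMeasurableMetric μ g) (hh : IsMeasurableMetric μ h)
    (h0 : fieldDist μ g h = 0) : ∀ᵐ x ∂μ.measure, g x = h x := by
  have h1 := fieldDist_sq μ g h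
  rw [h0, zero_pow two_ne_zero, eq_comm,
    lintegral_eq_zero_iff' (hg.aemeasurable_trLogSq hh).ennreal_ofReal] at h1
  filter_upwards [h1, hg.ae_posDef_gram, hh.ae_posDef_gram] with x hx h2 h3
  refine eq_of_gram_eq (eq_of_logDistSq_eq_zero h2 h3 (le_antisymm ?_ (logDistSq_nonneg h2 h3)))
  exact ENNReal.ofReal_eq_zero.1 hx

end IsMeasurableMetric

/-- `X` contains all measurable metrics at finite distance from one of its points. -/
theorem mem_roughMetrics_of_fieldDist_lt_top [BorelSpace M] [CompactSpace M]
    [IsManifold (𝓡 n) ∞ M] (hg : g ∈ roughMetrics μ s) (hh : IsMeasurableMetric μ h)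
    (hd : fieldDist μ h g < ⊤) : h ∈ roughMetrics μ s := by
  rw [mem_roughMetrics_iff] at hg ⊢
  exact ⟨hh, fun k hk => (hh.fieldDist_triangle hg.1
    (isMeasurableMetric_of_mem_sobolevMetrics hk)).trans_lt
    (ENNReal.add_lt_top.2 ⟨hd, hg.2 k hk⟩)⟩

/-! ### Geodesics between tensor fields -/

namespace IsMeasurableMetric

theorem ae_isGeodesicPoint (hg : IsMeasurableMetric μ g) (hh : IsMeasurableMetric μ h) (t : ℝ) :
    ∀ᵐ x ∂μ.measure, IsGeodesicPoint t (gram (g x) (stdFrame x)) (gram (h x) (stdFrame x))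
      (gram (geodField t g h x) (stdFrame x)) := by
  filter_upwards [hg.ae_posDef_gram, hh.ae_posDef_gram] with x h1 h2
  rw [gram_geodField]
  exact isGeodesicPoint_geodPoint h1 h2 t

theorem fieldDist_geodField (hg : IsMeasurableMetric μ g) (hh : IsMeasurableMetric μ h)
    {t t' : ℝ} (ht : t ∈ Icc (0 : ℝ) 1) (ht' : t' ∈ Icc (0 : ℝ) 1) :
    fieldDist μ (FixedVolumeMetrics.geodField t g h) (FixedVolumeMetrics.geodField t' g h) =
      ENNReal.ofReal |t - t'| * fieldDist μ g h := by
  have h1 : ∫⁻ x, ENNReal.ofReal (trLogSq (FixedVolumeMetrics.geodField t g h)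
      (FixedVolumeMetrics.geodField t' g h) x) ∂μ.measure =
      ENNReal.ofReal ((t - t') ^ 2) * ∫⁻ x, ENNReal.ofReal (trLogSq g h x) ∂μ.measure := by
    rw [← lintegral_const_mul' _ _ ENNReal.ofReal_ne_top]
    refine lintegral_congr_ae ?_
    filter_upwards [hg.ae_isGeodesicPoint hh t, hg.ae_isGeodesicPoint hh t', hg.ae_posDef_gram,
      hh.ae_posDef_gram] with x a b c d
    rw [← ENNReal.ofReal_mul (sq_nonneg _), trLogSq_eq, trLogSq_eq, a.logDistSq_eq b c d ht ht']
  rw [fieldDist, fieldDist, h1, ENNReal.mul_rpow_of_nonneg _ _ (by norm_num),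
    ENNReal.ofReal_rpow_of_nonneg (sq_nonneg _) (by norm_num), ← Real.sqrt_eq_rpow,
    Real.sqrt_sq_eq_abs]

variable [BorelSpace M] [CompactSpace M] [IsManifold (𝓡 n) ∞ M]

theorem geodField (hg : IsMeasurableMetric μ g) (hh : IsMeasurableMetric μ h) {t : ℝ}
    (ht : t ∈ Icc (0 : ℝ) 1) : IsMeasurableMetric μ (geodField t g h) := by
  refine ⟨fun e he => ?_, ?_, ?_⟩
  · refine (aemeasurable_geodPoint (hg.aemeasurable e he) (hh.aemeasurable e he)
      (hg.ae_posDef_chartCoeff he) (hh.ae_posDef_chartCoeff he) ht).congr ?_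
    filter_upwards [ae_symm_of_ae he μ hg.ae_posDef_gram, ae_symm_of_ae he μ hh.ae_posDef_gram,
      ae_restrict_mem e.open_target.measurableSet] with y h1 h2 hy
    rw [chartCoeff_eq, chartCoeff_eq, chartCoeff_eq, gram_geodField,
      geodPoint_congruence h1 h2 (he.isC1Chart.isUnit_matOf_chartDeriv hy) ht]
  · filter_upwards [hg.ae_isGeodesicPoint hh t] with x hx
    exact (isSymmPosDef_iff _).2 hx.posDef
  · filter_upwards [hg.ae_isGeodesicPoint hh t, hg.ae_posDef_gram, hh.ae_posDef_gram, hg.agrees,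
      hh.agrees] with x hx h1 h2 h3 h4
    rw [agreesAt_iff μ _ ((isSymmPosDef_iff _).2 h1)] at h3
    rw [agreesAt_iff μ _ ((isSymmPosDef_iff _).2 h2)] at h4
    rw [agreesAt_iff μ _ ((isSymmPosDef_iff _).2 hx.posDef), ← h3]
    exact hx.det_eq h1 h2 ht (h3.trans h4.symm)

theorem fieldDist_geodField_convex (hg : IsMeasurableMetric μ g) (hh : IsMeasurableMetric μ h)
    (hk : IsMeasurableMetric μ k) {t : ℝ} (ht : t ∈ Icc (0 : ℝ) 1) :
    fieldDist μ k (FixedVolumeMetrics.geodField t g h) ^ 2 +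
        ENNReal.ofReal (t * (1 - t)) * fieldDist μ g h ^ 2 ≤
      ENNReal.ofReal (1 - t) * fieldDist μ k g ^ 2 + ENNReal.ofReal t * fieldDist μ k h ^ 2 := by
  have ht' : 0 ≤ 1 - t := sub_nonneg.2 ht.2
  simp only [fieldDist_sq]
  rw [← lintegral_const_mul' _ _ ENNReal.ofReal_ne_top,
    ← lintegral_const_mul' _ _ ENNReal.ofReal_ne_top,
    ← lintegral_const_mul' _ _ ENNReal.ofReal_ne_top,
    ← lintegral_add_left' (hk.aemeasurable_trLogSq (hg.geodField hh ht)).ennreal_ofReal,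
    ← lintegral_add_left' ((hk.aemeasurable_trLogSq hg).ennreal_ofReal.const_mul _)]
  refine lintegral_mono_ae ?_
  filter_upwards [hg.ae_isGeodesicPoint hh t, hg.ae_posDef_gram, hh.ae_posDef_gram,
    hk.ae_posDef_gram] with x a b c d
  rw [trLogSq_eq, trLogSq_eq, trLogSq_eq, trLogSq_eq]
  have n1 := logDistSq_nonneg d a.posDef
  have n2 := logDistSq_nonneg b c
  have n3 := logDistSq_nonneg d b
  have n4 := logDistSq_nonneg d c
  rw [← ENNReal.ofReal_mul (mul_nonneg ht.1 ht'), ← ENNReal.ofReal_mul ht',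
    ← ENNReal.ofReal_mul ht.1, ← ENNReal.ofReal_add n1 (mul_nonneg (mul_nonneg ht.1 ht') n2),
    ← ENNReal.ofReal_add (mul_nonneg ht' n3) (mul_nonneg ht.1 n4)]
  exact ENNReal.ofReal_le_ofReal (a.convex b c d ht)

end IsMeasurableMetric

end MeasurableMetric

/-! ### Limits of Cauchy sequences of measurable metrics -/

section Completeness

open Matrix Filter Topology

variable {n : ℕ}

/-- A sequence of positive definite matrices whose steps decay geometrically has a positive definite
limit. -/
theorem exists_tendsto_of_geometric {F : ℕ → Matrix (Fin n) (Fin n) ℝ} (hF : ∀ k, (F k).PosDef)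
    {C : ℝ} (h : ∀ k, √(logDistSq (F k) (F (k + 1))) ≤ C * (1 / 2) ^ k) :
    ∃ B : Matrix (Fin n) (Fin n) ℝ, B.PosDef ∧ Tendsto F atTop (𝓝 B) := by
  have hC : 0 ≤ C := by simpa using (Real.sqrt_nonneg _).trans (h 0)
  have h1 : ∀ k m, √(logDistSq (F k) (F (k + m))) ≤
      2 * C * (1 / 2) ^ k - 2 * C * (1 / 2) ^ (k + m) := by
    intro k m
    induction m with
    | zero => simp [logDistSq_self (hF k)]
    | succ m ih =>
      have h2 := sqrt_logDistSq_triangle (hF k) (hF (k + m + 1)) (hF (k + m))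
      have h3 := h (k + m)
      rw [← add_assoc, pow_succ (1 / 2 : ℝ) (k + m)]
      linarith
  refine exists_tendsto_of_cauchy hF fun ε hε => ?_
  have hlim : Tendsto (fun k : ℕ => 2 * C * (1 / 2 : ℝ) ^ k) atTop (𝓝 0) := by
    simpa using (tendsto_pow_atTop_nhds_zero_of_lt_one (r := (1 / 2 : ℝ)) (by norm_num)
      (by norm_num)).const_mul (2 * C)
  obtain ⟨N, hN⟩ := eventually_atTop.1 (hlim.eventually (gt_mem_nhds hε))
  have key : ∀ k ≥ N, ∀ l ≥ k, √(logDistSq (F k) (F l)) < ε := by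
    intro k hk l hl
    obtain ⟨m, rfl⟩ := Nat.exists_eq_add_of_le hl
    refine lt_of_le_of_lt (h1 k m) (lt_of_le_of_lt (sub_le_self _ (by positivity)) (hN k hk))
  refine ⟨N, fun k hk l hl => ?_⟩
  rcases le_total k l with hkl | hkl
  · exact key k hk l hkl
  · rw [logDistSq_comm (hF k) (hF l)]
    exact key l hl k hkl

variable {M : Type*} [TopologicalSpace M] [ChartedSpace (EuclideanSpace ℝ (Fin n)) M]

open Classical in

/-- The pointwise limit of a sequence of metrics where it exists and is positive definite, and `0`
elsewhere. -/
noncomputable def limitField (g : ℕ → TwoTensor n M) : TwoTensor n M := fun x =>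
  if h : ∃ B : Matrix (Fin n) (Fin n) ℝ, B.PosDef ∧
    Tendsto (fun k => gram (g k x) (stdFrame x)) atTop (𝓝 B) then ofGram h.choose else 0

theorem limitField_spec {g : ℕ → TwoTensor n M} {x : M}
    (h : ∃ B : Matrix (Fin n) (Fin n) ℝ, B.PosDef ∧
      Tendsto (fun k => gram (g k x) (stdFrame x)) atTop (𝓝 B)) :
    (gram (limitField g x) (stdFrame x)).PosDef ∧
      Tendsto (fun k => gram (g k x) (stdFrame x)) atTop
        (𝓝 (gram (limitField g x) (stdFrame x))) := by
  rw [limitField, dif_pos h, gram_ofGram]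
  exact h.choose_spec

variable [MeasurableSpace M] [BorelSpace M] [CompactSpace M] [IsManifold (𝓡 n) ∞ M]
  {μ : VolumeForm n M} {s : ℝ}

/-- A sequence that is Cauchy at a geometric rate converges pointwise almost everywhere, since
`∫ ∑ₖ 4ᵏ tr((log(gₖ⁻¹gₖ₊₁))²) dμ` is finite. By Fatou's lemma it converges in `δ` as well. -/
theorem exists_limit_of_controlled {g : ℕ → TwoTensor n M}
    (hg : ∀ k, IsMeasurableMetric μ (g k))
    (hc : ∀ N k l, N ≤ k → N ≤ l → fieldDist μ (g k) (g l) < (1 / 4 : ℝ≥0∞) ^ N) :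
    ∃ g' : TwoTensor n M, IsMeasurableMetric μ g' ∧
      ∀ k, fieldDist μ (g k) g' ≤ (1 / 4 : ℝ≥0∞) ^ k := by
  have hsq : ∀ N k l, N ≤ k → N ≤ l →
      ∫⁻ x, ENNReal.ofReal (trLogSq (g k) (g l) x) ∂μ.measure ≤ ((1 / 4 : ℝ≥0∞) ^ N) ^ 2 := by
    intro N k l hk hl
    rw [← fieldDist_sq]
    gcongr
    exact (hc N k l hk hl).le
  have hfin : ∫⁻ x, ∑' k : ℕ, (4 : ℝ≥0∞) ^ k * ENNReal.ofReal (trLogSq (g k) (g (k + 1)) x)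
      ∂μ.measure ≠ ⊤ := by
    rw [lintegral_tsum fun k =>
      (((hg k).aemeasurable_trLogSq (hg (k + 1))).ennreal_ofReal.const_mul _)]
    have hterm : ∀ k : ℕ, ∫⁻ x, (4 : ℝ≥0∞) ^ k *
        ENNReal.ofReal (trLogSq (g k) (g (k + 1)) x) ∂μ.measure ≤ (1 / 4 : ℝ≥0∞) ^ k := by
      intro k
      rw [lintegral_const_mul' _ _ (ENNReal.pow_ne_top (by norm_num))]
      calc (4 : ℝ≥0∞) ^ k * ∫⁻ x, ENNReal.ofReal (trLogSq (g k) (g (k + 1)) x) ∂μ.measure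
          ≤ (4 : ℝ≥0∞) ^ k * ((1 / 4 : ℝ≥0∞) ^ k) ^ 2 := by
            gcongr
            exact hsq k k (k + 1) le_rfl (Nat.le_succ k)
        _ = ((4 : ℝ≥0∞) * (1 / 4)) ^ k * (1 / 4 : ℝ≥0∞) ^ k := by rw [mul_pow]; ring
        _ = (1 / 4 : ℝ≥0∞) ^ k := by
            rw [one_div, ENNReal.mul_inv_cancel (by norm_num) (by norm_num), one_pow, one_mul]
    refine ne_top_of_le_ne_top ?_ (ENNReal.tsum_le_tsum hterm)
    rw [ENNReal.tsum_geometric, ne_eq, ENNReal.inv_eq_top, tsub_eq_zero_iff_le, not_le,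
      one_div]
    exact ENNReal.inv_lt_one.2 (by norm_num)
  have hae := ae_lt_top' (AEMeasurable.tsum fun k =>
      (((hg k).aemeasurable_trLogSq (hg (k + 1))).ennreal_ofReal.const_mul _)) hfin
  have hpos : ∀ᵐ x ∂μ.measure, ∀ k, (gram (g k x) (stdFrame x)).PosDef :=
    ae_all_iff.2 fun k => (hg k).ae_posDef_gram
  have hlim : ∀ᵐ x ∂μ.measure, (gram (limitField g x) (stdFrame x)).PosDef ∧
      Tendsto (fun k => gram (g k x) (stdFrame x)) atTop
        (𝓝 (gram (limitField g x) (stdFrame x))) := by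
    filter_upwards [hae, hpos] with x hx hp
    refine limitField_spec (exists_tendsto_of_geometric hp (C := √(∑' k : ℕ, (4 : ℝ≥0∞) ^ k *
      ENNReal.ofReal (trLogSq (g k) (g (k + 1)) x)).toReal) fun k => ?_)
    have h1 : (4 : ℝ≥0∞) ^ k * ENNReal.ofReal (trLogSq (g k) (g (k + 1)) x) ≤ _ :=
      ENNReal.le_tsum (f := fun k : ℕ => (4 : ℝ≥0∞) ^ k *
        ENNReal.ofReal (trLogSq (g k) (g (k + 1)) x)) k
    have h2 := ENNReal.toReal_mono hx.ne h1
    have hn := logDistSq_nonneg (hp k) (hp (k + 1))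
    rw [trLogSq_eq, ENNReal.toReal_mul, ENNReal.toReal_ofReal hn, ENNReal.toReal_pow] at h2
    have h3 := Real.sqrt_le_sqrt h2
    have h4 : √((4 : ℝ≥0∞).toReal ^ k) = 2 ^ k := by
      rw [show (4 : ℝ≥0∞).toReal = 2 ^ 2 by norm_num, ← pow_mul, mul_comm, pow_mul]
      exact Real.sqrt_sq (by positivity)
    rw [Real.sqrt_mul (by positivity), h4] at h3
    rw [one_div, inv_pow, ← div_eq_mul_inv, le_div_iff₀ (by positivity), mul_comm]
    exact h3
  have hmeas : IsMeasurableMetric μ (limitField g) := by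
    refine ⟨fun e he i j => ?_, ?_, ?_⟩
    · refine aemeasurable_of_tendsto_metrizable_ae atTop
        (fun k => (hg k).aemeasurable e he i j) ?_
      filter_upwards [ae_symm_of_ae he μ hlim] with y hy
      have h1 := ((hy.2.const_mul (matOf (chartDeriv e y))ᵀ).mul_const (matOf (chartDeriv e y)))
      simp only [← chartCoeff_eq] at h1
      exact ((continuous_id.matrix_elem i j).tendsto _).comp h1
    · filter_upwards [hlim] with x hx using (isSymmPosDef_iff _).2 hx.1
    · filter_upwards [hlim, hpos, ae_all_iff.2 fun k => (hg k).agrees] with x hx hp ha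
      rw [agreesAt_iff μ _ ((isSymmPosDef_iff _).2 hx.1)]
      have h1 := (continuous_id.matrix_det.tendsto _).comp hx.2
      have h2 : ∀ k, (gram (g k x) (stdFrame x)).det = μ.form x (stdFrame x) ^ 2 := fun k =>
        (agreesAt_iff μ _ ((isSymmPosDef_iff _).2 (hp k))).1 (ha k)
      refine tendsto_nhds_unique h1 ?_
      simp only [Function.comp_def, id, h2]
      exact tendsto_const_nhds
  refine ⟨limitField g, hmeas, fun k => ?_⟩
  rw [← ENNReal.pow_le_pow_left_iff two_ne_zero, fieldDist_sq]
  calc ∫⁻ x, ENNReal.ofReal (trLogSq (g k) (limitField g) x) ∂μ.measure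
      = ∫⁻ x, liminf (fun l => ENNReal.ofReal (trLogSq (g k) (g l) x)) atTop ∂μ.measure := by
        refine lintegral_congr_ae ?_
        filter_upwards [hlim, hpos] with x hx hp
        have h1 := tendsto_logDistSq (hp k) hx.1 (Eventually.of_forall fun _ : ℕ => hp k)
          (Eventually.of_forall hp) tendsto_const_nhds hx.2
        exact ((ENNReal.tendsto_ofReal h1).liminf_eq).symm
    _ ≤ liminf (fun l => ∫⁻ x, ENNReal.ofReal (trLogSq (g k) (g l) x) ∂μ.measure) atTop :=
        lintegral_liminf_le' fun l => ((hg k).aemeasurable_trLogSq (hg l)).ennreal_ofReal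
    _ ≤ ((1 / 4 : ℝ≥0∞) ^ k) ^ 2 := by
        refine liminf_le_of_frequently_le' (Eventually.frequently ?_)
        filter_upwards [eventually_ge_atTop k] with l hl using hsq k k l le_rfl hl

end Completeness

/-! ### The complete metric space of rough metrics -/

section RoughSpace

open Filter Topology

variable {n : ℕ} {M : Type*} [TopologicalSpace M] [ChartedSpace (EuclideanSpace ℝ (Fin n)) M]
  [MeasurableSpace M] {μ : VolumeForm n M} {s : ℝ}

theorem RoughSpace.exists_rep (p : RoughSpace μ s) :
    ∃ (g : TwoTensor n M) (hg : g ∈ roughMetrics μ s), RoughSpace.mk g hg = p := by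
  obtain ⟨⟨g, hg⟩, h⟩ := Quotient.exists_rep p
  exact ⟨g, hg, h⟩

theorem RoughSpace.edist_mk {g h : TwoTensor n M} (hg : g ∈ roughMetrics μ s)
    (hh : h ∈ roughMetrics μ s) :
    edist (RoughSpace.mk g hg) (RoughSpace.mk h hh) = fieldDist μ g h := rfl

theorem RoughSpace.mk_eq_iff {g h : TwoTensor n M} (hg : g ∈ roughMetrics μ s)
    (hh : h ∈ roughMetrics μ s) :
    RoughSpace.mk g hg = RoughSpace.mk h hh ↔ ∀ᵐ x ∂μ.measure, g x = h x :=
  Quotient.eq (r := roughSetoid μ s)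

theorem isMeasurableMetric_of_mem_roughMetrics {g : TwoTensor n M} (hg : g ∈ roughMetrics μ s) :
    IsMeasurableMetric μ g :=
  (mem_roughMetrics_iff.1 hg).1

variable [BorelSpace M] [CompactSpace M] [IsManifold (𝓡 n) ∞ M]

/-- The distance `δ` makes `X` an extended metric space. -/
noncomputable instance : EMetricSpace (RoughSpace μ s) where
  edist := edist
  edist_self p := by
    obtain ⟨g, hg, rfl⟩ := p.exists_rep
    exact (isMeasurableMetric_of_mem_roughMetrics hg).fieldDist_self
  edist_comm p q := by
    obtain ⟨g, hg, rfl⟩ := p.exists_rep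
    obtain ⟨h, hh, rfl⟩ := q.exists_rep
    exact (isMeasurableMetric_of_mem_roughMetrics hg).fieldDist_comm
      (isMeasurableMetric_of_mem_roughMetrics hh)
  edist_triangle p q r := by
    obtain ⟨g, hg, rfl⟩ := p.exists_rep
    obtain ⟨h, hh, rfl⟩ := q.exists_rep
    obtain ⟨k, hk, rfl⟩ := r.exists_rep
    exact (isMeasurableMetric_of_mem_roughMetrics hg).fieldDist_triangle
      (isMeasurableMetric_of_mem_roughMetrics hh) (isMeasurableMetric_of_mem_roughMetrics hk)
  eq_of_edist_eq_zero {p q} hpq := by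
    obtain ⟨g, hg, rfl⟩ := p.exists_rep
    obtain ⟨h, hh, rfl⟩ := q.exists_rep
    exact (RoughSpace.mk_eq_iff hg hh).2
      ((isMeasurableMetric_of_mem_roughMetrics hg).ae_eq_of_fieldDist_eq_zero
        (isMeasurableMetric_of_mem_roughMetrics hh) hpq)

instance : CompleteSpace (RoughSpace μ s) := by
  refine EMetric.complete_of_convergent_controlled_sequences (fun N => (1 / 4 : ℝ≥0∞) ^ N)
    (fun N => ENNReal.pow_pos (by norm_num) N) fun u hu => ?_
  choose g hg hgu using fun k => (u k).exists_rep
  obtain ⟨g', hg', hlim⟩ := exists_limit_of_controlled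
    (fun k => isMeasurableMetric_of_mem_roughMetrics (hg k)) fun N k l hk hl => by
      rw [← RoughSpace.edist_mk (hg k) (hg l), hgu, hgu]
      exact hu N k l hk hl
  have hmem : g' ∈ roughMetrics μ s := by
    refine mem_roughMetrics_of_fieldDist_lt_top (hg 0) hg' ?_
    rw [hg'.fieldDist_comm (isMeasurableMetric_of_mem_roughMetrics (hg 0))]
    refine (hlim 0).trans_lt ?_
    simp
  refine ⟨RoughSpace.mk g' hmem, tendsto_iff_edist_tendsto_0.2 ?_⟩
  have hz : Tendsto (fun k : ℕ => (1 / 4 : ℝ≥0∞) ^ k) atTop (𝓝 0) :=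
    ENNReal.tendsto_pow_atTop_nhds_zero_of_lt_one (by
      rw [one_div]; exact ENNReal.inv_lt_one.2 (by norm_num))
  refine tendsto_of_tendsto_of_tendsto_of_le_of_le tendsto_const_nhds hz (fun _ => bot_le)
    fun k => ?_
  rw [← hgu k]
  exact hlim k

/-- `X` is a space of nonpositive curvature: the Bruhat–Tits inequality holds in each tangent space,
and is preserved by integration. -/
theorem hasConvexGeodesics_roughSpace : HasConvexGeodesics (RoughSpace μ s) := by
  classical
  intro p q hpq
  obtain ⟨g, hg, rfl⟩ := p.exists_rep
  obtain ⟨h, hh, rfl⟩ := q.exists_rep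
  have hg' := isMeasurableMetric_of_mem_roughMetrics hg
  have hh' := isMeasurableMetric_of_mem_roughMetrics hh
  have h0 : (0 : ℝ) ∈ Icc (0 : ℝ) 1 := ⟨le_rfl, zero_le_one⟩
  have h1 : (1 : ℝ) ∈ Icc (0 : ℝ) 1 := ⟨zero_le_one, le_rfl⟩
  have hzero : ∀ᵐ x ∂μ.measure, geodField 0 g h x = g x := by
    filter_upwards [hg'.ae_isGeodesicPoint hh' 0, hg'.ae_posDef_gram] with x hx hp
    have := hx.left
    rw [zero_pow two_ne_zero, zero_mul] at this
    exact (eq_of_gram_eq (eq_of_logDistSq_eq_zero hp hx.posDef this)).symm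
  have hone : ∀ᵐ x ∂μ.measure, geodField 1 g h x = h x := by
    filter_upwards [hg'.ae_isGeodesicPoint hh' 1, hh'.ae_posDef_gram] with x hx hp
    have := hx.right
    rw [sub_self, zero_pow two_ne_zero, zero_mul] at this
    exact eq_of_gram_eq (eq_of_logDistSq_eq_zero hx.posDef hp this)
  have hmem : ∀ t ∈ Icc (0 : ℝ) 1, geodField t g h ∈ roughMetrics μ s := by
    intro t ht
    refine mem_roughMetrics_of_fieldDist_lt_top hg (hg'.geodField hh' ht) ?_
    have e1 : fieldDist μ (geodField t g h) g =
        fieldDist μ (geodField t g h) (geodField 0 g h) := by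
      unfold fieldDist
      congr 1
      refine lintegral_congr_ae ?_
      filter_upwards [hzero] with x hx
      simp only [trLogSq, hx]
    rw [e1, hg'.fieldDist_geodField hh' ht h0]
    exact ENNReal.mul_lt_top ENNReal.ofReal_lt_top (lt_top_iff_ne_top.2 hpq)
  let γ : ℝ → RoughSpace μ s := fun t =>
    if ht : t ∈ Icc (0 : ℝ) 1 then RoughSpace.mk (geodField t g h) (hmem t ht)
    else RoughSpace.mk g hg
  have hγ : ∀ t (ht : t ∈ Icc (0 : ℝ) 1), γ t = RoughSpace.mk (geodField t g h) (hmem t ht) :=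
    fun t ht => dif_pos ht
  refine ⟨γ, ⟨?_, ?_, fun t ht t' ht' => ?_⟩, fun t ht z => ?_⟩
  · rw [hγ 0 h0, RoughSpace.mk_eq_iff]; exact hzero
  · rw [hγ 1 h1, RoughSpace.mk_eq_iff]; exact hone
  · rw [hγ t ht, hγ t' ht', RoughSpace.edist_mk, RoughSpace.edist_mk]
    exact hg'.fieldDist_geodField hh' ht ht'
  · obtain ⟨k, hk, rfl⟩ := z.exists_rep
    rw [hγ t ht]
    exact hg'.fieldDist_geodField_convex hh' (isMeasurableMetric_of_mem_roughMetrics hk) ht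

end RoughSpace

/-! ### The action of a volumorphism -/

section PullbackAction

open Matrix Filter Topology

variable {n : ℕ} {M : Type*} [TopologicalSpace M] [ChartedSpace (EuclideanSpace ℝ (Fin n)) M]
  [IsManifold (𝓡 n) ∞ M] {μ : VolumeForm n M} {s : ℝ} {φ : M ≃ₘ^1⟮𝓡 n, 𝓡 n⟯ M}
  {g h : TwoTensor n M}

/-- The pullback of a continuous metric by a `C¹` diffeomorphism has continuous components. -/
theorem continuousAt_chartCoeff_pullback (φ : M ≃ₘ^1⟮𝓡 n, 𝓡 n⟯ M)
    (hh : h ∈ sobolevMetrics μ s) {e : OpenPartialHomeomorph M (EuclideanSpace ℝ (Fin n))}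
    (he : IsChart e) {x : M} (hx : x ∈ e.source) :
    ContinuousAt (fun y => (chartCoeff (pullback φ h) e y : Matrix (Fin n) (Fin n) ℝ)) (e x) := by
  have hc := isChart_chartAt (n := n) (φ x)
  set c := chartAt (EuclideanSpace ℝ (Fin n)) (φ x)
  have hcp := hc.isC1Chart.pullChart φ
  have hy : e x ∈ e.target ∩ e.symm ⁻¹' (pullChart φ c).source := by
    refine ⟨e.map_source hx, ?_⟩
    rw [mem_preimage, e.left_inv hx]
    exact mem_chart_source _ (φ x)
  have hW := (isOpen_overlap (pullChart φ c) e).mem_nhds hy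
  have h1 : ContinuousAt (transMat (pullChart φ c) e) (e x) :=
    (hcp.continuousOn_transMat he.isC1Chart).continuousAt hW
  have h2 : ContinuousAt ((pullChart φ c) ∘ e.symm) (e x) :=
    (hcp.contDiffOn_transition he.isC1Chart).continuousOn.continuousAt hW
  have hmem : ((pullChart φ c) ∘ e.symm) (e x) ∈ c.target :=
    (pullChart φ c).map_source hy.2
  have h3 : ContinuousAt (fun y => (chartCoeff h c y : Matrix (Fin n) (Fin n) ℝ))
      (((pullChart φ c) ∘ e.symm) (e x)) :=
    tendsto_pi_nhds.2 fun i => tendsto_pi_nhds.2 fun j =>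
      ((hh.2.2 c hc i j).1.continuousAt (c.open_target.mem_nhds hmem)).tendsto
  have h4 : ContinuousAt (fun y => chartCoeff h c (((pullChart φ c) ∘ e.symm) y)) (e x) :=
    h3.comp h2
  have h5 : ContinuousAt (fun y => (transMat (pullChart φ c) e y)ᵀ *
      chartCoeff h c (((pullChart φ c) ∘ e.symm) y) * transMat (pullChart φ c) e y) (e x) :=
    (((continuous_id.matrix_transpose.tendsto _).comp h1).mul h4).mul h1
  refine h5.congr ?_
  filter_upwards [hW] with y hy'
  rw [hcp.chartCoeff_transition he.isC1Chart _ hy', Function.comp_apply]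
  rw [chartCoeff_pullback φ hc.isC1Chart h ((pullChart φ c).map_source hy'.2)]

variable [MeasurableSpace M] [BorelSpace M] [CompactSpace M]

theorem IsMeasurableMetric.pullback (hg : IsMeasurableMetric μ g) (hφ : PreservesForm μ φ) :
    IsMeasurableMetric μ (pullback φ g) := by
  have hq := hφ.measurePreserving.quasiMeasurePreserving
  refine ⟨fun e he => aemeasurable_chartCoeff_pullback φ he.isC1Chart hg.aemeasurable, ?_, ?_⟩
  · filter_upwards [hq.ae hg.posDef] with x hx
    exact (isSymmPosDef_pullback φ g x).2 hx
  · filter_upwards [hq.ae hg.posDef, hq.ae hg.agrees] with x hx hx'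
    exact hφ.agreesAt hx hx'

theorem PreservesForm.fieldDist_pullback (hφ : PreservesForm μ φ) (hg : IsMeasurableMetric μ g)
    (hh : IsMeasurableMetric μ h) :
    fieldDist μ (pullback φ g) (pullback φ h) = fieldDist μ g h := by
  have hq := hφ.measurePreserving.quasiMeasurePreserving
  unfold fieldDist
  congr 1
  rw [← hφ.lintegral_comp fun x => ENNReal.ofReal (trLogSq g h x)]
  refine lintegral_congr_ae ?_
  filter_upwards [hq.ae hg.posDef, hq.ae hh.posDef] with x h1 h2
  rw [trLogSq_pullback φ g h x h1 h2]

/-- A Sobolev metric lies at finite distance from its pullback by a `C¹` diffeomorphism: both are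
continuous metrics on a compact manifold. -/
theorem fieldDist_pullback_lt_top (φ : M ≃ₘ^1⟮𝓡 n, 𝓡 n⟯ M) (hh : h ∈ sobolevMetrics μ s) :
    fieldDist μ h (pullback φ h) < ⊤ := by
  have hcont : Continuous (trLogSq h (pullback φ h)) := by
    refine continuous_iff_continuousAt.2 fun x => ?_
    have he := isChart_chartAt (n := n) x
    set e := chartAt (EuclideanSpace ℝ (Fin n)) x
    have hx : x ∈ e.source := mem_chart_source _ x
    have hp : ∀ z, IsSymmPosDef (pullback φ h z) := fun z =>
      (isSymmPosDef_pullback φ h z).2 (hh.1 _)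
    have h1 : ContinuousAt (fun y => (chartCoeff h e y : Matrix (Fin n) (Fin n) ℝ)) (e x) :=
      tendsto_pi_nhds.2 fun i => tendsto_pi_nhds.2 fun j =>
        ((hh.2.2 e he i j).1.continuousAt (e.open_target.mem_nhds (e.map_source hx))).tendsto
    have h2 := continuousAt_chartCoeff_pullback φ hh he hx
    have hpos : ∀ {k : TwoTensor n M}, (∀ z, IsSymmPosDef (k z)) →
        ∀ y ∈ e.target, (chartCoeff k e y).PosDef := fun hk y hy =>
      (posDef_chartCoeff_iff he.isC1Chart _ hy).2 (hk _)
    have hev : ∀ᶠ y in 𝓝 (e x), y ∈ e.target := e.open_target.mem_nhds (e.map_source hx)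
    have h3 : ContinuousAt (fun y => logDistSq (chartCoeff h e y) (chartCoeff (pullback φ h) e y))
        (e x) :=
      tendsto_logDistSq (hpos hh.1 _ (e.map_source hx)) (hpos hp _ (e.map_source hx))
        (hev.mono (hpos hh.1)) (hev.mono (hpos hp)) h1 h2
    refine (ContinuousAt.comp (f := e) h3 (e.continuousAt hx)).congr ?_
    filter_upwards [e.open_source.mem_nhds hx] with z hz
    have := trLogSq_eq_chartCoeff he.isC1Chart h (pullback φ h) (e.map_source hz) (hh.1 _) (hp _)
    rw [e.left_inv hz] at this
    exact this.symm
  obtain ⟨C, hC⟩ := (isCompact_range hcont).bddAbove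
  rw [fieldDist_lt_top_iff]
  calc ∫⁻ x, ENNReal.ofReal (trLogSq h (pullback φ h) x) ∂μ.measure
      ≤ ∫⁻ _, ENNReal.ofReal C ∂μ.measure :=
        lintegral_mono fun x => ENNReal.ofReal_le_ofReal (hC ⟨x, rfl⟩)
    _ < ⊤ := by
      rw [lintegral_const]
      exact ENNReal.mul_lt_top ENNReal.ofReal_lt_top (measure_univ_lt_top μ)

/-- Pullback by a volumorphism preserves `X`: `δ(φ^*g, h) = δ(g, (φ⁻¹)^*h)`, which is at most
`δ(g, h) + δ(h, (φ⁻¹)^*h)`. -/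
theorem PreservesForm.pullback_mem_roughMetrics (hφ : PreservesForm μ φ)
    (hg : g ∈ roughMetrics μ s) : pullback φ g ∈ roughMetrics μ s := by
  rw [mem_roughMetrics_iff] at hg ⊢
  refine ⟨hg.1.pullback hφ, fun h hh => ?_⟩
  have hh' := isMeasurableMetric_of_mem_sobolevMetrics hh
  have hk := hh'.pullback hφ.symm
  have h1 : fieldDist μ (pullback φ g) h = fieldDist μ g (pullback φ.symm h) := by
    rw [← hφ.fieldDist_pullback hg.1 hk, pullback_symm_pullback]
  rw [h1]
  exact (hg.1.fieldDist_triangle hh' hk).trans_lt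
    (ENNReal.add_lt_top.2 ⟨hg.2 h hh, fieldDist_pullback_lt_top φ.symm hh⟩)

/-- The action of a volumorphism on `X` by pullback. It is well defined on classes of almost
everywhere equal tensor fields because `φ` preserves null sets. -/
noncomputable def pullbackMap (s : ℝ) (hφ : PreservesForm μ φ) (p : RoughSpace μ s) :
    RoughSpace μ s :=
  Quotient.map (sa := roughSetoid μ s) (sb := roughSetoid μ s)
    (fun g => ⟨pullback φ g.1, hφ.pullback_mem_roughMetrics g.2⟩)
    (fun g h hgh => by
      have hgh' : ∀ᵐ x ∂μ.measure, g.1 x = h.1 x := hgh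
      change ∀ᵐ x ∂μ.measure, pullback φ g.1 x = pullback φ h.1 x
      filter_upwards [hφ.measurePreserving.quasiMeasurePreserving.ae hgh'] with x hx
      simp only [pullback, hx]) p

theorem edist_pullbackMap (hφ : PreservesForm μ φ) (p q : RoughSpace μ s) :
    edist (pullbackMap s hφ p) (pullbackMap s hφ q) = edist p q := by
  obtain ⟨g, hg, rfl⟩ := p.exists_rep
  obtain ⟨h, hh, rfl⟩ := q.exists_rep
  exact hφ.fieldDist_pullback (isMeasurableMetric_of_mem_roughMetrics hg)
    (isMeasurableMetric_of_mem_roughMetrics hh)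

end PullbackAction

end FixedVolumeMetrics

theorem theorem3p3 {n : ℕ} {M : Type*} [TopologicalSpace M] [T2Space M] [CompactSpace M]
    [ChartedSpace (EuclideanSpace ℝ (Fin n)) M] [IsManifold (𝓡 n) ∞ M]
    [MeasurableSpace M] [BorelSpace M]
    (μ : FixedVolumeMetrics.VolumeForm n M) (s : ℝ) (hs : (n : ℝ) / 2 < s)
    (φ : M ≃ₘ^1⟮𝓡 n, 𝓡 n⟯ M) (hφ : FixedVolumeMetrics.IsSobolevVolumorphism μ (s + 1) φ) :
    ∃ T : FixedVolumeMetrics.RoughSpace μ s → FixedVolumeMetrics.RoughSpace μ s,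
      FixedVolumeMetrics.IsPullbackAction μ s φ T ∧
      ∀ p : FixedVolumeMetrics.RoughSpace μ s,
        FixedVolumeMetrics.DistBounded (Set.range fun k : ℕ => T^[k] p) →
        ∃ (g : FixedVolumeMetrics.TwoTensor n M) (hg : g ∈ FixedVolumeMetrics.roughMetrics μ s),
          FixedVolumeMetrics.RoughSpace.mk g hg ∈
            FixedVolumeMetrics.distClosure
              (FixedVolumeMetrics.geodHull (Set.range fun k : ℕ => T^[k] p)) ∧
          T (FixedVolumeMetrics.RoughSpace.mk g hg) = FixedVolumeMetrics.RoughSpace.mk g hg ∧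
          ∀ᵐ x ∂μ.measure, FixedVolumeMetrics.pullback φ g x = g x := by
  have hpres := hφ.preservesForm
  refine ⟨FixedVolumeMetrics.pullbackMap s hpres, fun g hg =>
    ⟨hpres.pullback_mem_roughMetrics hg, rfl⟩, fun p hp => ?_⟩
  obtain ⟨c, hc, hfix⟩ := FixedVolumeMetrics.hasConvexGeodesics_roughSpace.exists_fixedPoint
    (FixedVolumeMetrics.edist_pullbackMap hpres) hp
  obtain ⟨g, hg, rfl⟩ := c.exists_rep
  exact ⟨g, hg, hc, hfix, (FixedVolumeMetrics.RoughSpace.mk_eq_iff _ _).1 hfix⟩
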